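/- **Setting.** Let $T\ge 1$, $N\ge 0$, and let $d_j,s_j,\mu_j$ ($1\le j\le r$) be positive integers. Put $d=(d_1,\dots,d_r)$, $n=\sum_j\mu_js_jd_j$, $$\chi(z)=\prod_{j}(1-z^{\mu_js_j})^{d_j}=\sum_{k=0}^{n}e(k)z^k,\qquad \beta(\lambda)=\prod_{j}\prod_{|k|\le[s_j/2]}\Big(i\lambda-\frac{2\pi i k}{s_j}\Big)^{d_j},\qquad \frac1{\chi(z)}=\sum_{k\ge0}d(k)z^k ,$$ and write $\chi=\chi(e^{-i\lambda})$, $\beta=\beta(\lambda)$. Let $\vec\xi(m)$, $m\in\mathbb Z$, be a $\mathbb C^T$-valued stochastic sequence whose increments $\chi\vec\xi(m)=\sum_{k=0}^n e(k)\vec\xi(m-k)$ have mean zero and are stationary with spectral density $f$, that is, $\mathsf E\,\chi\xi_p(m)\overline{\chi\xi_q(k)}=\frac1{2\pi}\int_{-\pi}^{\pi}e^{i\lambda(m-k)}\frac{|\chi|^2}{|\beta|^2}f_{pq}\,d\lambda$. Let $\vec\eta$ be a mean-zero stationary sequence with spectral density $g$, uncorrelated with $\vec\xi$, and put $\vec\zeta=\vec\xi+\vec\eta$,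 $p=f+|\beta|^2g$. Here $f,g$ are measurable and take positive semidefinite matrices as values, and $\frac{|\chi|^2}{|\beta|^2}f$ and $g$ are integrable on $(-\pi,\pi]$. The functional $A_N\vec\xi=\sum_{k=0}^N\vec a(k)^\top\vec\xi(k)$, $\vec a(k)\in\mathbb C^T$, is estimated from $\vec\zeta(m)$, $m\in\mathbb Z\setminus\{0,\dots,N\}$. Put $\vec b(k)=\sum_{m=k}^N d(m-k)\vec a(m)$, $A(\lambda)=\sum_{k=0}^N\vec a(k)e^{ik\lambda}$, $B(\lambda)=\sum_{k=0}^N\vec b(k)e^{ik\lambda}$. Then $A_N\vec\zeta=\sum_{k=0}^N\vec b(k)^\top\chi\vec\zeta(k)-V_N\vec\zeta$, where $V_N\vec\zeta$ is a linear combination of $\vec\zeta(-n),\dots,\vec\zeta(-1)$. Let $L_2(p)$ have the inner product $\int_{-\pi}^{\pi}u^\top p\,\overline v\,d\lambda$, and let $L(p)\subset L_2(p)$ be the closed subspace generated by the functions $e^{ik\lambda}\frac{\chi}{\beta}\vec\delta_l$, $1\le l\le T$, with $k\le-1$ or $k\ge N+n+1$ ($\vec\delta_l$ are the standard basis vectors).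 The linear estimates are $\widehat A=\widehat H_h-V_N\vec\zeta$ with spectral characteristic $h\in L(p)$, where $h\mapsto\widehat H_h$ is the linear mean-square continuous map that sends $e^{ik\lambda}\frac{\chi}{\beta}\vec\delta_l$ to $\chi\zeta_l(k)$. Their mean-square error $\Delta(h;f,g)=\mathsf E|A_N\vec\xi-\widehat A|^2$ is $$\Delta(h;f,g)=\frac1{2\pi}\int_{-\pi}^{\pi}\Big(u^\top f\,\overline u+(\beta u-A)^\top g\,\overline{(\beta u-A)}\Big)d\lambda,\qquad u=B\frac{\chi}{\beta}-h .$$ Let $h(f,g)\in L(p)$ be the minimizer of $\Delta(\cdot;f,g)$ over $L(p)$, and $\Delta(f,g)=\Delta(h(f,g);f,g)$. The *minimality condition* for $(f,g)$ is that $p$ is invertible a.e. and $\int_{-\pi}^{\pi}\operatorname{Tr}\big[\frac{|\beta|^2}{|\chi|^2}p^{-1}\big]d\lambda<\infty$. Under it, let $\mathbf T,\mathbf P$ be the block matrices with blocks indexed by $0\le j,k\le N+n$, and $\mathbf Q$ the block matrix with blocks indexed by $0\le j,k\le N$, whose $(j,k)$ blocks are $\frac1{2\pi}\int_{-\pi}^{\pi}e^{i\lambda(k-j)}F(\lambda)^\top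 d\lambda$ with, respectively, $$F=\frac{|\beta|^2}{\chi}\,g\,p^{-1},\qquad F=\frac{|\beta|^2}{|\chi|^2}\,p^{-1},\qquad F=f\,p^{-1}g .$$ Let $[D\mathbf a]$ be $(\vec b(0),\dots,\vec b(N))$ extended by $n$ zero blocks; in $\mathbf T\mathbf a$ the vector $\mathbf a=(\vec a(0),\dots,\vec a(N))$ is extended by $n$ zero blocks as well. With $\langle x,y\rangle=\sum_i x_i\overline{y_i}$, put $$E(f,g)=\big\langle [D\mathbf a]-\mathbf T\mathbf a,\ \mathbf P^{-1}([D\mathbf a]-\mathbf T\mathbf a)\big\rangle+\langle\mathbf Q\mathbf a,\mathbf a\rangle .$$ **Lemma 3.1.** Let $\mathcal D_f,\mathcal D_g$ be sets of spectral densities as above, and let $f^0\in\mathcal D_f$, $g^0\in\mathcal D_g$ satisfy the minimality condition and solve the maximization problem $$E(f^0,g^0)=\max E(f,g),$$ the maximum being over all $(f,g)\in\mathcal D_f\times\mathcal D_g$ that satisfy the minimality condition (so that $E(f,g)$ is defined). 1. If all pairs in $\mathcal D_f\times\mathcal D_g$ satisfy the minimality condition, or if $\mathcal D_f$ and $\mathcal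 D_g$ are convex, then $f^0,g^0$ are least favorable in $\mathcal D_f\times\mathcal D_g$: $\Delta(f^0,g^0)=\max_{(f,g)\in\mathcal D_f\times\mathcal D_g}\Delta(f,g)$. 2. The optimal spectral characteristic $h^0=h(f^0,g^0)$ is given by $$(h^0)^\top=B^\top\frac{\chi}{\beta}-A^\top g^0\,\overline\beta\,(p^0)^{-1}-C^\top\,\frac{\overline\beta}{\overline\chi}\,(p^0)^{-1},\qquad p^0=f^0+|\beta|^2g^0,\quad C(\lambda)=\sum_{k=0}^{N+n}\vec c(k)e^{ik\lambda},$$ where $(\vec c(0),\dots,\vec c(N+n))=(\mathbf P^0)^{-1}([D\mathbf a]-\mathbf T^0\mathbf a)$, and $\mathbf P^0,\mathbf T^0$ are the matrices $\mathbf P,\mathbf T$ for $(f^0,g^0)$. If $\mathcal D_f$ and $\mathcal D_g$ are convex and $h^0\in H_{\mathcal D}=\bigcap_{(f,g)\in\mathcal D_f\times\mathcal D_g}L(f+|\beta|^2g)$, then $h^0$ is the minimax (robust) spectral characteristic: $\max_{(f,g)\in\mathcal D_f\times\mathcal D_g}\Delta(h^0;f,g)$ is attained, and $$\max_{(f,g)\in\mathcal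 D_f\times\mathcal D_g}\Delta(h^0;f,g)=\min_{h\in H_{\mathcal D}}\ \sup_{(f,g)\in\mathcal D_f\times\mathcal D_g}\Delta(h;f,g).$$ -/

import Mathlib

open MeasureTheory
open scoped ENNReal ComplexOrder

noncomputable section

namespace GMInterp

/-! ## The increment operator -/

/-- Parameters of the generalized multiple increment operator
`∏ⱼ (1 - B_{μⱼ}^{sⱼ})^{dⱼ}`, all of them positive integers. -/
structure Pattern where
  r : ℕ
  d : Fin r → ℕ
  s : Fin r → ℕ
  μ : Fin r → ℕ
  d_pos : ∀ j, 0 < d j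
  s_pos : ∀ j, 0 < s j
  μ_pos : ∀ j, 0 < μ j

namespace Pattern

/-- `n(γ) = ∑ⱼ μⱼ sⱼ dⱼ`. -/
def n (γ : Pattern) : ℕ := ∑ j, γ.μ j * γ.s j * γ.d j

/-- The increment operator as a polynomial in the backward shift. -/
def incPoly (γ : Pattern) : Polynomial ℂ :=
  ∏ j, (1 - Polynomial.X ^ (γ.μ j * γ.s j)) ^ γ.d j

/-- `e_γ(k)`, the coefficients of the increment operator. -/
def e (γ : Pattern) (k : ℕ) : ℂ := γ.incPoly.coeff k

/-- `d_μ(k)`, the coefficients of `∏ⱼ (∑_i x^{μⱼ sⱼ i})^{dⱼ}`. -/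
def dcoef (γ : Pattern) (k : ℕ) : ℂ :=
  PowerSeries.coeff k
    (∏ j, (PowerSeries.mk fun m : ℕ => if γ.μ j * γ.s j ∣ m then (1 : ℂ) else 0) ^ γ.d j)

/-- `χ(e^{-ix}) = ∏ⱼ (1 - e^{-i x μⱼ sⱼ})^{dⱼ}`. -/
def chi (γ : Pattern) (x : ℝ) : ℂ :=
  ∏ j, (1 - Complex.exp (-(Complex.I * x * (γ.μ j * γ.s j : ℕ)))) ^ γ.d j

/-- `β(ix) = ∏ⱼ ∏_{|k| ≤ [sⱼ/2]} (ix - 2πik/sⱼ)^{dⱼ}`. -/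
def beta (γ : Pattern) (x : ℝ) : ℂ :=
  ∏ j, ∏ k ∈ Finset.Icc (-((γ.s j / 2 : ℕ) : ℤ)) ((γ.s j / 2 : ℕ) : ℤ),
    (Complex.I * x - 2 * Real.pi * Complex.I * (k : ℂ) / (γ.s j : ℂ)) ^ γ.d j

end Pattern

/-! ## Spectral densities -/

/-- Lebesgue measure on one period. -/
def circ : Measure ℝ := volume.restrict (Set.Ioc (-Real.pi) Real.pi)

/-- Matrix-valued functions of the frequency. -/
abbrev MatFun (T : ℕ) : Type := ℝ → Matrix (Fin T) (Fin T) ℂ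

/-- Vector-valued functions of the frequency. -/
abbrev VecFun (T : ℕ) : Type := ℝ → Fin T → ℂ

variable {T : ℕ}

/-- Spectral density of a vector sequence with stationary increments: measurable, positive
semidefinite, and such that the increments have finite variance. -/
structure IsSignalDensity (γ : Pattern) (f : MatFun T) : Prop where
  meas : ∀ p q, AEStronglyMeasurable (fun x => f x p q) circ
  psd : ∀ᵐ x ∂circ, (f x).PosSemidef
  integrable : ∀ p q,
    Integrable (fun x => ((‖γ.chi x‖ ^ 2 / ‖γ.beta x‖ ^ 2 : ℝ) : ℂ) * f x p q) circ

/-- Spectral density of a stationary vector sequence. -/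
structure IsNoiseDensity (g : MatFun T) : Prop where
  psd : ∀ᵐ x ∂circ, (g x).PosSemidef
  integrable : ∀ p q, Integrable (fun x => g x p q) circ

/-- `f + |β|² g`, the spectral density of signal plus noise. -/
def obsDensity (γ : Pattern) (f g : MatFun T) : MatFun T :=
  fun x => f x + ((‖γ.beta x‖ ^ 2 : ℝ) : ℂ) • g x

/-- The minimality condition `∫ Tr[|β|²/|χ|² (f + |β|² g)⁻¹] < ∞`; the inverse is required to exist
almost everywhere. -/
def MinimalityCondition (γ : Pattern) (f g : MatFun T) : Prop :=
  (∀ᵐ x ∂circ, IsUnit (obsDensity γ f g x).det) ∧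
  Integrable (fun x => ((‖γ.beta x‖ ^ 2 / ‖γ.chi x‖ ^ 2 : ℝ) : ℂ) *
    ((obsDensity γ f g x)⁻¹).trace) circ

/-! ## Spectral characteristics and their mean-square errors -/

/-- The quadratic form `uᵀ p ū` (real and nonnegative for positive semidefinite `p`). -/
def quad (p : Matrix (Fin T) (Fin T) ℂ) (u : Fin T → ℂ) : ℝ :=
  (u ⬝ᵥ p.mulVec (star u)).re

/-- The squared norm `∫ hᵀ p h̄` of `L₂(p)`. -/
def normSq (p : MatFun T) (h : VecFun T) : ℝ≥0∞ :=
  ∫⁻ x, ENNReal.ofReal (quad (p x) (h x)) ∂circ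

/-- `∑ₖ c(k) e^{ixk} χ(e^{-ix}) / β(ix)`, the spectral characteristic of the random variable
`∑ₖ c(k)ᵀ χζ(k)`. -/
def trig (γ : Pattern) (c : ℤ →₀ (Fin T → ℂ)) : VecFun T :=
  fun x p => (∑ k ∈ c.support, c k p * Complex.exp (Complex.I * x * k)) * (γ.chi x / γ.beta x)

/-- The coefficients only involve increments of observed values: the increment at `k` uses the
values at `k - n(γ), …, k`, and these avoid `0, …, N` when `k ≤ -1` or `k ≥ N + n(γ) + 1`. -/
def Observed (γ : Pattern) (N : ℕ) (c : ℤ →₀ (Fin T → ℂ)) : Prop :=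
  ∀ k ∈ c.support, k ≤ -1 ∨ (N : ℤ) + γ.n + 1 ≤ k

/-- The closed subspace of `L₂(p)` generated by the functions `e^{ixk} χ(e^{-ix}) / β(ix) δ_l`,
`k ≤ -1` or `k ≥ N + n(γ) + 1`. -/
def obsSpace (γ : Pattern) (N : ℕ) (p : MatFun T) : Set (VecFun T) :=
  {h | (∀ l, AEStronglyMeasurable (fun x => h x l) circ) ∧
    ∀ ε : ℝ≥0∞, 0 < ε → ∃ c : ℤ →₀ (Fin T → ℂ), Observed γ N c ∧ normSq p (h - trig γ c) < ε}

/-- `b(k) = ∑_{m=k}^N d_μ(m-k) a(m)` for `k ≤ N`, and `0` for `k > N`; this is the vector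
`[D a]`, already extended by zeros. -/
def bvec (γ : Pattern) {N : ℕ} (a : Fin (N + 1) → Fin T → ℂ) (k : ℕ) : Fin T → ℂ :=
  fun p => ∑ m : Fin (N + 1), if k ≤ (m : ℕ) then γ.dcoef (m - k) * a m p else 0

/-- `A(e^{ix}) = ∑_{k=0}^N a(k) e^{ixk}`. -/
def Afun {N : ℕ} (a : Fin (N + 1) → Fin T → ℂ) : VecFun T :=
  fun x p => ∑ k : Fin (N + 1), a k p * Complex.exp (Complex.I * x * (k : ℕ))

/-- `B(e^{ix}) = ∑_{k=0}^N b(k) e^{ixk}`. -/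
def Bfun (γ : Pattern) {N : ℕ} (a : Fin (N + 1) → Fin T → ℂ) : VecFun T :=
  fun x p => ∑ k : Fin (N + 1), bvec γ a k p * Complex.exp (Complex.I * x * (k : ℕ))

/-- `u = B χ/β - h`: the error of the estimate with spectral characteristic `h` is
`∫ uᵀ dZ_ξ + ∫ (β u - A)ᵀ dZ_η`. -/
def errFun (γ : Pattern) {N : ℕ} (a : Fin (N + 1) → Fin T → ℂ) (h : VecFun T) : VecFun T :=
  fun x => (γ.chi x / γ.beta x) • Bfun γ a x - h x

/-- `Δ(h; f, g)`, the mean-square error of the estimate with spectral characteristic `h` when the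
spectral densities are `f` and `g`. -/
def mse (γ : Pattern) {N : ℕ} (a : Fin (N + 1) → Fin T → ℂ) (h : VecFun T) (f g : MatFun T) :
    ℝ≥0∞ :=
  ENNReal.ofReal (1 / (2 * Real.pi)) *
    ∫⁻ x, ENNReal.ofReal (quad (f x) (errFun γ a h x) +
      quad (g x) (γ.beta x • errFun γ a h x - Afun a x)) ∂circ

/-- `Δ(f, g)`, the mean-square error of the optimal linear estimate. -/
def minMse (γ : Pattern) {N : ℕ} (a : Fin (N + 1) → Fin T → ℂ) (f g : MatFun T) : ℝ≥0∞ :=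
  ⨅ h ∈ obsSpace γ N (obsDensity γ f g), mse γ a h f g

/-- `h` is the spectral characteristic of the optimal linear estimate for `f`, `g`. -/
def IsOptimal (γ : Pattern) {N : ℕ} (a : Fin (N + 1) → Fin T → ℂ) (h : VecFun T)
    (f g : MatFun T) : Prop :=
  h ∈ obsSpace γ N (obsDensity γ f g) ∧ mse γ a h f g = minMse γ a f g

/-- Least favorable spectral densities in `Df × Dg`:
`Δ(h(f₀,g₀); f₀, g₀) = max Δ(h(f,g); f, g)` over `Df × Dg`, where `h(f,g)` is optimal for `f, g`. -/
def LeastFavorable (γ : Pattern) {N : ℕ} (a : Fin (N + 1) → Fin T → ℂ) (Df Dg : Set (MatFun T))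
    (f₀ g₀ : MatFun T) : Prop :=
  f₀ ∈ Df ∧ g₀ ∈ Dg ∧ ∃ h₀, IsOptimal γ a h₀ f₀ g₀ ∧
    ∀ f ∈ Df, ∀ g ∈ Dg, minMse γ a f g ≤ mse γ a h₀ f₀ g₀

/-- `H_D`, the characteristics that are admissible for all densities of `Df × Dg`. -/
def HD (γ : Pattern) (N : ℕ) (Df Dg : Set (MatFun T)) : Set (VecFun T) :=
  {h | ∀ f ∈ Df, ∀ g ∈ Dg, h ∈ obsSpace γ N (obsDensity γ f g)}

/-- The largest mean-square error of `h` over `Df × Dg`. -/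
def worstMse (γ : Pattern) {N : ℕ} (a : Fin (N + 1) → Fin T → ℂ) (Df Dg : Set (MatFun T))
    (h : VecFun T) : ℝ≥0∞ :=
  ⨆ f ∈ Df, ⨆ g ∈ Dg, mse γ a h f g

/-- Minimax (robust) spectral characteristic: it lies in `H_D`, its largest error over
`Df × Dg` is attained, and this error is minimal over `H_D`. -/
def IsMinimax (γ : Pattern) {N : ℕ} (a : Fin (N + 1) → Fin T → ℂ) (Df Dg : Set (MatFun T))
    (h₀ : VecFun T) : Prop :=
  h₀ ∈ HD γ N Df Dg ∧
  (∃ f ∈ Df, ∃ g ∈ Dg, mse γ a h₀ f g = worstMse γ a Df Dg h₀) ∧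
  ∀ h ∈ HD γ N Df Dg, worstMse γ a Df Dg h₀ ≤ worstMse γ a Df Dg h

/-! ## Matrices of Fourier coefficients -/

/-- The matrix of the operation `(v(k))ₖ ↦ (j-th Fourier coefficient of (∑ₖ v(k)ᵀ e^{ikx}) F)ⱼ`:
its block `(j, k)` is `(2π)⁻¹ ∫ e^{ix(k-j)} F(x)ᵀ dx`. -/
def fourierBlock (L : ℕ) (F : MatFun T) : Matrix (Fin L × Fin T) (Fin L × Fin T) ℂ :=
  fun jp kq => (1 / (2 * Real.pi) : ℂ) *
    ∫ x, Complex.exp (Complex.I * x * (((kq.1 : ℕ) : ℂ) - ((jp.1 : ℕ) : ℂ))) * F x kq.2 jp.2 ∂circ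

/-- `T`, from the function `|β|² / χ(e^{-ix}) · g (f + |β|² g)⁻¹`. -/
def Tmat (γ : Pattern) (N : ℕ) (f g : MatFun T) :
    Matrix (Fin (N + γ.n + 1) × Fin T) (Fin (N + γ.n + 1) × Fin T) ℂ :=
  fourierBlock _ fun x =>
    (((‖γ.beta x‖ ^ 2 : ℝ) : ℂ) / γ.chi x) • (g x * (obsDensity γ f g x)⁻¹)

/-- `P`, from the function `|β|² / |χ|² · (f + |β|² g)⁻¹`. -/
def Pmat (γ : Pattern) (N : ℕ) (f g : MatFun T) :
    Matrix (Fin (N + γ.n + 1) × Fin T) (Fin (N + γ.n + 1) × Fin T) ℂ :=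
  fourierBlock _ fun x =>
    ((‖γ.beta x‖ ^ 2 / ‖γ.chi x‖ ^ 2 : ℝ) : ℂ) • (obsDensity γ f g x)⁻¹

/-- `Q`, from the function `f (f + |β|² g)⁻¹ g`. -/
def Qmat (γ : Pattern) (N : ℕ) (f g : MatFun T) :
    Matrix (Fin (N + 1) × Fin T) (Fin (N + 1) × Fin T) ℂ :=
  fourierBlock _ fun x => f x * (obsDensity γ f g x)⁻¹ * g x

/-- `[D a] - T a`, where both `D a` and `a` are extended by `n(γ)` zero blocks. -/
def resid (γ : Pattern) {N : ℕ} (a : Fin (N + 1) → Fin T → ℂ) (f g : MatFun T) :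
    Fin (N + γ.n + 1) × Fin T → ℂ :=
  (fun jp => bvec γ a jp.1 jp.2) -
    (Tmat γ N f g).mulVec fun kq => if h : (kq.1 : ℕ) < N + 1 then a ⟨kq.1, h⟩ kq.2 else 0

/-- `c = P⁻¹ ([D a] - T a)`. -/
def cvec (γ : Pattern) {N : ℕ} (a : Fin (N + 1) → Fin T → ℂ) (f g : MatFun T) :
    Fin (N + γ.n + 1) × Fin T → ℂ :=
  (Pmat γ N f g)⁻¹.mulVec (resid γ a f g)

/-- The error expression `⟨[D a] - T a, P⁻¹([D a] - T a)⟩ + ⟨Q a, a⟩`, with `⟨x, y⟩ = ∑ xᵢ ȳᵢ`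
(a real number under the minimality condition). -/
def errorValue (γ : Pattern) {N : ℕ} (a : Fin (N + 1) → Fin T → ℂ) (f g : MatFun T) : ℝ :=
  (resid γ a f g ⬝ᵥ star (cvec γ a f g)).re +
    ((Qmat γ N f g).mulVec (fun kq => a kq.1 kq.2) ⬝ᵥ star (fun kq => a kq.1 kq.2)).re

/-- `C(e^{ix}) = ∑_{k=0}^{N+n(γ)} c(k) e^{ixk}`. -/
def Cfun (γ : Pattern) {N : ℕ} (a : Fin (N + 1) → Fin T → ℂ) (f g : MatFun T) : VecFun T :=
  fun x p => ∑ k : Fin (N + γ.n + 1), cvec γ a f g (k, p) * Complex.exp (Complex.I * x * (k : ℕ))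

/-- The explicit spectral characteristic: with `p = f + |β|² g`,
`hᵀ = Bᵀ χ/β - Aᵀ g β̄ p⁻¹ - Cᵀ (β̄ / χ̄) p⁻¹`. -/
def specChar (γ : Pattern) {N : ℕ} (a : Fin (N + 1) → Fin T → ℂ) (f g : MatFun T) : VecFun T :=
  fun x => (γ.chi x / γ.beta x) • Bfun γ a x
    - Matrix.vecMul (Afun a x) (star (γ.beta x) • (g x * (obsDensity γ f g x)⁻¹))
    - Matrix.vecMul (Cfun γ a f g x)
        ((star (γ.beta x) / star (γ.chi x)) • (obsDensity γ f g x)⁻¹)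

/-! ## The stochastic sequences -/

section Stochastic

variable {Ω : Type*} [MeasurableSpace Ω]

/-- The increment of a vector sequence, `∑_{k=0}^{n(γ)} e_γ(k) y_p(m - k)`. -/
def incr (γ : Pattern) (y : ℤ → Fin T → Ω → ℂ) (m : ℤ) (p : Fin T) : Ω → ℂ :=
  fun ω => ∑ k ∈ Finset.range (γ.n + 1), γ.e k * y (m - k) p ω

/-- `ξ` has zero-mean stationary increments with spectral density `f`, `η` is zero-mean stationary
with spectral density `g`, and they are uncorrelated. -/
structure IsModel (γ : Pattern) (P : Measure Ω) (ξ η : ℤ → Fin T → Ω → ℂ) (f g : MatFun T) :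
    Prop where
  meas : ∀ m p, AEStronglyMeasurable (ξ m p) P
  incr_memLp : ∀ m p, MemLp (incr γ ξ m p) 2 P
  incr_mean : ∀ m p, ∫ ω, incr γ ξ m p ω ∂P = 0
  incr_cov : ∀ m k p q, ∫ ω, incr γ ξ m p ω * star (incr γ ξ k q ω) ∂P =
    (1 / (2 * Real.pi) : ℂ) * ∫ x, Complex.exp (Complex.I * x * ((m : ℂ) - (k : ℂ))) *
      (((‖γ.chi x‖ ^ 2 / ‖γ.beta x‖ ^ 2 : ℝ) : ℂ) * f x p q) ∂circ
  noise_memLp : ∀ m p, MemLp (η m p) 2 P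
  noise_mean : ∀ m p, ∫ ω, η m p ω ∂P = 0
  noise_cov : ∀ m k p q, ∫ ω, η m p ω * star (η k q ω) ∂P =
    (1 / (2 * Real.pi) : ℂ) * ∫ x, Complex.exp (Complex.I * x * ((m : ℂ) - (k : ℂ))) *
      g x p q ∂circ
  uncorrelated : ∀ m k p q, ∫ ω, incr γ ξ m p ω * star (η k q ω) ∂P = 0

/-- The functional `A_N y = ∑_{k=0}^N a(k)ᵀ y(k)`. -/
def functionalA {N : ℕ} (a : Fin (N + 1) → Fin T → ℂ) (y : ℤ → Fin T → Ω → ℂ) : Ω → ℂ :=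
  fun ω => ∑ k : Fin (N + 1), ∑ p, a k p * y ((k : ℕ) : ℤ) p ω

/-- `V_N y = ∑_{k=-n(γ)}^{-1} v(k)ᵀ y(k)` with `v(k) = ∑_{l=0}^N e_γ(l-k) b(l)`; the sum below runs
over `-k`. It depends only on observed values. -/
def functionalV (γ : Pattern) {N : ℕ} (a : Fin (N + 1) → Fin T → ℂ) (y : ℤ → Fin T → Ω → ℂ) :
    Ω → ℂ :=
  fun ω => ∑ k ∈ Finset.Icc 1 γ.n, ∑ p,
    (∑ l ∈ Finset.range (N + 1), γ.e (l + k) * bvec γ a l p) * y (-(k : ℤ)) p ω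

/-- `H` is the random variable `∫ hᵀ dZ` with spectral characteristic `h`: finite combinations of
observed increments of `ξ + η` converge to `H` in mean square while their spectral characteristics
converge to `h` in `L₂(f + |β|² g)`. -/
def HasCharacteristic (γ : Pattern) (N : ℕ) (P : Measure Ω) (ξ η : ℤ → Fin T → Ω → ℂ)
    (f g : MatFun T) (h : VecFun T) (H : Ω → ℂ) : Prop :=
  AEStronglyMeasurable H P ∧
  ∀ ε : ℝ≥0∞, 0 < ε → ∃ c : ℤ →₀ (Fin T → ℂ), Observed γ N c ∧
    normSq (obsDensity γ f g) (h - trig γ c) < ε ∧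
    ∫⁻ ω, ‖H ω - ∑ k ∈ c.support, ∑ p, c k p * incr γ (ξ + η) k p ω‖ₑ ^ 2 ∂P < ε

/-- `E |A_N ξ - Â|²` for the estimate `Â = H - V_N (ξ + η)`. -/
def estimateError (γ : Pattern) {N : ℕ} (a : Fin (N + 1) → Fin T → ℂ) (P : Measure Ω)
    (ξ η : ℤ → Fin T → Ω → ℂ) (H : Ω → ℂ) : ℝ≥0∞ :=
  ∫⁻ ω, ‖functionalA a ξ ω - (H ω - functionalV γ a (ξ + η) ω)‖ₑ ^ 2 ∂P

end Stochastic

end GMInterp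

end

open GMInterp

/-!
With `p = f + |β|² g`, completing the square (`quad_add_quad_sub_eq`) turns the error density into
`Aᵀ f p⁻¹ g Ā` plus the squared `p`-distance of `h` from `B χ/β - Aᵀ β̄ g p⁻¹`. The optimal
characteristic is therefore the projection of that function onto the observed subspace `L(p)`.
Under the minimality condition the orthogonal complement of `L(p)` in `L₂(p)` consists of the
functions `Cᵀ (β̄/χ̄) p⁻¹` with `C` a trigonometric polynomial with frequencies `0, …, N + n`. It
suffices to know that a function of `L₂(p)` orthogonal to all of these lies in `L(p)`
(`IsMinimalWeight.mem_obsSpace`). This follows from the density of all trigonometric polynomials,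
because the unobserved coefficients of a polynomial close to such a function are small and can be
dropped. The orthogonality relations are the linear system `P c = [D a] - T a`, which is solvable
since `P` is the Gram matrix of linearly independent functions. Evaluating the norms gives the
Pythagorean identity `mse_eq`: `Δ(h; f, g)` is the error expression plus the squared distance of `h`
from the explicit characteristic.

For a fixed characteristic `Δ(h; f, g)` is affine in `(f, g)`, so the minimal error is concave. For
convex classes, mixtures of `(f₀, g₀)` with an arbitrary pair satisfy the minimality condition, and
concavity along the segment shows that `(f₀, g₀)` is least favorable. If `hₜ` is optimal for the
mixture with weight `t` on `(f, g)`, the Pythagorean identity at `(f₀, g₀)` yields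
`Δ(hₜ; f, g) ≤ Δ(f₀, g₀)` and `‖hₜ - h₀‖² = O(t)` in `L₂(p₀)`. Along `t = 2⁻ⁿ⁻¹` the functions `hₜ`
converge almost everywhere to `h₀`, and Fatou's lemma gives the saddle point inequality
`Δ(h₀; f, g) ≤ Δ(f₀, g₀)` (`mse_specChar_le`).

The probabilistic meaning of `Δ(h; f, g)` is the isometry `spectralSpan_secondMoment` between the
linear span of the increments and noise values and their spectral representations, extended to
limits by the inequality `‖u + v‖² ≤ (1 + t) ‖u‖² + (1 + t⁻¹) ‖v‖²`.
-/

namespace GMInterp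

variable {T : ℕ}

/-! ### Pointwise matrix algebra -/

/-- The sesquilinear form `uᵀ M v̄`, conjugate-linear in the second argument; `quad M u` is its
real part on the diagonal. -/
def form (M : Matrix (Fin T) (Fin T) ℂ) (u v : Fin T → ℂ) : ℂ :=
  u ⬝ᵥ M.mulVec (star v)

section Pointwise

variable {M M' : Matrix (Fin T) (Fin T) ℂ} {u v w : Fin T → ℂ}

lemma form_eq_sum (M : Matrix (Fin T) (Fin T) ℂ) (u v : Fin T → ℂ) :
    form M u v = ∑ i, ∑ j, u i * (M i j * star (v j)) := by
  simp [form, dotProduct, Matrix.mulVec, Finset.mul_sum]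

lemma form_add_left : form M (u + v) w = form M u w + form M v w := add_dotProduct _ _ _

lemma form_smul_left (c : ℂ) : form M (c • u) v = c * form M u v := by
  simp [form, smul_dotProduct]

lemma form_add_right : form M u (v + w) = form M u v + form M u w := by
  simp [form, Matrix.mulVec_add, dotProduct_add]

lemma form_smul_right (c : ℂ) : form M u (c • v) = star c * form M u v := by
  simp [form, Matrix.mulVec_smul, dotProduct_smul]

lemma form_add_matrix : form (M + M') u v = form M u v + form M' u v := by
  simp [form, Matrix.add_mulVec, dotProduct_add]

lemma form_smul_matrix (c : ℂ) : form (c • M) u v = c * form M u v := by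
  simp [form, Matrix.smul_mulVec, dotProduct_smul]

lemma star_form (hM : M.IsHermitian) (u v : Fin T → ℂ) : star (form M u v) = form M v u := by
  simp only [form_eq_sum, star_sum, star_mul']
  rw [Finset.sum_comm]
  refine Finset.sum_congr rfl fun j _ => Finset.sum_congr rfl fun i _ => ?_
  rw [hM.apply j i, star_star]
  ring

lemma form_self_nonneg (hM : M.PosSemidef) (u : Fin T → ℂ) : 0 ≤ form M u u := by
  have := hM.dotProduct_mulVec_nonneg (star u)
  rwa [star_star] at this

lemma quad_nonneg (hM : M.PosSemidef) (u : Fin T → ℂ) : 0 ≤ quad M u :=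
  (Complex.le_def.1 (form_self_nonneg hM u)).1

lemma form_self (hM : M.PosSemidef) (u : Fin T → ℂ) : form M u u = (quad M u : ℂ) := by
  apply Complex.ext
  · simp [quad, form]
  · simpa using (Complex.le_def.1 (form_self_nonneg hM u)).2.symm

lemma quad_eq_re_form (M : Matrix (Fin T) (Fin T) ℂ) (u : Fin T → ℂ) :
    quad M u = (form M u u).re := rfl

lemma quad_zero_vec (M : Matrix (Fin T) (Fin T) ℂ) : quad M 0 = 0 := by simp [quad]

lemma quad_add_matrix : quad (M + M') u = quad M u + quad M' u := by
  simp [quad_eq_re_form, form_add_matrix]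

lemma quad_smul_matrix (c : ℝ) : quad ((c : ℂ) • M) u = c * quad M u := by
  rw [quad_eq_re_form, form_smul_matrix, Complex.re_ofReal_mul]
  rfl

lemma quad_smul (c : ℂ) : quad M (c • u) = ‖c‖ ^ 2 * quad M u := by
  rw [quad_eq_re_form, form_smul_left, form_smul_right, ← mul_assoc, quad_eq_re_form]
  have : c * star c = ((‖c‖ ^ 2 : ℝ) : ℂ) := by
    rw [Complex.star_def, Complex.mul_conj, Complex.normSq_eq_norm_sq]
  rw [this, Complex.re_ofReal_mul]

lemma quad_neg : quad M (-u) = quad M u := by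
  simpa using quad_smul (M := M) (u := u) (-1)

lemma quad_sub_comm : quad M (u - v) = quad M (v - u) := by
  rw [← quad_neg, neg_sub]

lemma quad_add (hM : M.PosSemidef) :
    quad M (u + v) = quad M u + 2 * (form M u v).re + quad M v := by
  have h : (form M v u).re = (form M u v).re := by
    rw [← star_form hM.1 u v]; simp
  simp only [quad_eq_re_form, form_add_left, form_add_right, Complex.add_re, h]
  ring

/-- Weighted arithmetic–geometric form of the Cauchy–Schwarz inequality. -/
lemma two_mul_norm_form_le (hM : M.PosSemidef) {t : ℝ} (ht : 0 < t) (u v : Fin T → ℂ) :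
    2 * ‖form M u v‖ ≤ t * quad M u + t⁻¹ * quad M v := by
  obtain ⟨z, hz, hzf⟩ : ∃ z : ℂ, ‖z‖ = 1 ∧ z * form M u v = -(‖form M u v‖ : ℂ) := by
    by_cases h : form M u v = 0
    · exact ⟨1, by simp, by simp [h]⟩
    · have h' : (‖form M u v‖ : ℂ) ≠ 0 := by simpa using h
      refine ⟨-star (form M u v) / ‖form M u v‖, by simp [h], ?_⟩
      have : star (form M u v) * form M u v = (‖form M u v‖ : ℂ) ^ 2 := by
        rw [mul_comm, Complex.star_def, Complex.mul_conj, Complex.normSq_eq_norm_sq]; simp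
      field_simp
      rw [this]
  have hs : 0 < Real.sqrt t := Real.sqrt_pos.2 ht
  have h := quad_nonneg hM (((Real.sqrt t : ℂ) * z) • u + ((Real.sqrt t)⁻¹ : ℂ) • v)
  rw [quad_add hM, form_smul_left, form_smul_right, quad_smul, quad_smul] at h
  have e1 : (Real.sqrt t : ℂ) * z * (star ((Real.sqrt t)⁻¹ : ℂ) * form M u v)
      = -(‖form M u v‖ : ℂ) := by
    have hs' : (Real.sqrt t : ℂ) ≠ 0 := by exact_mod_cast hs.ne'
    rw [← hzf]
    simp only [star_inv₀, Complex.star_def, Complex.conj_ofReal]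
    field_simp
  have e2 : ‖(Real.sqrt t : ℂ) * z‖ ^ 2 = t := by
    rw [norm_mul, hz, mul_one, Complex.norm_real, Real.norm_eq_abs, sq_abs, Real.sq_sqrt ht.le]
  have e3 : ‖((Real.sqrt t)⁻¹ : ℂ)‖ ^ 2 = t⁻¹ := by
    rw [norm_inv, Complex.norm_real, Real.norm_eq_abs, inv_pow, sq_abs, Real.sq_sqrt ht.le]
  rw [e1, e2, e3] at h
  simp only [Complex.neg_re, Complex.ofReal_re] at h
  linarith

lemma norm_form_le (hM : M.PosSemidef) (u v : Fin T → ℂ) :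
    ‖form M u v‖ ≤ quad M u + quad M v := by
  have := two_mul_norm_form_le hM one_pos u v
  have := norm_nonneg (form M u v)
  simp only [inv_one, one_mul] at *
  linarith

lemma quad_add_le (hM : M.PosSemidef) {t : ℝ} (ht : 0 < t) (u v : Fin T → ℂ) :
    quad M (u + v) ≤ (1 + t) * quad M u + (1 + t⁻¹) * quad M v := by
  have h1 := two_mul_norm_form_le hM ht u v
  have h2 := Complex.re_le_norm (form M u v)
  rw [quad_add hM]
  linarith

lemma form_single (M : Matrix (Fin T) (Fin T) ℂ) (i j : Fin T) :
    form M (Pi.single i 1) (Pi.single j 1) = M i j := by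
  rw [form_eq_sum, Finset.sum_eq_single i, Finset.sum_eq_single j] <;>
    simp +contextual [Pi.single_apply]

lemma trace_re_eq_sum (M : Matrix (Fin T) (Fin T) ℂ) :
    M.trace.re = ∑ i, quad M (Pi.single i 1) := by
  simp [Matrix.trace, quad_eq_re_form, form_single]

lemma trace_re_nonneg (hM : M.PosSemidef) : 0 ≤ M.trace.re := by
  rw [trace_re_eq_sum]
  exact Finset.sum_nonneg fun i _ => quad_nonneg hM _

lemma norm_apply_le_trace (hM : M.PosSemidef) (i j : Fin T) : ‖M i j‖ ≤ M.trace.re := by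
  have h := two_mul_norm_form_le hM one_pos (Pi.single i 1) (Pi.single j 1)
  rw [form_single] at h
  have hi : ∀ i, quad M (Pi.single i 1) ≤ M.trace.re := fun i => by
    rw [trace_re_eq_sum]
    exact Finset.single_le_sum (f := fun i => quad M (Pi.single i 1))
      (fun i _ => quad_nonneg hM _) (Finset.mem_univ i)
  have := hi i
  have := hi j
  linarith

lemma norm_form_le_trace (hM : M.PosSemidef) (u v : Fin T → ℂ) :
    ‖form M u v‖ ≤ M.trace.re * ((∑ i, ‖u i‖) * ∑ i, ‖v i‖) := by
  rw [form_eq_sum, Finset.sum_mul_sum, Finset.mul_sum]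
  refine (norm_sum_le _ _).trans (Finset.sum_le_sum fun i _ => ?_)
  rw [Finset.mul_sum]
  refine (norm_sum_le _ _).trans (Finset.sum_le_sum fun j _ => ?_)
  rw [norm_mul, norm_mul, norm_star]
  have := norm_apply_le_trace hM i j
  have h2 : 0 ≤ ‖u i‖ * ‖v j‖ := by positivity
  nlinarith

lemma quad_le_trace (hM : M.PosSemidef) (u : Fin T → ℂ) :
    quad M u ≤ M.trace.re * (∑ i, ‖u i‖) ^ 2 := by
  rw [pow_two]
  exact (Complex.re_le_norm _).trans (norm_form_le_trace hM u u)

/-! The dual vector of `w`: pairing with `wᵀ M⁻¹` in the form `M` is the plain pairing with `w`. -/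

lemma star_vecMul_inv (hM : M.IsHermitian) (w : Fin T → ℂ) :
    star (Matrix.vecMul w M⁻¹) = M⁻¹.mulVec (star w) := by
  rw [Matrix.star_vecMul, hM.inv.eq]

lemma form_vecMul_inv_right (hM : M.IsHermitian) (hdet : IsUnit M.det) (u w : Fin T → ℂ) :
    form M u (Matrix.vecMul w M⁻¹) = u ⬝ᵥ star w := by
  rw [form, star_vecMul_inv hM, Matrix.mulVec_mulVec, Matrix.mul_nonsing_inv _ hdet,
    Matrix.one_mulVec]

lemma form_vecMul_inv_left (hdet : IsUnit M.det) (u w : Fin T → ℂ) :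
    form M (Matrix.vecMul w M⁻¹) u = w ⬝ᵥ star u := by
  rw [form, Matrix.dotProduct_mulVec, Matrix.vecMul_vecMul, Matrix.nonsing_inv_mul _ hdet,
    Matrix.vecMul_one]

lemma quad_vecMul_inv (hM : M.IsHermitian) (hdet : IsUnit M.det) (w : Fin T → ℂ) :
    quad M (Matrix.vecMul w M⁻¹) = quad M⁻¹ w := by
  rw [quad_eq_re_form, form_vecMul_inv_left hdet, star_vecMul_inv hM]
  rfl

lemma eq_zero_of_quad_eq_zero (hM : M.PosSemidef) (hdet : IsUnit M.det) {u : Fin T → ℂ}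
    (h : quad M u = 0) : u = 0 := by
  have hp : M.PosDef := by
    rw [← Matrix.isUnit_iff_isUnit_det] at hdet
    exact hM.posDef_iff_isUnit.2 hdet
  by_contra hu
  have hu' : star u ≠ 0 := by simpa using hu
  have h2 := hp.dotProduct_mulVec_pos hu'
  rw [star_star] at h2
  exact (Complex.lt_def.1 h2).1.ne' h

lemma vecMul_eq_inv_mul (g p : Matrix (Fin T) (Fin T) ℂ) (A : Fin T → ℂ) (b : ℂ) :
    Matrix.vecMul A (b • (g * p⁻¹)) = Matrix.vecMul (b • Matrix.vecMul A g) p⁻¹ := by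
  rw [Matrix.smul_vecMul, Matrix.vecMul_smul, Matrix.vecMul_vecMul]

/-- Completing the square in the error density: the pointwise minimizer is
`uᵀ = b̄ Aᵀ g p⁻¹`, with `p = f + |b|² g`. -/
lemma quad_add_quad_sub_eq {f g : Matrix (Fin T) (Fin T) ℂ} (hf : f.PosSemidef)
    (hg : g.PosSemidef) (b : ℂ)
    (hdet : IsUnit (f + ((‖b‖ ^ 2 : ℝ) : ℂ) • g).det) (A u : Fin T → ℂ) :
    quad f u + quad g (b • u - A) =
      quad (f * (f + ((‖b‖ ^ 2 : ℝ) : ℂ) • g)⁻¹ * g) A +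
      quad (f + ((‖b‖ ^ 2 : ℝ) : ℂ) • g)
        (u - Matrix.vecMul A (star b • (g * (f + ((‖b‖ ^ 2 : ℝ) : ℂ) • g)⁻¹))) := by
  set p := f + ((‖b‖ ^ 2 : ℝ) : ℂ) • g with hp
  have hpp : p.PosSemidef := hf.add (hg.smul (by
    rw [Complex.zero_le_real]; positivity))
  have hbb : b * star b = ((‖b‖ ^ 2 : ℝ) : ℂ) := by
    rw [Complex.star_def, Complex.mul_conj, Complex.normSq_eq_norm_sq]
  set u₁ := Matrix.vecMul A (star b • (g * p⁻¹)) with hu₁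
  have h1 : u₁ = Matrix.vecMul (star b • Matrix.vecMul A g) p⁻¹ := vecMul_eq_inv_mul _ _ _ _
  have hstar : star (Matrix.vecMul A g) = g.mulVec (star A) := by
    rw [Matrix.star_vecMul, hg.1.eq]
  have hu : form p u u₁ = b * form g u A := by
    rw [h1, form_vecMul_inv_right hpp.1 hdet, star_smul, hstar, star_star, dotProduct_smul]
    rfl
  have h11 : form p u₁ u₁ = b * form g u₁ A := by
    rw [h1, form_vecMul_inv_right hpp.1 hdet, star_smul, hstar, star_star, dotProduct_smul]
    rfl
  have hfp : form (f * p⁻¹ * g) A A = form g A A - form p u₁ u₁ := by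
    rw [h11]
    have : f = p - ((‖b‖ ^ 2 : ℝ) : ℂ) • g := by rw [hp]; abel
    have e : f * p⁻¹ * g = g - ((‖b‖ ^ 2 : ℝ) : ℂ) • (g * p⁻¹ * g) := by
      conv_lhs => rw [this]
      rw [sub_mul, sub_mul, Matrix.mul_nonsing_inv _ hdet, one_mul, smul_mul_assoc,
        smul_mul_assoc]
    rw [e, ← hbb]
    have : form (g * p⁻¹ * g) A A = form g (Matrix.vecMul A (g * p⁻¹)) A := by
      rw [form, form, Matrix.dotProduct_mulVec, Matrix.dotProduct_mulVec, Matrix.vecMul_vecMul]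
    have h2 : form g u₁ A = star b * form (g * p⁻¹ * g) A A := by
      rw [hu₁, Matrix.vecMul_smul, form_smul_left, this]
    rw [h2]
    simp only [form, Matrix.sub_mulVec, Matrix.smul_mulVec, dotProduct_sub, dotProduct_smul,
      smul_eq_mul]
    ring
  have hre : quad (f * p⁻¹ * g) A = quad g A - quad p u₁ := by
    rw [quad_eq_re_form, hfp, Complex.sub_re]; rfl
  have s1 : quad p (u - u₁) = quad p u - 2 * (form p u u₁).re + quad p u₁ := by
    rw [sub_eq_add_neg, quad_add hpp, quad_neg]
    have : form p u (-u₁) = - form p u u₁ := by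
      simpa using form_smul_right (M := p) (u := u) (v := u₁) (-1)
    rw [this, Complex.neg_re]; ring
  have s2 : quad g (b • u - A) = ‖b‖ ^ 2 * quad g u - 2 * (b * form g u A).re + quad g A := by
    rw [sub_eq_add_neg, quad_add hg, quad_neg, quad_smul, form_smul_left]
    have : form g u (-A) = - form g u A := by
      simpa using form_smul_right (M := g) (u := u) (v := A) (-1)
    rw [this, mul_neg, Complex.neg_re]; ring
  have s0 : quad p u = quad f u + ‖b‖ ^ 2 * quad g u := by
    rw [hp, quad_add_matrix, quad_smul_matrix]
  rw [hre, s1, s2, hu, s0]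
  ring

end Pointwise

/-! ### The transfer functions `χ` and `β` -/

instance : IsFiniteMeasure circ := by
  unfold circ; infer_instance

instance : NullSingletonClass circ := by
  unfold circ; infer_instance

namespace Pattern

variable (γ : Pattern)

@[fun_prop]
lemma continuous_chi : Continuous γ.chi := by
  unfold chi; fun_prop

@[fun_prop]
lemma continuous_beta : Continuous γ.beta := by
  unfold beta; fun_prop

lemma chi_ne_zero : ∀ᵐ x ∂circ, γ.chi x ≠ 0 := by
  have hc : Set.Countable {x : ℝ | γ.chi x = 0} := by
    refine (Set.countable_iUnion fun j : Fin γ.r =>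
      Set.countable_range fun k : ℤ => -(2 * Real.pi * k / (γ.μ j * γ.s j : ℕ) : ℝ)).mono ?_
    intro x hx
    obtain ⟨j, -, hj⟩ := Finset.prod_eq_zero_iff.1 (show ∏ j, _ = (0 : ℂ) from hx)
    have h1 := (pow_eq_zero_iff (γ.d_pos j).ne').1 hj
    obtain ⟨k, hk⟩ := Complex.exp_eq_one_iff.1 (sub_eq_zero.1 h1).symm
    refine Set.mem_iUnion.2 ⟨j, k, ?_⟩
    have hm : ((γ.μ j * γ.s j : ℕ) : ℝ) ≠ 0 := by
      exact_mod_cast (Nat.mul_pos (γ.μ_pos j) (γ.s_pos j)).ne'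
    have h2 : (x * (γ.μ j * γ.s j : ℕ) : ℝ) = -(2 * Real.pi * k) := by
      have h3 : Complex.I * ((x * (γ.μ j * γ.s j : ℕ) + 2 * Real.pi * k : ℝ) : ℂ) = 0 := by
        push_cast at hk ⊢
        linear_combination -hk
      have h4 := (mul_eq_zero.1 h3).resolve_left Complex.I_ne_zero
      have := Complex.ofReal_eq_zero.1 h4
      linarith
    simp only
    field_simp
    linarith
  exact measure_mono_null (fun x hx => by simpa using hx) (hc.measure_zero circ)

lemma beta_ne_zero : ∀ᵐ x ∂circ, γ.beta x ≠ 0 := by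
  have hc : Set.Countable {x : ℝ | γ.beta x = 0} := by
    refine (Set.countable_iUnion fun j : Fin γ.r =>
      Set.countable_range fun k : ℤ => (2 * Real.pi * k / (γ.s j : ℕ) : ℝ)).mono ?_
    intro x hx
    obtain ⟨j, -, hj⟩ := Finset.prod_eq_zero_iff.1 (show ∏ j, _ = (0 : ℂ) from hx)
    obtain ⟨k, -, hk⟩ := Finset.prod_eq_zero_iff.1 hj
    have h1 := (pow_eq_zero_iff (γ.d_pos j).ne').1 hk
    refine Set.mem_iUnion.2 ⟨j, k, ?_⟩
    have h3 : Complex.I * ((x - 2 * Real.pi * k / (γ.s j : ℕ) : ℝ) : ℂ) = 0 := by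
      push_cast at h1 ⊢
      linear_combination h1
    have := Complex.ofReal_eq_zero.1 ((mul_eq_zero.1 h3).resolve_left Complex.I_ne_zero)
    simp only
    linarith
  exact measure_mono_null (fun x hx => by simpa using hx) (hc.measure_zero circ)

lemma natDegree_incPoly_le : γ.incPoly.natDegree ≤ γ.n := by
  unfold incPoly n
  refine (Polynomial.natDegree_prod_le _ _).trans (Finset.sum_le_sum fun j _ => ?_)
  refine Polynomial.natDegree_pow_le.trans ?_
  rw [mul_comm]
  refine Nat.mul_le_mul_right _ ?_
  refine (Polynomial.natDegree_sub_le _ _).trans ?_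
  simp

lemma e_eq_zero {k : ℕ} (hk : γ.n < k) : γ.e k = 0 :=
  Polynomial.coeff_eq_zero_of_natDegree_lt (γ.natDegree_incPoly_le.trans_lt hk)

lemma chi_eq_sum (x : ℝ) :
    γ.chi x = ∑ k ∈ Finset.range (γ.n + 1), γ.e k * Complex.exp (-(Complex.I * x * k)) := by
  have h : γ.chi x = γ.incPoly.eval (Complex.exp (-(Complex.I * x))) := by
    simp only [chi, incPoly, Polynomial.eval_prod, Polynomial.eval_pow, Polynomial.eval_sub,
      Polynomial.eval_one, Polynomial.eval_X, ← Complex.exp_nat_mul]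
    refine Finset.prod_congr rfl fun j _ => ?_
    congr 3
    ring
  rw [h, Polynomial.eval_eq_sum_range' (Nat.lt_succ_of_le γ.natDegree_incPoly_le)]
  refine Finset.sum_congr rfl fun k _ => ?_
  rw [← Complex.exp_nat_mul]
  congr 2
  ring

end Pattern

lemma integral_exp_circ (k : ℤ) :
    ∫ x, Complex.exp (Complex.I * (x : ℝ) * k) ∂circ = if k = 0 then 2 * (Real.pi : ℂ) else 0 := by
  have hpi : -Real.pi ≤ Real.pi := by linarith [Real.pi_pos]
  rw [circ, ← intervalIntegral.integral_of_le hpi]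
  split_ifs with h
  · simp [h]; ring
  · have hc : Complex.I * (k : ℂ) ≠ 0 := mul_ne_zero Complex.I_ne_zero (by exact_mod_cast h)
    have : ∀ x : ℝ, Complex.I * (x : ℂ) * k = Complex.I * (k : ℂ) * x := fun x => by ring
    simp_rw [this]
    rw [integral_exp_mul_complex hc, div_eq_zero_iff]
    left
    rw [sub_eq_zero, Complex.exp_eq_exp_iff_exists_int]
    exact ⟨k, by push_cast; ring⟩

lemma norm_exp_I_mul (x : ℝ) (k : ℤ) : ‖Complex.exp (Complex.I * x * k)‖ = 1 := by
  have : Complex.I * x * k = ((x * k : ℝ) : ℂ) * Complex.I := by push_cast; ring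
  rw [this, Complex.norm_exp_ofReal_mul_I]

lemma star_exp_I_mul (x : ℝ) (k : ℂ) (hk : star k = k) :
    star (Complex.exp (Complex.I * x * k)) = Complex.exp (-(Complex.I * x * k)) := by
  simp only [Complex.star_def] at *
  rw [← Complex.exp_conj]
  congr 1
  simp [hk]

/-! ### The weighted space `L₂(p)` -/

/-- A measurable function with positive semidefinite matrices as values almost everywhere. -/
structure IsWeight (p : MatFun T) : Prop where
  meas : ∀ i j, AEStronglyMeasurable (fun x => p x i j) circ
  psd : ∀ᵐ x ∂circ, (p x).PosSemidef

/-- A vector function of the frequency, measurable in each component. -/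
def VecMeasurable (u : VecFun T) : Prop := ∀ l, AEStronglyMeasurable (fun x => u x l) circ

/-- Membership of a vector function in `L₂(p)`. -/
structure MemL2 (p : MatFun T) (u : VecFun T) : Prop where
  meas : VecMeasurable u
  integrable : Integrable (fun x => quad (p x) (u x)) circ

namespace VecMeasurable

variable {u v : VecFun T}

lemma add (hu : VecMeasurable u) (hv : VecMeasurable v) : VecMeasurable (u + v) :=
  fun l => (hu l).add (hv l)

lemma sub (hu : VecMeasurable u) (hv : VecMeasurable v) : VecMeasurable (u - v) :=
  fun l => (hu l).sub (hv l)

lemma smul {φ : ℝ → ℂ} (hφ : AEStronglyMeasurable φ circ) (hu : VecMeasurable u) :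
    VecMeasurable (fun x => φ x • u x) :=
  fun l => hφ.mul (hu l)

lemma of_continuous (hu : Continuous u) : VecMeasurable u :=
  fun l => ((continuous_apply l).comp hu).aestronglyMeasurable

lemma vecMul {p : MatFun T} (hu : VecMeasurable u)
    (hp : ∀ i j, AEStronglyMeasurable (fun x => p x i j) circ) :
    VecMeasurable (fun x => Matrix.vecMul (u x) (p x)) := by
  intro l
  simp only [Matrix.vecMul, dotProduct]
  exact Finset.aestronglyMeasurable_fun_sum _ fun i _ => (hu i).mul (hp i l)

end VecMeasurable

lemma aestronglyMeasurable_form {p : MatFun T}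
    (hp : ∀ i j, AEStronglyMeasurable (fun x => p x i j) circ) {u v : VecFun T}
    (hu : VecMeasurable u) (hv : VecMeasurable v) :
    AEStronglyMeasurable (fun x => form (p x) (u x) (v x)) circ := by
  simp only [form_eq_sum]
  exact Finset.aestronglyMeasurable_fun_sum _ fun i _ =>
    Finset.aestronglyMeasurable_fun_sum _ fun j _ => (hu i).mul ((hp i j).mul (hv j).star)

lemma aestronglyMeasurable_quad {p : MatFun T}
    (hp : ∀ i j, AEStronglyMeasurable (fun x => p x i j) circ) {u : VecFun T}
    (hu : VecMeasurable u) : AEStronglyMeasurable (fun x => quad (p x) (u x)) circ :=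
  Complex.continuous_re.comp_aestronglyMeasurable (aestronglyMeasurable_form hp hu hu)

lemma aestronglyMeasurable_smul_matrix {p : MatFun T} {φ : ℝ → ℂ}
    (hφ : AEStronglyMeasurable φ circ)
    (hp : ∀ i j, AEStronglyMeasurable (fun x => p x i j) circ) (i j : Fin T) :
    AEStronglyMeasurable (fun x => (φ x • p x) i j) circ := hφ.mul (hp i j)

lemma aestronglyMeasurable_mul_matrix {p q : MatFun T}
    (hp : ∀ i j, AEStronglyMeasurable (fun x => p x i j) circ)
    (hq : ∀ i j, AEStronglyMeasurable (fun x => q x i j) circ) (i j : Fin T) :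
    AEStronglyMeasurable (fun x => (p x * q x) i j) circ := by
  simp only [Matrix.mul_apply]
  exact Finset.aestronglyMeasurable_fun_sum _ fun k _ => (hp i k).mul (hq k j)

lemma aestronglyMeasurable_inv_matrix {p : MatFun T}
    (hp : ∀ i j, AEStronglyMeasurable (fun x => p x i j) circ) (i j : Fin T) :
    AEStronglyMeasurable (fun x => (p x)⁻¹ i j) circ := by
  have hm : AEMeasurable (fun x => (fun i j => p x i j : Fin T → Fin T → ℂ)) circ :=
    aemeasurable_pi_lambda _ fun i => aemeasurable_pi_lambda _ fun j => (hp i j).aemeasurable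
  have hc : Continuous fun M : Fin T → Fin T → ℂ => (Matrix.of M : Matrix (Fin T) (Fin T) ℂ) :=
    continuous_id
  have hd : Measurable fun M : Fin T → Fin T → ℂ => (Matrix.of M).det :=
    hc.matrix_det.measurable
  have ha : Measurable fun M : Fin T → Fin T → ℂ => (Matrix.of M).adjugate i j :=
    (hc.matrix_adjugate.matrix_elem i j).measurable
  have := ((hd.comp_aemeasurable hm).inv.mul (ha.comp_aemeasurable hm)).aestronglyMeasurable
  refine this.congr (Filter.Eventually.of_forall fun x => ?_)
  simp only [Matrix.inv_def, Ring.inverse_eq_inv, Matrix.smul_apply, smul_eq_mul]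
  rfl

namespace IsWeight

variable {p q : MatFun T}

lemma add (hp : IsWeight p) (hq : IsWeight q) : IsWeight (fun x => p x + q x) where
  meas i j := (hp.meas i j).add (hq.meas i j)
  psd := by
    filter_upwards [hp.psd, hq.psd] with x h1 h2 using h1.add h2

lemma smul (hp : IsWeight p) {φ : ℝ → ℝ} (hφ : AEStronglyMeasurable φ circ)
    (h0 : ∀ x, 0 ≤ φ x) : IsWeight (fun x => (φ x : ℂ) • p x) where
  meas := aestronglyMeasurable_smul_matrix
    (Complex.continuous_ofReal.comp_aestronglyMeasurable hφ) hp.meas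
  psd := by
    filter_upwards [hp.psd] with x h1 using h1.smul (Complex.zero_le_real.2 (h0 x))

lemma inv (hp : IsWeight p) : IsWeight (fun x => (p x)⁻¹) where
  meas := aestronglyMeasurable_inv_matrix hp.meas
  psd := by
    filter_upwards [hp.psd] with x h1 using h1.inv

lemma normSq_eq (hp : IsWeight p) {u : VecFun T} (hu : MemL2 p u) :
    normSq p u = ENNReal.ofReal (∫ x, quad (p x) (u x) ∂circ) := by
  rw [normSq, ofReal_integral_eq_lintegral_ofReal hu.integrable]
  filter_upwards [hp.psd] with x hx using quad_nonneg hx _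

lemma memL2_of_normSq_lt_top (hp : IsWeight p) {u : VecFun T} (hu : VecMeasurable u)
    (h : normSq p u < ∞) : MemL2 p u := by
  refine ⟨hu, aestronglyMeasurable_quad hp.meas hu, ?_⟩
  rw [hasFiniteIntegral_iff_ofReal]
  · exact h
  · filter_upwards [hp.psd] with x hx using quad_nonneg hx _

lemma memL2_of_le (hp : IsWeight p) {u : VecFun T} (hu : VecMeasurable u) {φ : ℝ → ℝ}
    (hφ : Integrable φ circ) (h : ∀ᵐ x ∂circ, quad (p x) (u x) ≤ φ x) : MemL2 p u := by
  refine ⟨hu, hφ.mono' (aestronglyMeasurable_quad hp.meas hu) ?_⟩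
  filter_upwards [hp.psd, h] with x hx h
  rwa [Real.norm_of_nonneg (quad_nonneg hx _)]

lemma integrable_form (hp : IsWeight p) {u v : VecFun T} (hu : MemL2 p u) (hv : MemL2 p v) :
    Integrable (fun x => form (p x) (u x) (v x)) circ := by
  refine (hu.integrable.add hv.integrable).mono' (aestronglyMeasurable_form hp.meas hu.meas hv.meas)
    ?_
  filter_upwards [hp.psd] with x hx using norm_form_le hx _ _

lemma normSq_add_le (hp : IsWeight p) {u v : VecFun T} (hu : VecMeasurable u)
    {t : ℝ} (ht : 0 < t) :
    normSq p (u + v) ≤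
      ENNReal.ofReal (1 + t) * normSq p u + ENNReal.ofReal (1 + t⁻¹) * normSq p v := by
  have ht' : 0 < t⁻¹ := inv_pos.2 ht
  have hm : AEMeasurable (fun x => ENNReal.ofReal (quad (p x) (u x))) circ :=
    (aestronglyMeasurable_quad hp.meas hu).aemeasurable.ennreal_ofReal
  unfold normSq
  rw [← lintegral_const_mul' _ _ ENNReal.ofReal_ne_top,
    ← lintegral_const_mul' _ _ ENNReal.ofReal_ne_top, ← lintegral_add_left' (hm.const_mul _)]
  refine lintegral_mono_ae ?_
  filter_upwards [hp.psd] with x hx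
  rw [← ENNReal.ofReal_mul (by positivity), ← ENNReal.ofReal_mul (by positivity),
    ← ENNReal.ofReal_add (mul_nonneg (by positivity) (quad_nonneg hx _))
      (mul_nonneg (by positivity) (quad_nonneg hx _))]
  exact ENNReal.ofReal_le_ofReal (quad_add_le hx ht _ _)

end IsWeight

lemma normSq_neg (p : MatFun T) (u : VecFun T) : normSq p (-u) = normSq p u := by
  simp [normSq, quad_neg]

lemma normSq_sub_comm (p : MatFun T) (u v : VecFun T) : normSq p (u - v) = normSq p (v - u) := by
  rw [← normSq_neg, neg_sub]

namespace MemL2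

variable {p : MatFun T} {u v : VecFun T}

lemma add (hp : IsWeight p) (hu : MemL2 p u) (hv : MemL2 p v) : MemL2 p (u + v) := by
  refine hp.memL2_of_le (hu.meas.add hv.meas)
    ((hu.integrable.const_mul (1 + 1)).add (hv.integrable.const_mul (1 + 1⁻¹))) ?_
  filter_upwards [hp.psd] with x hx using quad_add_le hx one_pos _ _

lemma neg (hu : MemL2 p u) : MemL2 p (-u) :=
  ⟨fun l => (hu.meas l).neg, by simpa [quad_neg] using hu.integrable⟩

lemma const_smul (c : ℂ) (hu : MemL2 p u) : MemL2 p (c • u) :=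
  ⟨fun l => (hu.meas l).const_mul c, by
    simpa only [Pi.smul_apply, quad_smul] using hu.integrable.const_mul (‖c‖ ^ 2)⟩

lemma zero (p : MatFun T) : MemL2 p 0 :=
  ⟨fun _ => aestronglyMeasurable_const, by simp [quad_zero_vec]⟩

lemma sub (hp : IsWeight p) (hu : MemL2 p u) (hv : MemL2 p v) : MemL2 p (u - v) := by
  rw [sub_eq_add_neg]
  exact hu.add hp hv.neg

end MemL2

lemma exists_ae_bound {w : VecFun T} (hw : Continuous w) :
    ∃ C, ∀ᵐ x ∂circ, ∑ i, ‖w x i‖ ≤ C := by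
  have hc : Continuous fun x => ∑ i, ‖w x i‖ :=
    continuous_finsetSum _ fun i _ => ((continuous_apply i).comp hw).norm
  obtain ⟨C, hC⟩ := (isCompact_Icc (a := -Real.pi) (b := Real.pi)).exists_bound_of_continuousOn
    hc.continuousOn
  refine ⟨C, ?_⟩
  filter_upwards [ae_restrict_mem measurableSet_Ioc] with x hx
  exact (Real.le_norm_self _).trans (hC x (Set.Ioc_subset_Icc_self hx))

/-- Bounded functions are square integrable with respect to an integrable weight. -/
lemma IsWeight.memL2_of_continuous {G : MatFun T} (hG : IsWeight G)
    (hint : ∀ i j, Integrable (fun x => G x i j) circ) {w : VecFun T} (hw : Continuous w) :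
    MemL2 G w := by
  obtain ⟨C, hC⟩ := exists_ae_bound hw
  have ht : Integrable (fun x => (G x).trace.re) circ := by
    simp only [Matrix.trace, Matrix.diag, Complex.re_sum]
    exact integrable_finsetSum _ fun i _ => (hint i i).re
  refine hG.memL2_of_le (.of_continuous hw) (ht.mul_const (C ^ 2)) ?_
  filter_upwards [hG.psd, hC] with x hx hC
  refine (quad_le_trace hx _).trans ?_
  have h0 : 0 ≤ ∑ i, ‖w x i‖ := Finset.sum_nonneg fun _ _ => norm_nonneg _
  have := trace_re_nonneg hx
  gcongr

/-! ### Density of the trigonometric polynomials in `L₂(p)` -/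

/-- The vector trigonometric polynomial `∑ₖ c(k) e^{ixk}`. -/
noncomputable def trigPoly (c : ℤ →₀ (Fin T → ℂ)) : VecFun T :=
  fun x p => ∑ k ∈ c.support, c k p * Complex.exp (Complex.I * x * k)

lemma trig_apply (γ : Pattern) (c : ℤ →₀ (Fin T → ℂ)) (x : ℝ) :
    trig γ c x = (γ.chi x / γ.beta x) • trigPoly c x := by
  ext p
  simp [trig, trigPoly, mul_comm]

lemma continuous_trigPoly (c : ℤ →₀ (Fin T → ℂ)) : Continuous (trigPoly c) := by
  refine continuous_pi fun p => ?_
  unfold trigPoly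
  fun_prop

lemma trigPoly_eq_sum (c : ℤ →₀ (Fin T → ℂ)) {s : Finset ℤ} (hs : c.support ⊆ s) (x : ℝ)
    (p : Fin T) : trigPoly c x p = ∑ k ∈ s, c k p * Complex.exp (Complex.I * x * k) := by
  refine Finset.sum_subset hs fun k _ hk => ?_
  simp [Finsupp.notMem_support_iff.1 hk]

/-- Trigonometric polynomials are dense in `L₂` of a finite measure on one period. -/
lemma exists_trig_approx_scalar (ρ : Measure ℝ) [IsFiniteMeasure ρ] (hρ : ρ ≪ circ) {f : ℝ → ℂ}
    (hf : StronglyMeasurable f) {C : ℝ} (hC : ∀ x, ‖f x‖ ≤ C) {ε : ℝ≥0∞} (hε : 0 < ε) :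
    ∃ c : ℤ →₀ ℂ,
      ∫⁻ x, ‖f x - ∑ k ∈ c.support, c k * Complex.exp (Complex.I * x * k)‖ₑ ^ 2 ∂ρ < ε := by
  have : Fact (0 < 2 * Real.pi) := ⟨Real.two_pi_pos⟩
  let ν : Measure (AddCircle (2 * Real.pi)) := ρ.map (fun x : ℝ => (x : AddCircle (2 * Real.pi)))
  have hcoe : Measurable (fun x : ℝ => (x : AddCircle (2 * Real.pi))) :=
    AddCircle.measurable_mk'
  have hfin : IsFiniteMeasure ν := Measure.isFiniteMeasure_map _ _
  let F : AddCircle (2 * Real.pi) → ℂ := fun y =>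
    f (AddCircle.measurableEquivIoc (2 * Real.pi) (-Real.pi) y : ℝ)
  have hF : StronglyMeasurable F :=
    hf.comp_measurable (measurable_subtype_coe.comp (MeasurableEquiv.measurable _))
  have hFf : ∀ᵐ x : ℝ ∂ρ, F (x : AddCircle (2 * Real.pi)) = f x := by
    have : ∀ᵐ x : ℝ ∂circ, F (x : AddCircle (2 * Real.pi)) = f x := by
      filter_upwards [ae_restrict_mem measurableSet_Ioc] with x hx
      have hx' : x ∈ Set.Ioc (-Real.pi) (-Real.pi + 2 * Real.pi) :=
        ⟨hx.1, by linarith [hx.2]⟩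
      have h1 : AddCircle.measurableEquivIoc (2 * Real.pi) (-Real.pi)
          (x : AddCircle (2 * Real.pi)) = ⟨x, hx'⟩ :=
        Subtype.ext (AddCircle.equivIoc_coe_of_mem hx')
      simp only [F, h1]
    exact hρ.ae_le this
  have hFL : MemLp F 2 ν :=
    MemLp.of_bound hF.aestronglyMeasurable C (Filter.Eventually.of_forall fun y => hC _)
  obtain ⟨δ, hδ, hδε⟩ : ∃ δ : ℝ≥0∞, 0 < δ ∧ (δ + δ * (ν Set.univ) ^ (2⁻¹ : ℝ)) ^ 2 < ε := by
    have hlim : Filter.Tendsto (fun δ : ℝ≥0∞ => (δ + δ * (ν Set.univ) ^ (2⁻¹ : ℝ)) ^ 2)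
        (nhds 0) (nhds ((0 + 0 * (ν Set.univ) ^ (2⁻¹ : ℝ)) ^ 2)) := by
      refine ENNReal.Tendsto.pow (Filter.tendsto_id.add ?_)
      refine ENNReal.Tendsto.mul_const Filter.tendsto_id (Or.inr ?_)
      exact ENNReal.rpow_ne_top_of_nonneg (by norm_num) (measure_ne_top _ _)
    have h0 : ∀ᶠ δ in nhds (0 : ℝ≥0∞), (δ + δ * (ν Set.univ) ^ (2⁻¹ : ℝ)) ^ 2 < ε :=
      hlim.eventually (gt_mem_nhds (by simpa using hε))
    obtain ⟨u, hu, hu'⟩ := ENNReal.nhds_zero_basis.eventually_iff.1 h0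
    obtain ⟨δ, h1, h2⟩ := exists_between hu
    exact ⟨δ, h1, hu' h2⟩
  obtain ⟨g, hg, -⟩ := hFL.exists_boundedContinuous_eLpNorm_sub_le (by norm_num) hδ.ne'
  have hgd : (g.toContinuousMap) ∈
      closure ((Submodule.span ℂ (Set.range (@fourier (2 * Real.pi)))) : Set _) := by
    have := span_fourier_closure_eq_top (T := 2 * Real.pi)
    rw [← Submodule.topologicalClosure_coe, this]
    trivial
  obtain ⟨δ', hδ', hδδ⟩ : ∃ δ' : ℝ, 0 < δ' ∧ ENNReal.ofReal δ' ≤ δ := by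
    rcases eq_or_ne δ ∞ with rfl | h
    · exact ⟨1, one_pos, le_top⟩
    · exact ⟨δ.toReal, ENNReal.toReal_pos hδ.ne' h, by rw [ENNReal.ofReal_toReal h]⟩
  obtain ⟨h, hh, hgh⟩ := Metric.mem_closure_iff.1 hgd δ' hδ'
  obtain ⟨c, rfl⟩ := Finsupp.mem_span_range_iff_exists_finsupp.1 hh
  set H := (c.sum fun i a => a • fourier i : C(AddCircle (2 * Real.pi), ℂ)) with hH
  have hHx : ∀ x : ℝ, H (x : AddCircle (2 * Real.pi)) =
      ∑ k ∈ c.support, c k * Complex.exp (Complex.I * x * k) := by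
    intro x
    rw [hH, Finsupp.sum, ContinuousMap.sum_apply]
    refine Finset.sum_congr rfl fun k _ => ?_
    rw [ContinuousMap.smul_apply, fourier_coe_apply, smul_eq_mul]
    congr 2
    have : (Real.pi : ℂ) ≠ 0 := by exact_mod_cast Real.pi_ne_zero
    push_cast
    field_simp
  refine ⟨c, ?_⟩
  have hHm : AEStronglyMeasurable (fun y => F y - H y) ν :=
    hF.aestronglyMeasurable.sub H.continuous.aestronglyMeasurable
  have e1 : ∫⁻ x, ‖f x - ∑ k ∈ c.support, c k * Complex.exp (Complex.I * x * k)‖ₑ ^ 2 ∂ρ =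
      ∫⁻ y, ‖F y - H y‖ₑ ^ 2 ∂ν := by
    rw [lintegral_map' (hHm.enorm.pow_const 2) hcoe.aemeasurable]
    refine lintegral_congr_ae ?_
    filter_upwards [hFf] with x hx
    rw [hx, hHx]
  have e2 : ∫⁻ y, ‖F y - H y‖ₑ ^ 2 ∂ν = eLpNorm (fun y => F y - H y) 2 ν ^ 2 := by
    rw [eLpNorm_eq_lintegral_rpow_enorm_toReal (by norm_num) (by norm_num), ← ENNReal.rpow_natCast,
      ← ENNReal.rpow_mul]
    simp
  rw [e1, e2]
  refine lt_of_le_of_lt ?_ hδε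
  gcongr
  have e3 : (fun y => F y - H y) = (F - g) + (fun y => g y - H y) := by
    ext y; simp
  rw [e3]
  refine (eLpNorm_add_le (hF.aestronglyMeasurable.sub g.continuous.aestronglyMeasurable)
    (g.continuous.sub H.continuous).aestronglyMeasurable (by norm_num)).trans ?_
  refine add_le_add hg ?_
  refine (eLpNorm_le_of_ae_bound (C := δ') (Filter.Eventually.of_forall fun y => ?_)).trans ?_
  · have := ContinuousMap.dist_lt_iff hδ' |>.1 hgh y
    rw [dist_eq_norm] at this
    exact this.le
  · rw [mul_comm]
    simp only [ENNReal.toReal_ofNat]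
    gcongr

lemma sq_sum_enorm_le (v : Fin T → ℂ) :
    ENNReal.ofReal ((∑ i, ‖v i‖) ^ 2) ≤ (T : ℝ≥0∞) * ∑ i, ‖v i‖ₑ ^ 2 := by
  have h := sq_sum_le_card_mul_sum_sq (s := (Finset.univ : Finset (Fin T))) (f := fun i => ‖v i‖)
  simp only [Finset.card_univ, Fintype.card_fin] at h
  refine (ENNReal.ofReal_le_ofReal h).trans (le_of_eq ?_)
  rw [ENNReal.ofReal_mul (by positivity), ENNReal.ofReal_natCast,
    ENNReal.ofReal_sum_of_nonneg fun i _ => by positivity]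
  congr 1
  refine Finset.sum_congr rfl fun i _ => ?_
  rw [ENNReal.ofReal_pow (norm_nonneg _), ofReal_norm]

lemma exists_trigPoly_approx_bounded {q : MatFun T} (hq : IsWeight q)
    (hint : ∀ i j, Integrable (fun x => q x i j) circ) {w : VecFun T} (hw : VecMeasurable w)
    {C : ℝ} (hC : ∀ x i, ‖w x i‖ ≤ C) {ε : ℝ≥0∞} (hε : 0 < ε) :
    ∃ c, normSq q (w - trigPoly c) < ε := by
  have ht : Integrable (fun x => (q x).trace.re) circ := by
    simp only [Matrix.trace, Matrix.diag, Complex.re_sum]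
    exact integrable_finsetSum _ fun i _ => (hint i i).re
  let d : ℝ → ℝ≥0∞ := fun x => ENNReal.ofReal (q x).trace.re
  have hd : AEMeasurable d circ := ht.aestronglyMeasurable.aemeasurable.ennreal_ofReal
  let ρ := circ.withDensity d
  have hρ : ρ ≪ circ := withDensity_absolutelyContinuous _ _
  have hfin : IsFiniteMeasure ρ :=
    isFiniteMeasure_withDensity_ofReal ht.2
  obtain ⟨δ, hδ, hδε⟩ : ∃ δ : ℝ≥0∞, 0 < δ ∧ (T : ℝ≥0∞) * (T * δ) < ε := by
    obtain ⟨δ, h1, h2⟩ := exists_between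
      (show (0 : ℝ≥0∞) < ε / (T * T + 1) from ENNReal.div_pos hε.ne' (by finiteness))
    refine ⟨δ, h1, ?_⟩
    have h3 := (ENNReal.lt_div_iff_mul_lt (by simp) (Or.inl (by finiteness))).1 h2
    refine lt_of_le_of_lt ?_ h3
    rw [← mul_assoc, mul_comm δ]
    gcongr
    exact le_self_add
  have happ : ∀ l, ∃ c : ℤ →₀ ℂ, ∫⁻ x, ‖w x l -
      ∑ k ∈ c.support, c k * Complex.exp (Complex.I * x * k)‖ₑ ^ 2 ∂ρ < δ := by
    intro l
    have hm := (hw l).mono_ac hρ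
    -- a bounded strongly measurable version of the component
    let f : ℝ → ℂ := fun x => if ‖hm.mk _ x‖ ≤ C then hm.mk _ x else 0
    have hfm : StronglyMeasurable f :=
      hm.stronglyMeasurable_mk.ite (measurableSet_le hm.stronglyMeasurable_mk.norm.measurable
        measurable_const) stronglyMeasurable_const
    have hfC : ∀ x, ‖f x‖ ≤ |C| := by
      intro x
      by_cases h : ‖hm.mk _ x‖ ≤ C
      · simpa only [f, if_pos h] using h.trans (le_abs_self C)
      · simp only [f, if_neg h, norm_zero]; positivity
    obtain ⟨c, hc⟩ := exists_trig_approx_scalar ρ hρ hfm hfC hδ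
    refine ⟨c, ?_⟩
    convert hc using 1
    refine lintegral_congr_ae ?_
    filter_upwards [hm.ae_eq_mk] with x hx
    have : f x = w x l := by
      have h := hC x l
      rw [hx] at h
      simp only [f, if_pos h]
      exact hx.symm
    rw [this]
  choose c hc using happ
  let s : Finset ℤ := Finset.univ.biUnion fun l => (c l).support
  let c' : ℤ →₀ (Fin T → ℂ) := Finsupp.onFinset s (fun k l => c l k) (by
    intro k hk
    obtain ⟨l, hl⟩ := Function.ne_iff.1 hk
    exact Finset.mem_biUnion.2 ⟨l, Finset.mem_univ _, Finsupp.mem_support_iff.2 hl⟩)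
  have hc' : ∀ x l, trigPoly c' x l =
      ∑ k ∈ (c l).support, c l k * Complex.exp (Complex.I * x * k) := by
    intro x l
    rw [trigPoly_eq_sum c' (s := s) Finsupp.support_onFinset_subset]
    refine (Finset.sum_subset (Finset.subset_biUnion_of_mem (fun l => (c l).support)
      (Finset.mem_univ l)) fun k _ hk => ?_).symm
    simp [c', Finsupp.notMem_support_iff.1 hk]
  refine ⟨c', lt_of_le_of_lt ?_ hδε⟩
  have hvm : VecMeasurable (w - trigPoly c') := hw.sub (.of_continuous (continuous_trigPoly _))
  have hm : ∀ l, AEMeasurable (fun x => ‖(w - trigPoly c') x l‖ₑ ^ 2) ρ := fun l =>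
    ((hvm l).mono_ac hρ).enorm.pow_const 2
  calc normSq q (w - trigPoly c')
      ≤ ∫⁻ x, d x * ((T : ℝ≥0∞) * ∑ l, ‖(w - trigPoly c') x l‖ₑ ^ 2) ∂circ := by
        refine lintegral_mono_ae ?_
        filter_upwards [hq.psd] with x hx
        refine (ENNReal.ofReal_le_ofReal (quad_le_trace hx _)).trans ?_
        rw [ENNReal.ofReal_mul (trace_re_nonneg hx)]
        gcongr
        exact sq_sum_enorm_le _
    _ = ∫⁻ x, ((T : ℝ≥0∞) * ∑ l, ‖(w - trigPoly c') x l‖ₑ ^ 2) ∂ρ := by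
        refine (lintegral_withDensity_eq_lintegral_mul₀' hd ?_).symm
        exact (Finset.aemeasurable_fun_sum _ fun l _ => hm l).const_mul _
    _ = T * ∑ l, ∫⁻ x, ‖(w - trigPoly c') x l‖ₑ ^ 2 ∂ρ := by
        rw [lintegral_const_mul' _ _ (by finiteness), lintegral_finsetSum' _ fun l _ => hm l]
    _ ≤ T * ∑ _l : Fin T, δ := by
        gcongr with l
        refine le_of_eq_of_le ?_ (hc l).le
        simp only [Pi.sub_apply, hc']
    _ = T * (T * δ) := by simp

/-- Trigonometric polynomials are dense in `L₂(q)` for an integrable weight `q`. -/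
lemma exists_trigPoly_approx {q : MatFun T} (hq : IsWeight q)
    (hint : ∀ i j, Integrable (fun x => q x i j) circ) {w : VecFun T} (hw : MemL2 q w)
    {ε : ℝ≥0∞} (hε : 0 < ε) : ∃ c, normSq q (w - trigPoly c) < ε := by
  choose w' hw' hww using fun l => hw.meas l
  have hm : ∀ M : ℕ, MeasurableSet {x | ∑ i, ‖w' i x‖ ≤ M} := fun M =>
    measurableSet_le (Finset.measurable_fun_sum _ fun i _ => (hw' i).norm.measurable)
      measurable_const
  -- truncations of `w`
  let tr : ℕ → VecFun T := fun M x i => if ∑ i, ‖w' i x‖ ≤ M then w' i x else 0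
  have htm : ∀ M, VecMeasurable (tr M) := fun M i =>
    ((hw' i).ite (hm M) stronglyMeasurable_const).aestronglyMeasurable
  have htC : ∀ M x i, ‖tr M x i‖ ≤ (M : ℝ) := by
    intro M x i
    by_cases h : ∑ i, ‖w' i x‖ ≤ M
    · simp only [tr, if_pos h]
      exact (Finset.single_le_sum (f := fun i => ‖w' i x‖) (fun _ _ => norm_nonneg _)
        (Finset.mem_univ i)).trans h
    · simp [tr, if_neg h]
  have hae : ∀ᵐ x ∂circ, ∀ i, w x i = w' i x := by
    rw [ae_all_iff]; exact hww
  have hlim : Filter.Tendsto (fun M => normSq q (w - tr M)) Filter.atTop (nhds 0) := by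
    have h0 : (0 : ℝ≥0∞) = ∫⁻ _, 0 ∂circ := by simp
    rw [h0]
    refine tendsto_lintegral_of_dominated_convergence' (fun x => ENNReal.ofReal (quad (q x) (w x)))
      (fun M => (aestronglyMeasurable_quad hq.meas
        (hw.meas.sub (htm M))).aemeasurable.ennreal_ofReal) (fun M => ?_) ?_ ?_
    · filter_upwards [hae, hq.psd] with x hx hpsd
      refine ENNReal.ofReal_le_ofReal ?_
      by_cases h : ∑ i, ‖w' i x‖ ≤ M
      · have : (w - tr M) x = 0 := by
          ext i; simp [tr, if_pos h, hx i]
        rw [this, quad_zero_vec]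
        exact quad_nonneg hpsd _
      · have : (w - tr M) x = w x := by
          ext i; simp [tr, if_neg h]
        rw [this]
    · exact (lintegral_ofReal_le_lintegral_enorm _).trans_lt hw.integrable.2 |>.ne
    · filter_upwards [hae] with x hx
      obtain ⟨M₀, hM₀⟩ := exists_nat_ge (∑ i, ‖w' i x‖)
      refine tendsto_const_nhds.congr' ?_
      filter_upwards [Filter.eventually_ge_atTop M₀] with M hM
      have h : ∑ i, ‖w' i x‖ ≤ M := hM₀.trans (by exact_mod_cast hM)
      have : (w - tr M) x = 0 := by
        ext i; simp [tr, if_pos h, hx i]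
      rw [this, quad_zero_vec, ENNReal.ofReal_zero]
  have hε4 : 0 < ε / 4 := ENNReal.div_pos hε.ne' (by norm_num)
  obtain ⟨M, hM⟩ := (hlim.eventually (gt_mem_nhds hε4)).exists
  obtain ⟨c, hc⟩ := exists_trigPoly_approx_bounded hq hint (htm M) (htC M) hε4
  refine ⟨c, ?_⟩
  have e : w - trigPoly c = (w - tr M) + (tr M - trigPoly c) := by abel
  rw [e]
  refine (hq.normSq_add_le (hw.meas.sub (htm M)) one_pos).trans_lt ?_
  have h2 : ENNReal.ofReal (1 + 1) = 2 := by norm_num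
  rw [inv_one, h2, ← mul_add]
  have h3 := ENNReal.add_lt_add hM hc
  calc 2 * (normSq q (w - tr M) + normSq q (tr M - trigPoly c)) < 2 * (ε / 4 + ε / 4) :=
        ENNReal.mul_lt_mul_right (by norm_num) (by norm_num) h3
    _ = ε := by
        rw [← two_mul, ← mul_assoc, show (2 * 2 : ℝ≥0∞) = 4 by norm_num]
        exact ENNReal.mul_div_cancel (by norm_num) (by norm_num)

/-! ### The observed subspace and its orthogonal complement -/

lemma IsSignalDensity.isWeight {γ : Pattern} {f : MatFun T} (hf : IsSignalDensity γ f) :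
    IsWeight f := ⟨hf.meas, hf.psd⟩

lemma IsNoiseDensity.isWeight {g : MatFun T} (hg : IsNoiseDensity g) : IsWeight g :=
  ⟨fun i j => (hg.integrable i j).aestronglyMeasurable, hg.psd⟩

lemma isWeight_obsDensity {γ : Pattern} {f g : MatFun T} (hf : IsSignalDensity γ f)
    (hg : IsNoiseDensity g) : IsWeight (obsDensity γ f g) :=
  hf.isWeight.add (hg.isWeight.smul (φ := fun x => ‖γ.beta x‖ ^ 2)
    (by fun_prop) fun x => by positivity)

/-- `|χ|²/|β|² p`, the spectral density of the increments. -/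
noncomputable def incDensity (γ : Pattern) (p : MatFun T) : MatFun T :=
  fun x => ((‖γ.chi x‖ ^ 2 / ‖γ.beta x‖ ^ 2 : ℝ) : ℂ) • p x

/-- `|β|²/|χ|² p⁻¹`, the weight of the coefficients of functions orthogonal to the observations. -/
noncomputable def dualDensity (γ : Pattern) (p : MatFun T) : MatFun T :=
  fun x => ((‖γ.beta x‖ ^ 2 / ‖γ.chi x‖ ^ 2 : ℝ) : ℂ) • (p x)⁻¹

/-- `wᵀ (β̄/χ̄) p⁻¹`. For trigonometric polynomials `w` with frequencies in `0, …, N + n`, these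
are the functions of `L₂(p)` orthogonal to the observed increments. -/
noncomputable def dualFun (γ : Pattern) (p : MatFun T) (w : VecFun T) : VecFun T :=
  fun x => Matrix.vecMul (w x) ((star (γ.beta x) / star (γ.chi x)) • (p x)⁻¹)

lemma isWeight_incDensity (γ : Pattern) {p : MatFun T} (hp : IsWeight p) :
    IsWeight (incDensity γ p) :=
  hp.smul (φ := fun x => ‖γ.chi x‖ ^ 2 / ‖γ.beta x‖ ^ 2)
    (by
      have h1 : Measurable fun x => ‖γ.chi x‖ := γ.continuous_chi.norm.measurable
      have h2 : Measurable fun x => ‖γ.beta x‖ := γ.continuous_beta.norm.measurable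
      exact ((h1.pow_const 2).div (h2.pow_const 2)).aestronglyMeasurable)
    fun x => by positivity

lemma isWeight_dualDensity (γ : Pattern) {p : MatFun T} (hp : IsWeight p) :
    IsWeight (dualDensity γ p) :=
  hp.inv.smul (φ := fun x => ‖γ.beta x‖ ^ 2 / ‖γ.chi x‖ ^ 2)
    (by
      have h1 : Measurable fun x => ‖γ.chi x‖ := γ.continuous_chi.norm.measurable
      have h2 : Measurable fun x => ‖γ.beta x‖ := γ.continuous_beta.norm.measurable
      exact ((h2.pow_const 2).div (h1.pow_const 2)).aestronglyMeasurable)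
    fun x => by positivity

lemma integrable_incDensity {γ : Pattern} {f g : MatFun T} (hf : IsSignalDensity γ f)
    (hg : IsNoiseDensity g) (i j : Fin T) :
    Integrable (fun x => incDensity γ (obsDensity γ f g) x i j) circ := by
  have hχ : Continuous fun x => ‖γ.chi x‖ ^ 2 := by fun_prop
  obtain ⟨C, hC⟩ := (isCompact_Icc (a := -Real.pi) (b := Real.pi)).exists_bound_of_continuousOn
    hχ.continuousOn
  have h2 : Integrable (fun x => ((‖γ.chi x‖ ^ 2 : ℝ) : ℂ) * g x i j) circ := by
    refine (hg.integrable i j).bdd_mul (c := C) (Continuous.aestronglyMeasurable (by fun_prop)) ?_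
    filter_upwards [ae_restrict_mem measurableSet_Ioc] with x hx
    rw [Complex.norm_real]
    exact hC x (Set.Ioc_subset_Icc_self hx)
  refine ((hf.integrable i j).add h2).congr ?_
  filter_upwards [γ.beta_ne_zero] with x hx
  have hb : (‖γ.beta x‖ : ℂ) ≠ 0 := by simpa using hx
  simp only [incDensity, obsDensity, Matrix.smul_apply, Matrix.add_apply, smul_eq_mul,
    Pi.add_apply]
  push_cast
  field_simp

lemma integrable_dualDensity {γ : Pattern} {f g : MatFun T} (hf : IsSignalDensity γ f)
    (hg : IsNoiseDensity g) (hmin : MinimalityCondition γ f g) (i j : Fin T) :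
    Integrable (fun x => dualDensity γ (obsDensity γ f g) x i j) circ := by
  have hw := isWeight_dualDensity γ (isWeight_obsDensity hf hg)
  refine hmin.2.re.mono' (hw.meas i j) ?_
  filter_upwards [hw.psd] with x hx
  refine (norm_apply_le_trace hx i j).trans (le_of_eq ?_)
  simp [dualDensity, Matrix.trace_smul]

/-- A weight `p` for which the increments have finite variance and the minimality condition
holds. -/
structure IsMinimalWeight (γ : Pattern) (p : MatFun T) : Prop extends IsWeight p where
  inc_integrable : ∀ i j, Integrable (fun x => incDensity γ p x i j) circ
  isUnit_det : ∀ᵐ x ∂circ, IsUnit (p x).det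
  dual_integrable : ∀ i j, Integrable (fun x => dualDensity γ p x i j) circ

lemma isMinimalWeight_obsDensity {γ : Pattern} {f g : MatFun T} (hf : IsSignalDensity γ f)
    (hg : IsNoiseDensity g) (hmin : MinimalityCondition γ f g) :
    IsMinimalWeight γ (obsDensity γ f g) where
  toIsWeight := isWeight_obsDensity hf hg
  inc_integrable := integrable_incDensity hf hg
  isUnit_det := hmin.1
  dual_integrable := integrable_dualDensity hf hg hmin

section Trig

variable {γ : Pattern} {p : MatFun T}

lemma quad_trig (c : ℤ →₀ (Fin T → ℂ)) (x : ℝ) :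
    quad (p x) (trig γ c x) = quad (incDensity γ p x) (trigPoly c x) := by
  rw [trig_apply, quad_smul, incDensity, quad_smul_matrix, norm_div, div_pow]

lemma memL2_chi_div_beta_smul (hp : IsWeight p)
    (hint : ∀ i j, Integrable (fun x => incDensity γ p x i j) circ) {w : VecFun T}
    (hw : Continuous w) : MemL2 p (fun x => (γ.chi x / γ.beta x) • w x) := by
  have h := (isWeight_incDensity γ hp).memL2_of_continuous hint hw
  have hm : AEStronglyMeasurable (fun x => γ.chi x / γ.beta x) circ :=
    (γ.continuous_chi.measurable.div γ.continuous_beta.measurable).aestronglyMeasurable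
  refine ⟨h.meas.smul hm, h.integrable.congr (.of_forall fun x => ?_)⟩
  simp only
  rw [incDensity, quad_smul_matrix, quad_smul, norm_div, div_pow]

lemma memL2_trig (hp : IsWeight p) (hint : ∀ i j, Integrable (fun x => incDensity γ p x i j) circ)
    (c : ℤ →₀ (Fin T → ℂ)) : MemL2 p (trig γ c) := by
  rw [show trig γ c = fun x => (γ.chi x / γ.beta x) • trigPoly c x from funext (trig_apply γ c)]
  exact memL2_chi_div_beta_smul hp hint (continuous_trigPoly c)

lemma trigPoly_sub (c c' : ℤ →₀ (Fin T → ℂ)) : trigPoly (c - c') = trigPoly c - trigPoly c' := by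
  ext x l
  simp only [Pi.sub_apply]
  rw [trigPoly_eq_sum c Finset.subset_union_left, trigPoly_eq_sum c' Finset.subset_union_right,
    trigPoly_eq_sum (c - c') (s := c.support ∪ c'.support) Finsupp.support_sub,
    ← Finset.sum_sub_distrib]
  refine Finset.sum_congr rfl fun k _ => ?_
  simp [sub_mul]

lemma trig_sub (c c' : ℤ →₀ (Fin T → ℂ)) : trig γ (c - c') = trig γ c - trig γ c' := by
  ext x l
  simp [trig_apply, trigPoly_sub, mul_sub]

/-- Density of the functions `trig γ c`, without restriction on the frequencies, in `L₂(p)`. -/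
lemma exists_trig_approx (hp : IsWeight p)
    (hint : ∀ i j, Integrable (fun x => incDensity γ p x i j) circ) {h : VecFun T}
    (hh : MemL2 p h) {ε : ℝ≥0∞} (hε : 0 < ε) : ∃ c, normSq p (h - trig γ c) < ε := by
  have hm : AEStronglyMeasurable (fun x => γ.beta x / γ.chi x) circ :=
    (γ.continuous_beta.measurable.div γ.continuous_chi.measurable).aestronglyMeasurable
  have key : ∀ u : VecFun T, ∀ᵐ x ∂circ, quad (incDensity γ p x) ((γ.beta x / γ.chi x) • u x) =
      quad (p x) (u x) := by
    intro u
    filter_upwards [γ.beta_ne_zero, γ.chi_ne_zero] with x h1 h2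
    have h1' : ‖γ.beta x‖ ≠ 0 := by simpa using h1
    have h2' : ‖γ.chi x‖ ≠ 0 := by simpa using h2
    rw [incDensity, quad_smul_matrix, quad_smul, norm_div]
    field_simp
  have hw : MemL2 (incDensity γ p) (fun x => (γ.beta x / γ.chi x) • h x) :=
    ⟨hh.meas.smul hm, hh.integrable.congr ((key h).mono fun x hx => hx.symm)⟩
  obtain ⟨c, hc⟩ := exists_trigPoly_approx (isWeight_incDensity γ hp) hint hw hε
  refine ⟨c, lt_of_eq_of_lt (lintegral_congr_ae ?_) hc⟩
  filter_upwards [key (h - trig γ c), γ.beta_ne_zero, γ.chi_ne_zero] with x hx h1 h2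
  rw [← hx]
  congr 2
  simp only [Pi.sub_apply, trig_apply, smul_sub, smul_smul]
  rw [div_mul_div_cancel₀ h2, div_self h1, one_smul]

end Trig

/-- The vector function `e^{ixk} δ_l`. -/
noncomputable def expVec (k : ℤ) (l : Fin T) : VecFun T :=
  fun x => Complex.exp (Complex.I * x * k) • Pi.single l 1

lemma continuous_expVec (k : ℤ) (l : Fin T) : Continuous (expVec k l) := by
  unfold expVec; fun_prop

lemma dotProduct_star_expVec (u : Fin T → ℂ) (k : ℤ) (l : Fin T) (x : ℝ) :
    u ⬝ᵥ star (expVec k l x) = u l * Complex.exp (-(Complex.I * x * k)) := by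
  rw [expVec, star_smul, dotProduct_smul, star_exp_I_mul x k (by simp), ← Pi.single_star,
    dotProduct_single]
  simp [mul_comm]

/-- The `k`-th Fourier coefficient of `(β/χ) h_l`, times `2π`. -/
noncomputable def fourierCoef (γ : Pattern) (h : VecFun T) (k : ℤ) (l : Fin T) : ℂ :=
  ∫ x, γ.beta x / γ.chi x * (h x l * Complex.exp (-(Complex.I * x * k))) ∂circ

namespace IsMinimalWeight

variable {γ : Pattern} {p : MatFun T}

lemma form_dualFun (hp : IsMinimalWeight γ p) (w : VecFun T) : ∀ᵐ x ∂circ, ∀ u,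
    form (p x) u (dualFun γ p w x) = γ.beta x / γ.chi x * (u ⬝ᵥ star (w x)) := by
  filter_upwards [hp.psd, hp.isUnit_det] with x h1 h2 u
  rw [dualFun, Matrix.vecMul_smul, form_smul_right, form_vecMul_inv_right h1.1 h2]
  simp

lemma quad_dualFun (hp : IsMinimalWeight γ p) (w : VecFun T) : ∀ᵐ x ∂circ,
    quad (p x) (dualFun γ p w x) = quad (dualDensity γ p x) (w x) := by
  filter_upwards [hp.psd, hp.isUnit_det] with x h1 h2
  rw [dualFun, Matrix.vecMul_smul, quad_smul, quad_vecMul_inv h1.1 h2, dualDensity,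
    quad_smul_matrix]
  simp [div_pow]

lemma memL2_dualFun (hp : IsMinimalWeight γ p) {w : VecFun T} (hw : Continuous w) :
    MemL2 p (dualFun γ p w) := by
  have h := (isWeight_dualDensity γ hp.toIsWeight).memL2_of_continuous hp.dual_integrable hw
  have hm : AEStronglyMeasurable (fun x => star (γ.beta x) / star (γ.chi x)) circ :=
    (γ.continuous_beta.star.measurable.div γ.continuous_chi.star.measurable).aestronglyMeasurable
  exact ⟨h.meas.vecMul (aestronglyMeasurable_smul_matrix hm hp.inv.meas),
    h.integrable.congr ((hp.quad_dualFun w).mono fun x hx => hx.symm)⟩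

lemma integrable_fourierCoef (hp : IsMinimalWeight γ p) {h : VecFun T} (hh : MemL2 p h) (k : ℤ)
    (l : Fin T) : Integrable (fun x => γ.beta x / γ.chi x *
      (h x l * Complex.exp (-(Complex.I * x * k)))) circ := by
  refine (hp.integrable_form hh (hp.memL2_dualFun (continuous_expVec k l))).congr ?_
  filter_upwards [hp.form_dualFun (expVec k l)] with x hx
  rw [hx, dotProduct_star_expVec]

lemma fourierCoef_sub (hp : IsMinimalWeight γ p) {u v : VecFun T} (hu : MemL2 p u)
    (hv : MemL2 p v) (k : ℤ) (l : Fin T) :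
    fourierCoef γ (u - v) k l = fourierCoef γ u k l - fourierCoef γ v k l := by
  rw [fourierCoef, fourierCoef, fourierCoef,
    ← integral_sub (hp.integrable_fourierCoef hu k l) (hp.integrable_fourierCoef hv k l)]
  refine integral_congr_ae (.of_forall fun x => ?_)
  simp only [Pi.sub_apply]
  ring

lemma integrable_trace_dual (hp : IsMinimalWeight γ p) :
    Integrable (fun x => (dualDensity γ p x).trace.re) circ := by
  simp only [Matrix.trace, Matrix.diag, Complex.re_sum]
  exact integrable_finsetSum _ fun i _ => (hp.dual_integrable i i).re

/-- The Fourier coefficients of `(β/χ) h` are controlled by the norm of `h`, uniformly in the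
index. -/
lemma two_mul_norm_fourierCoef_le (hp : IsMinimalWeight γ p) {h : VecFun T} (hh : MemL2 p h)
    (k : ℤ) (l : Fin T) {t : ℝ} (ht : 0 < t) :
    2 * ‖fourierCoef γ h k l‖ ≤ t⁻¹ * ∫ x, quad (p x) (h x) ∂circ +
      t * ∫ x, (dualDensity γ p x).trace.re ∂circ := by
  rw [← integral_const_mul, ← integral_const_mul, ← integral_add (hh.integrable.const_mul _)
    (hp.integrable_trace_dual.const_mul _)]
  have hint := hp.integrable_fourierCoef hh k l
  calc 2 * ‖fourierCoef γ h k l‖ ≤ 2 * ∫ x, ‖γ.beta x / γ.chi x *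
        (h x l * Complex.exp (-(Complex.I * x * k)))‖ ∂circ := by
        gcongr; exact norm_integral_le_integral_norm _
    _ = ∫ x, 2 * ‖γ.beta x / γ.chi x *
        (h x l * Complex.exp (-(Complex.I * x * k)))‖ ∂circ := (integral_const_mul _ _).symm
    _ ≤ _ := by
        refine integral_mono_ae (hint.norm.const_mul _)
          ((hh.integrable.const_mul _).add (hp.integrable_trace_dual.const_mul _)) ?_
        filter_upwards [hp.form_dualFun (expVec k l), hp.quad_dualFun (expVec k l), hp.psd,
          (isWeight_dualDensity γ hp.toIsWeight).psd] with x h1 h2 h3 h4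
        simp only [← dotProduct_star_expVec]
        rw [← h1]
        refine (two_mul_norm_form_le h3 (inv_pos.2 ht) _ _).trans ?_
        rw [inv_inv, h2]
        have h5 := quad_le_trace h4 (expVec k l x)
        have h6 : ∑ i, ‖expVec k l x i‖ = 1 := by
          rw [Finset.sum_eq_single l] <;>
            simp +contextual [expVec, norm_exp_I_mul]
        rw [h6, one_pow, mul_one] at h5
        gcongr

lemma exists_norm_fourierCoef_lt (hp : IsMinimalWeight γ p) {ε : ℝ} (hε : 0 < ε) :
    ∃ δ : ℝ≥0∞, 0 < δ ∧ ∀ h, MemL2 p h → normSq p h < δ → ∀ k l, ‖fourierCoef γ h k l‖ < ε := by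
  set K := ∫ x, (dualDensity γ p x).trace.re ∂circ with hK
  have hK0 : 0 ≤ K := integral_nonneg_of_ae (by
    filter_upwards [(isWeight_dualDensity γ hp.toIsWeight).psd] with x hx
      using trace_re_nonneg hx)
  have hK1 : 0 < K + 1 := by linarith
  refine ⟨ENNReal.ofReal (ε ^ 2 / (K + 1)), by positivity, fun h hh hlt k l => ?_⟩
  rw [hp.normSq_eq hh, ENNReal.ofReal_lt_ofReal_iff (by positivity)] at hlt
  have ht : 0 < ε / (K + 1) := by positivity
  have h1 := hp.two_mul_norm_fourierCoef_le hh k l ht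
  rw [← hK] at h1
  have h2 : (ε / (K + 1))⁻¹ * ∫ x, quad (p x) (h x) ∂circ <
      (ε / (K + 1))⁻¹ * (ε ^ 2 / (K + 1)) := by gcongr
  have h3 : (ε / (K + 1))⁻¹ * (ε ^ 2 / (K + 1)) = ε := by field_simp
  have h4 : ε / (K + 1) * K ≤ ε := by
    rw [div_mul_eq_mul_div, div_le_iff₀ hK1]
    nlinarith
  linarith

lemma fourierCoef_trig (c : ℤ →₀ (Fin T → ℂ)) (k : ℤ) (l : Fin T) :
    fourierCoef γ (trig γ c) k l = 2 * Real.pi * c k l := by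
  have h1 : fourierCoef γ (trig γ c) k l =
      ∫ x, ∑ j ∈ c.support, c j l * Complex.exp (Complex.I * (x : ℝ) * (j - k : ℤ)) ∂circ := by
    refine integral_congr_ae ?_
    filter_upwards [γ.beta_ne_zero, γ.chi_ne_zero] with x h1 h2
    have : γ.beta x / γ.chi x * (trig γ c x l * Complex.exp (-(Complex.I * x * k))) =
        trigPoly c x l * Complex.exp (-(Complex.I * x * k)) := by
      rw [trig_apply]
      simp only [Pi.smul_apply, smul_eq_mul]
      field_simp
    simp only [this, trigPoly, Finset.sum_mul]
    refine Finset.sum_congr rfl fun j _ => ?_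
    rw [mul_assoc, ← Complex.exp_add]
    congr 2
    push_cast
    ring
  rw [h1, integral_finsetSum]
  · simp only [integral_const_mul, integral_exp_circ, sub_eq_zero]
    simp only [mul_ite, mul_zero, Finset.sum_ite_eq', Finsupp.mem_support_iff]
    split_ifs with h
    · ring
    · simp [not_not.1 h]
  · intro j _
    refine Integrable.const_mul ?_ _
    have : Continuous fun x : ℝ => Complex.exp (Complex.I * (x : ℝ) * (j - k : ℤ)) := by fun_prop
    exact (this.integrableOn_Icc).mono_set Set.Ioc_subset_Icc_self

lemma memL2_of_mem_obsSpace {N : ℕ} (hp : IsWeight p)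
    (hint : ∀ i j, Integrable (fun x => incDensity γ p x i j) circ) {h : VecFun T}
    (hh : h ∈ obsSpace γ N p) : MemL2 p h := by
  obtain ⟨c, -, hc⟩ := hh.2 1 one_pos
  have h1 := memL2_trig hp hint c
  have h2 := hp.memL2_of_normSq_lt_top (VecMeasurable.sub hh.1 h1.meas)
    (hc.trans ENNReal.one_lt_top)
  simpa using h2.add hp h1

/-- Functions in the observed subspace are orthogonal to the dual functions with unobserved
frequencies. -/
lemma fourierCoef_eq_zero {N : ℕ} (hp : IsMinimalWeight γ p) {h : VecFun T}
    (hh : h ∈ obsSpace γ N p) {k : ℤ} (hk : 0 ≤ k) (hk' : k ≤ N + γ.n) (l : Fin T) :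
    fourierCoef γ h k l = 0 := by
  have hL := memL2_of_mem_obsSpace hp.toIsWeight hp.inc_integrable hh
  rw [← norm_eq_zero]
  refine le_antisymm (le_of_forall_pos_lt_add fun ε hε => ?_) (norm_nonneg _)
  obtain ⟨δ, hδ, H⟩ := hp.exists_norm_fourierCoef_lt hε
  obtain ⟨c, hc, hlt⟩ := hh.2 δ hδ
  have ht := memL2_trig hp.toIsWeight hp.inc_integrable (γ := γ) c
  have h1 := H _ (hL.sub hp.toIsWeight ht) hlt k l
  have hc0 : c k = 0 := by
    by_contra h0
    rcases hc k (Finsupp.mem_support_iff.2 h0) with h2 | h2 <;> omega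
  rw [hp.fourierCoef_sub hL ht, fourierCoef_trig, hc0] at h1
  simpa using h1

/-- A function of `L₂(p)` orthogonal to the dual functions with unobserved frequencies lies in the
observed subspace: the unobserved coefficients of an approximating trigonometric polynomial are
small, so they may be dropped. -/
lemma mem_obsSpace {N : ℕ} (hp : IsMinimalWeight γ p) {h : VecFun T} (hh : MemL2 p h)
    (h0 : ∀ k : ℤ, 0 ≤ k → k ≤ N + γ.n → ∀ l, fourierCoef γ h k l = 0) :
    h ∈ obsSpace γ N p := by
  refine ⟨hh.meas, fun ε hε => ?_⟩
  have hε4 : 0 < ε / 4 := ENNReal.div_pos hε.ne' (by norm_num)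
  have htr : Integrable (fun x => (incDensity γ p x).trace.re) circ := by
    simp only [Matrix.trace, Matrix.diag, Complex.re_sum]
    exact integrable_finsetSum _ fun i _ => (hp.inc_integrable i i).re
  have hw := isWeight_incDensity γ hp.toIsWeight
  set K := ∫ x, (incDensity γ p x).trace.re ∂circ with hK
  let D : ℝ := T * (N + γ.n + 1)
  obtain ⟨η, hη, hηε⟩ : ∃ η : ℝ, 0 < η ∧ ENNReal.ofReal (K * (D * η) ^ 2) < ε / 4 := by
    have hlim : Filter.Tendsto (fun η : ℝ => ENNReal.ofReal (K * (D * η) ^ 2))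
        (nhdsWithin 0 (Set.Ioi 0)) (nhds (ENNReal.ofReal (K * (D * 0) ^ 2))) := by
      have : Continuous fun η : ℝ => ENNReal.ofReal (K * (D * η) ^ 2) :=
        ENNReal.continuous_ofReal.comp (by fun_prop)
      exact this.continuousAt.continuousWithinAt
    have h1 := hlim.eventually (gt_mem_nhds (show _ < ε / 4 by simpa using hε.ne'))
    obtain ⟨η, h2, h3⟩ := (h1.and self_mem_nhdsWithin).exists
    exact ⟨η, h3, h2⟩
  obtain ⟨δ, hδ, H⟩ := hp.exists_norm_fourierCoef_lt hη
  obtain ⟨c, hc⟩ := exists_trig_approx hp.toIsWeight hp.inc_integrable hh (lt_min hδ hε4)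
  have ht := memL2_trig hp.toIsWeight hp.inc_integrable (γ := γ) c
  have hsmall : ∀ k : ℤ, 0 ≤ k → k ≤ N + γ.n → ∀ l, ‖c k l‖ ≤ η := by
    intro k h1 h2 l
    have h3 := H _ (hh.sub hp.toIsWeight ht) (hc.trans_le (min_le_left _ _)) k l
    rw [hp.fourierCoef_sub hh ht, fourierCoef_trig, h0 k h1 h2 l, zero_sub, norm_neg, norm_mul,
      norm_mul, Complex.norm_ofNat, Complex.norm_real, Real.norm_of_nonneg Real.pi_pos.le] at h3
    have h4 : 1 ≤ 2 * Real.pi := by linarith [Real.pi_gt_three]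
    have := norm_nonneg (c k l)
    nlinarith
  classical
  let s : Finset ℤ := Finset.Icc 0 (N + γ.n : ℤ)
  let c₁ := c.filter (fun k => k ∉ s)
  let c₂ := c - c₁
  have hc₂ : c₂.support ⊆ s := by
    intro k hk
    by_contra hks
    rw [Finsupp.mem_support_iff] at hk
    apply hk
    simp [c₂, c₁, hks]
  have hc₂' : ∀ k ∈ s, c₂ k = c k := by
    intro k hk
    simp [c₂, c₁, hk]
  refine ⟨c₁, ?_, ?_⟩
  · intro k hk
    rw [Finsupp.support_filter, Finset.mem_filter, Finset.mem_Icc] at hk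
    have := hk.2
    omega
  · have e : h - trig γ c₁ = (h - trig γ c) + trig γ c₂ := by
      rw [trig_sub]; abel
    have hb : normSq p (trig γ c₂) ≤ ENNReal.ofReal (K * (D * η) ^ 2) := by
      rw [hp.normSq_eq (memL2_trig hp.toIsWeight hp.inc_integrable c₂)]
      refine ENNReal.ofReal_le_ofReal ?_
      rw [hK, ← integral_mul_const]
      refine integral_mono_ae (memL2_trig hp.toIsWeight hp.inc_integrable c₂).integrable
        (htr.mul_const _) ?_
      filter_upwards [hw.psd] with x hx
      rw [quad_trig]
      refine (quad_le_trace hx _).trans ?_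
      have h5 : ∀ i, ‖trigPoly c₂ x i‖ ≤ (N + γ.n + 1) * η := by
        intro i
        rw [trigPoly_eq_sum c₂ hc₂]
        refine (norm_sum_le _ _).trans ?_
        have h6 : ∀ k ∈ s, ‖c₂ k i * Complex.exp (Complex.I * x * k)‖ ≤ η := by
          intro k hk
          rw [norm_mul, norm_exp_I_mul, mul_one, hc₂' k hk]
          exact hsmall k (Finset.mem_Icc.1 hk).1 (Finset.mem_Icc.1 hk).2 i
        refine (Finset.sum_le_card_nsmul _ _ _ h6).trans (le_of_eq ?_)
        rw [Int.card_Icc, nsmul_eq_mul]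
        have : ((N : ℤ) + γ.n + 1 - 0).toNat = N + γ.n + 1 := by omega
        rw [this]
        push_cast
        ring
      have h7 : ∑ i, ‖trigPoly c₂ x i‖ ≤ D * η := by
        refine (Finset.sum_le_card_nsmul _ _ _ fun i _ => h5 i).trans (le_of_eq ?_)
        simp only [Finset.card_univ, Fintype.card_fin, nsmul_eq_mul, D]
        ring
      have h8 : 0 ≤ ∑ i, ‖trigPoly c₂ x i‖ := Finset.sum_nonneg fun _ _ => norm_nonneg _
      have := trace_re_nonneg hx
      gcongr
    rw [e]
    refine (hp.normSq_add_le (hh.meas.sub ht.meas) one_pos).trans_lt ?_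
    have h2 : ENNReal.ofReal (1 + 1) = 2 := by norm_num
    rw [inv_one, h2, ← mul_add]
    calc 2 * (normSq p (h - trig γ c) + normSq p (trig γ c₂)) < 2 * (ε / 4 + ε / 4) :=
          ENNReal.mul_lt_mul_right (by norm_num) (by norm_num)
            (ENNReal.add_lt_add (hc.trans_le (min_le_right _ _)) (hb.trans_lt hηε))
      _ = ε := by
          rw [← two_mul, ← mul_assoc, show (2 * 2 : ℝ≥0∞) = 4 by norm_num]
          exact ENNReal.mul_div_cancel (by norm_num) (by norm_num)

end IsMinimalWeight

/-! ### Block matrices of Fourier coefficients -/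

/-- The trigonometric polynomial `∑_{k < L} v(k) e^{ixk}` with block vector `v` of coefficients. -/
noncomputable def blockPoly {L : ℕ} (v : Fin L × Fin T → ℂ) : VecFun T :=
  fun x p => ∑ k : Fin L, v (k, p) * Complex.exp (Complex.I * x * (k : ℕ))

lemma continuous_blockPoly {L : ℕ} (v : Fin L × Fin T → ℂ) : Continuous (blockPoly v) := by
  refine continuous_pi fun p => ?_
  unfold blockPoly
  fun_prop

lemma integrable_exp_mul {φ : ℝ → ℂ} (hφ : Integrable φ circ) (k : ℤ) :
    Integrable (fun x => Complex.exp (Complex.I * (x : ℝ) * k) * φ x) circ := by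
  refine hφ.bdd_mul (c := 1) (Continuous.aestronglyMeasurable (by fun_prop)) ?_
  exact .of_forall fun x => (norm_exp_I_mul x k).le

lemma integral_blockPoly {L : ℕ} (v : Fin L × Fin T → ℂ) (j : Fin L) (l : Fin T) :
    ∫ x, blockPoly v x l * Complex.exp (-(Complex.I * (x : ℝ) * (j : ℕ))) ∂circ =
      2 * Real.pi * v (j, l) := by
  have h1 : ∀ x : ℝ, blockPoly v x l * Complex.exp (-(Complex.I * (x : ℝ) * (j : ℕ))) =
      ∑ k : Fin L, v (k, l) * Complex.exp (Complex.I * (x : ℝ) * ((k : ℕ) - (j : ℕ) : ℤ)) := by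
    intro x
    rw [blockPoly, Finset.sum_mul]
    refine Finset.sum_congr rfl fun k _ => ?_
    rw [mul_assoc, ← Complex.exp_add]
    congr 2
    push_cast
    ring
  simp_rw [h1]
  rw [integral_finsetSum]
  · simp only [integral_const_mul, integral_exp_circ, sub_eq_zero, Nat.cast_inj, ← Fin.ext_iff]
    simp [mul_comm]
  · intro k _
    have := integrable_exp_mul (integrable_const (1 : ℂ)) ((k : ℕ) - (j : ℕ) : ℤ)
    simp only [mul_one] at this
    exact this.const_mul _

lemma integrable_vecMul_blockPoly {L : ℕ} {F : MatFun T}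
    (hF : ∀ i j, Integrable (fun x => F x i j) circ) (v : Fin L × Fin T → ℂ) (l : Fin T) :
    Integrable (fun x => Matrix.vecMul (blockPoly v x) (F x) l) circ := by
  simp only [Matrix.vecMul, dotProduct, blockPoly, Finset.sum_mul]
  refine integrable_finsetSum _ fun i _ => integrable_finsetSum _ fun k _ => ?_
  have := (integrable_exp_mul (hF i l) ((k : ℕ) : ℤ)).const_mul (v (k, i))
  simpa only [mul_assoc, Int.cast_natCast] using this

/-- A block matrix of Fourier coefficients acts as multiplication followed by truncation of the
Fourier series. -/
lemma fourierBlock_mulVec {L : ℕ} {F : MatFun T}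
    (hF : ∀ i j, Integrable (fun x => F x i j) circ) (v : Fin L × Fin T → ℂ) (j : Fin L)
    (l : Fin T) :
    (fourierBlock L F).mulVec v (j, l) = (1 / (2 * Real.pi) : ℂ) *
      ∫ x, Matrix.vecMul (blockPoly v x) (F x) l *
        Complex.exp (-(Complex.I * (x : ℝ) * (j : ℕ))) ∂circ := by
  have h1 : ∀ x : ℝ, Matrix.vecMul (blockPoly v x) (F x) l *
      Complex.exp (-(Complex.I * (x : ℝ) * (j : ℕ))) =
      ∑ kq : Fin L × Fin T, (Complex.exp (Complex.I * (x : ℝ) * ((kq.1 : ℕ) - (j : ℕ) : ℤ)) *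
        F x kq.2 l) * v kq := by
    intro x
    simp only [Matrix.vecMul, dotProduct, blockPoly, Finset.sum_mul]
    rw [Fintype.sum_prod_type, Finset.sum_comm]
    refine Finset.sum_congr rfl fun k _ => Finset.sum_congr rfl fun q _ => ?_
    have : Complex.exp (Complex.I * (x : ℝ) * ((k : ℕ) - (j : ℕ) : ℤ)) =
        Complex.exp (Complex.I * x * (k : ℕ)) * Complex.exp (-(Complex.I * (x : ℝ) * (j : ℕ))) := by
      rw [← Complex.exp_add]
      congr 1
      push_cast
      ring
    rw [this]
    ring
  simp_rw [h1]
  rw [integral_finsetSum _ fun kq _ => (integrable_exp_mul (hF kq.2 l) _).mul_const _,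
    Finset.mul_sum]
  simp only [Matrix.mulVec, dotProduct, fourierBlock]
  refine Finset.sum_congr rfl fun kq _ => ?_
  rw [integral_mul_const, mul_assoc]
  push_cast
  rfl

lemma fourierBlock_mulVec_dotProduct {L : ℕ} {F : MatFun T}
    (hF : ∀ i j, Integrable (fun x => F x i j) circ) (v : Fin L × Fin T → ℂ) :
    (fourierBlock L F).mulVec v ⬝ᵥ star v = (1 / (2 * Real.pi) : ℂ) *
      ∫ x, form (F x) (blockPoly v x) (blockPoly v x) ∂circ := by
  have h1 : ∀ x : ℝ, form (F x) (blockPoly v x) (blockPoly v x) =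
      ∑ kq : Fin L × Fin T, (Matrix.vecMul (blockPoly v x) (F x) kq.2 *
        Complex.exp (-(Complex.I * (x : ℝ) * (kq.1 : ℕ)))) * star (v kq) := by
    intro x
    rw [form, Matrix.dotProduct_mulVec, Fintype.sum_prod_type, Finset.sum_comm]
    simp only [dotProduct]
    refine Finset.sum_congr rfl fun l _ => ?_
    simp only [Pi.star_apply]
    rw [blockPoly, star_sum, Finset.mul_sum]
    refine Finset.sum_congr rfl fun k _ => ?_
    rw [star_mul', star_exp_I_mul x _ (by simp)]
    ring
  simp_rw [h1]
  rw [integral_finsetSum, Finset.mul_sum]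
  · simp only [dotProduct]
    refine Finset.sum_congr rfl fun kq _ => ?_
    rw [integral_mul_const, ← mul_assoc, ← fourierBlock_mulVec hF v kq.1 kq.2]
    rfl
  · intro kq _
    have := integrable_exp_mul (integrable_vecMul_blockPoly hF v kq.2) (-((kq.1 : ℕ) : ℤ))
    refine Integrable.mul_const (this.congr (.of_forall fun x => ?_)) _
    simp only
    rw [mul_comm]
    congr 2
    push_cast
    ring

/-! ### The optimal spectral characteristic -/

section Optimal

variable {γ : Pattern} {N : ℕ} {f g : MatFun T}

lemma Afun_eq_blockPoly (a : Fin (N + 1) → Fin T → ℂ) :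
    Afun a = blockPoly (fun kq : Fin (N + 1) × Fin T => a kq.1 kq.2) := rfl

lemma sum_extend_zero {M : ℕ} (hM : N + 1 ≤ M) (φ : ℕ → ℂ) (hφ : ∀ k, N < k → φ k = 0) :
    ∑ k : Fin M, φ k = ∑ k : Fin (N + 1), φ k := by
  rw [Fin.sum_univ_eq_sum_range φ, Fin.sum_univ_eq_sum_range φ]
  refine (Finset.sum_subset (Finset.range_mono hM) fun k _ hk => hφ k ?_).symm
  rw [Finset.mem_range] at hk
  omega

lemma Afun_eq_blockPoly_extend (a : Fin (N + 1) → Fin T → ℂ) :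
    Afun a = blockPoly (fun kq : Fin (N + γ.n + 1) × Fin T =>
      if h : (kq.1 : ℕ) < N + 1 then a ⟨kq.1, h⟩ kq.2 else 0) := by
  ext x p
  have := sum_extend_zero (N := N) (M := N + γ.n + 1) (by omega)
    (fun k => (if h : k < N + 1 then a ⟨k, h⟩ p else 0) * Complex.exp (Complex.I * x * k))
    (fun k hk => by rw [dif_neg (by omega), zero_mul])
  simp only [blockPoly, Afun]
  rw [this]
  exact Finset.sum_congr rfl fun k _ => by rw [dif_pos k.2]

lemma bvec_eq_zero (a : Fin (N + 1) → Fin T → ℂ) {k : ℕ} (hk : N < k) : bvec γ a k = 0 := by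
  ext p
  refine Finset.sum_eq_zero fun m _ => if_neg ?_
  have := m.2
  omega

lemma Bfun_eq_blockPoly_extend (a : Fin (N + 1) → Fin T → ℂ) :
    Bfun γ a = blockPoly (fun kq : Fin (N + γ.n + 1) × Fin T => bvec γ a kq.1 kq.2) := by
  ext x p
  exact (sum_extend_zero (N := N) (M := N + γ.n + 1) (by omega)
    (fun k => bvec γ a k p * Complex.exp (Complex.I * x * k))
    (fun k hk => by simp [bvec_eq_zero a hk])).symm

lemma continuous_Afun (a : Fin (N + 1) → Fin T → ℂ) : Continuous (Afun a) := by
  rw [Afun_eq_blockPoly]; exact continuous_blockPoly _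

lemma continuous_Bfun (a : Fin (N + 1) → Fin T → ℂ) : Continuous (Bfun γ a) := by
  rw [Bfun_eq_blockPoly_extend]; exact continuous_blockPoly _

/-- `Aᵀ β̄ g p⁻¹` with `p = f + |β|² g`, the pointwise minimizer of the error density. -/
noncomputable def noiseFun (γ : Pattern) (f g : MatFun T) (A : VecFun T) : VecFun T :=
  fun x => Matrix.vecMul (A x) (star (γ.beta x) • (g x * (obsDensity γ f g x)⁻¹))

/-- `f p⁻¹ g` with `p = f + |β|² g`, the error density at the pointwise minimizer. -/
noncomputable def parallelSum (γ : Pattern) (f g : MatFun T) : MatFun T :=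
  fun x => f x * (obsDensity γ f g x)⁻¹ * g x

lemma specChar_eq (a : Fin (N + 1) → Fin T → ℂ) :
    specChar γ a f g = fun x => (γ.chi x / γ.beta x) • Bfun γ a x -
      noiseFun γ f g (Afun a) x -
      dualFun γ (obsDensity γ f g) (blockPoly (cvec γ a f g)) x := rfl

variable (hf : IsSignalDensity γ f) (hg : IsNoiseDensity g) (hmin : MinimalityCondition γ f g)

include hf hg hmin

lemma error_density_eq : ∀ᵐ x ∂circ, ∀ A u : Fin T → ℂ,
    quad (f x) u + quad (g x) (γ.beta x • u - A) = quad (parallelSum γ f g x) A +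
      quad (obsDensity γ f g x)
        (u - Matrix.vecMul A (star (γ.beta x) • (g x * (obsDensity γ f g x)⁻¹))) := by
  filter_upwards [hf.psd, hg.psd, hmin.1] with x h1 h2 h3 A u
  exact quad_add_quad_sub_eq h1 h2 _ h3 A u

lemma quad_parallelSum_nonneg : ∀ᵐ x ∂circ, ∀ A : Fin T → ℂ,
    0 ≤ quad (parallelSum γ f g x) A := by
  filter_upwards [hf.psd, hg.psd, error_density_eq hf hg hmin] with x h1 h2 h3 A
  have h := h3 A (Matrix.vecMul A (star (γ.beta x) • (g x * (obsDensity γ f g x)⁻¹)))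
  rw [sub_self, quad_zero_vec, add_zero] at h
  rw [← h]
  exact add_nonneg (quad_nonneg h1 _) (quad_nonneg h2 _)

lemma memL2_noiseFun {A : VecFun T} (hA : Continuous A) :
    MemL2 (obsDensity γ f g) (noiseFun γ f g A) := by
  have hp := isMinimalWeight_obsDensity hf hg hmin
  have hgA := hg.isWeight.memL2_of_continuous hg.integrable hA
  refine hp.memL2_of_le (hgA.meas.vecMul (aestronglyMeasurable_smul_matrix
    γ.continuous_beta.star.aestronglyMeasurable
      (aestronglyMeasurable_mul_matrix hg.isWeight.meas hp.inv.meas))) hgA.integrable ?_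
  filter_upwards [quad_parallelSum_nonneg hf hg hmin, error_density_eq hf hg hmin] with x h1 h2
  have h := h2 (A x) 0
  have hz : ∀ M : Matrix (Fin T) (Fin T) ℂ, quad M (0 : Fin T → ℂ) = 0 := quad_zero_vec
  rw [hz, smul_zero, zero_sub, quad_neg, zero_sub, quad_neg, zero_add] at h
  have := h1 (A x)
  simp only [noiseFun]
  linarith

lemma integrable_noise_dual (i j : Fin T) : Integrable (fun x =>
    ((((‖γ.beta x‖ ^ 2 : ℝ) : ℂ) / γ.chi x) • (g x * (obsDensity γ f g x)⁻¹)) i j) circ := by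
  have hp := isMinimalWeight_obsDensity hf hg hmin
  refine (hp.integrable_form (memL2_noiseFun hf hg hmin (continuous_const (y := Pi.single i 1)))
    (hp.memL2_dualFun (continuous_const (y := Pi.single j 1)))).congr ?_
  filter_upwards [hp.form_dualFun fun _ => Pi.single j 1] with x hx
  rw [hx, ← Pi.single_star, dotProduct_single, noiseFun, Matrix.single_one_vecMul]
  simp only [Matrix.row_apply, Matrix.smul_apply, smul_eq_mul, star_one, mul_one]
  have : ((‖γ.beta x‖ ^ 2 : ℝ) : ℂ) = γ.beta x * star (γ.beta x) := by
    rw [Complex.star_def, Complex.mul_conj, Complex.normSq_eq_norm_sq]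
  rw [this]
  ring

lemma integrable_parallelSum (i j : Fin T) :
    Integrable (fun x => parallelSum γ f g x i j) circ := by
  have hp := isMinimalWeight_obsDensity hf hg hmin
  refine ((hg.integrable i j).sub (hp.integrable_form
    (memL2_noiseFun hf hg hmin (continuous_const (y := Pi.single i 1)))
    (memL2_noiseFun hf hg hmin (continuous_const (y := Pi.single j 1))))).congr ?_
  filter_upwards [hp.isUnit_det, hp.psd, hg.psd] with x h1 h2 h3
  have hbb : γ.beta x * star (γ.beta x) = ((‖γ.beta x‖ ^ 2 : ℝ) : ℂ) := by
    rw [Complex.star_def, Complex.mul_conj, Complex.normSq_eq_norm_sq]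
  have e : parallelSum γ f g x = g x - ((‖γ.beta x‖ ^ 2 : ℝ) : ℂ) •
      (g x * (obsDensity γ f g x)⁻¹ * g x) := by
    have h : f x = obsDensity γ f g x - ((‖γ.beta x‖ ^ 2 : ℝ) : ℂ) • g x := by
      simp [obsDensity]
    rw [parallelSum]
    conv_lhs => rw [h]
    rw [sub_mul, sub_mul, Matrix.mul_nonsing_inv _ h1, one_mul, smul_mul_assoc, smul_mul_assoc]
  simp only [Pi.sub_apply, noiseFun]
  rw [vecMul_eq_inv_mul _ _ (Pi.single j 1), form_vecMul_inv_right h2.1 h1, star_smul, star_star,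
    dotProduct_smul, Matrix.star_vecMul, h3.1.eq, e]
  have : Matrix.vecMul (Pi.single i 1) (star (γ.beta x) • (g x * (obsDensity γ f g x)⁻¹)) ⬝ᵥ
      (g x).mulVec (star (Pi.single j 1)) =
      star (γ.beta x) * (g x * (obsDensity γ f g x)⁻¹ * g x) i j := by
    rw [Matrix.dotProduct_mulVec, Matrix.vecMul_vecMul, Matrix.single_one_vecMul, ← Pi.single_star,
      dotProduct_single]
    simp
  rw [this, smul_eq_mul, ← mul_assoc, hbb]
  simp

lemma isUnit_det_Pmat : IsUnit (Pmat γ N f g).det := by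
  have hp := isMinimalWeight_obsDensity hf hg hmin
  have hw := isWeight_dualDensity γ hp.toIsWeight
  rw [← Matrix.isUnit_iff_isUnit_det, ← Matrix.mulVec_injective_iff_isUnit]
  refine (injective_iff_map_eq_zero (Matrix.mulVecLin (Pmat γ N f g))).2 fun v hv => ?_
  have h1 := fourierBlock_mulVec_dotProduct hp.dual_integrable v
  have hv' : (fourierBlock (N + γ.n + 1) (dualDensity γ (obsDensity γ f g))).mulVec v = 0 := hv
  rw [hv', zero_dotProduct] at h1
  have hM := hw.memL2_of_continuous hp.dual_integrable (continuous_blockPoly v)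
  have h2 : ∫ x, form (dualDensity γ (obsDensity γ f g) x) (blockPoly v x) (blockPoly v x) ∂circ
      = ((∫ x, quad (dualDensity γ (obsDensity γ f g) x) (blockPoly v x) ∂circ : ℝ) : ℂ) := by
    rw [← integral_complex_ofReal]
    refine integral_congr_ae ?_
    filter_upwards [hw.psd] with x hx using form_self hx _
  have hpi : (1 / (2 * Real.pi) : ℂ) ≠ 0 := by
    simp [Real.pi_ne_zero]
  have h3 : ∫ x, quad (dualDensity γ (obsDensity γ f g) x) (blockPoly v x) ∂circ = 0 := by
    have := (mul_eq_zero.1 h1.symm).resolve_left hpi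
    rw [h2] at this
    exact_mod_cast this
  rw [integral_eq_zero_iff_of_nonneg_ae (by
    filter_upwards [hw.psd] with x hx using quad_nonneg hx _) hM.integrable] at h3
  have h4 : ∀ᵐ x ∂circ, blockPoly v x = 0 := by
    filter_upwards [h3, hp.inv.psd, hp.isUnit_det, γ.beta_ne_zero, γ.chi_ne_zero]
      with x h5 h6 h7 h8 h9
    simp only [Pi.zero_apply, dualDensity, quad_smul_matrix] at h5
    refine eq_zero_of_quad_eq_zero h6 ?_ ((mul_eq_zero.1 h5).resolve_left ?_)
    · rw [Matrix.det_nonsing_inv]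
      exact h7.ringInverse
    · have h8' : ‖γ.beta x‖ ≠ 0 := by simpa using h8
      have h9' : ‖γ.chi x‖ ≠ 0 := by simpa using h9
      positivity
  ext ⟨j, l⟩
  have h5 := integral_blockPoly v j l
  rw [integral_congr_ae (g := fun _ => 0) (by
    filter_upwards [h4] with x hx
    simp [hx]), integral_zero] at h5
  have : (2 * Real.pi : ℂ) ≠ 0 := by simp [Real.pi_ne_zero]
  exact (mul_eq_zero.1 h5.symm).resolve_left this

lemma Pmat_mulVec_cvec (a : Fin (N + 1) → Fin T → ℂ) :
    (Pmat γ N f g).mulVec (cvec γ a f g) = resid γ a f g := by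
  rw [cvec, Matrix.mulVec_mulVec, Matrix.mul_nonsing_inv _ (isUnit_det_Pmat hf hg hmin),
    Matrix.one_mulVec]

lemma memL2_specChar (a : Fin (N + 1) → Fin T → ℂ) :
    MemL2 (obsDensity γ f g) (specChar γ a f g) := by
  have hp := isMinimalWeight_obsDensity hf hg hmin
  rw [specChar_eq]
  exact ((memL2_chi_div_beta_smul hp.toIsWeight hp.inc_integrable (continuous_Bfun a)).sub hp.toIsWeight
    (memL2_noiseFun hf hg hmin (continuous_Afun a))).sub hp.toIsWeight
    (hp.memL2_dualFun (continuous_blockPoly _))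

/-- The linear system for `c` expresses that the explicit spectral characteristic is orthogonal to
the dual functions with unobserved frequencies. -/
lemma fourierCoef_specChar (a : Fin (N + 1) → Fin T → ℂ) (j : Fin (N + γ.n + 1)) (l : Fin T) :
    fourierCoef γ (specChar γ a f g) (j : ℕ) l = 0 := by
  have hp := isMinimalWeight_obsDensity hf hg hmin
  set b : Fin (N + γ.n + 1) × Fin T → ℂ := fun kq => bvec γ a kq.1 kq.2 with hb
  set a' : Fin (N + γ.n + 1) × Fin T → ℂ :=
    fun kq => if h : (kq.1 : ℕ) < N + 1 then a ⟨kq.1, h⟩ kq.2 else 0 with ha'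
  set FT : MatFun T := fun x =>
    (((‖γ.beta x‖ ^ 2 : ℝ) : ℂ) / γ.chi x) • (g x * (obsDensity γ f g x)⁻¹) with hFT
  have hFTint : ∀ i j, Integrable (fun x => FT x i j) circ := integrable_noise_dual hf hg hmin
  set c := cvec γ a f g with hc
  have hA : Afun a = blockPoly a' := Afun_eq_blockPoly_extend a
  have hB : Bfun γ a = blockPoly b := Bfun_eq_blockPoly_extend a
  have hexp : ∀ φ : ℝ → ℂ, Integrable φ circ →
      Integrable (fun x => φ x * Complex.exp (-(Complex.I * (x : ℝ) * (j : ℕ)))) circ := by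
    intro φ hφ
    refine (integrable_exp_mul hφ (-((j : ℕ) : ℤ))).congr (.of_forall fun x => ?_)
    simp only
    rw [mul_comm]
    congr 2
    push_cast
    ring
  have h1 : fourierCoef γ (specChar γ a f g) (j : ℕ) l =
      ∫ x, (blockPoly b x l * Complex.exp (-(Complex.I * (x : ℝ) * (j : ℕ))) -
        Matrix.vecMul (blockPoly a' x) (FT x) l *
          Complex.exp (-(Complex.I * (x : ℝ) * (j : ℕ))) -
        Matrix.vecMul (blockPoly c x) (dualDensity γ (obsDensity γ f g) x) l *
          Complex.exp (-(Complex.I * (x : ℝ) * (j : ℕ)))) ∂circ := by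
    refine integral_congr_ae ?_
    filter_upwards [γ.beta_ne_zero, γ.chi_ne_zero] with x h2 h3
    have h3' : star (γ.chi x) ≠ 0 := by simpa using h3
    have e1 : ((‖γ.beta x‖ ^ 2 : ℝ) : ℂ) = γ.beta x * star (γ.beta x) := by
      rw [Complex.star_def, Complex.mul_conj, Complex.normSq_eq_norm_sq]
    have e2 : ((‖γ.chi x‖ ^ 2 : ℝ) : ℂ) = γ.chi x * star (γ.chi x) := by
      rw [Complex.star_def, Complex.mul_conj, Complex.normSq_eq_norm_sq]
    simp only [specChar_eq, hFT, dualDensity, noiseFun, dualFun, hA, hB, Matrix.vecMul_smul,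
      Pi.sub_apply, Pi.smul_apply, smul_eq_mul, Int.cast_natCast]
    rw [Complex.ofReal_div, e1, e2]
    field_simp
    ring
  have i1 : Integrable (fun x => blockPoly b x l) circ :=
    ((continuous_apply l).comp (continuous_blockPoly b)).integrableOn_Icc.mono_set
      Set.Ioc_subset_Icc_self
  have i2 : Integrable (fun x => blockPoly b x l * Complex.exp (-(Complex.I * (x : ℝ) * (j : ℕ))) -
      Matrix.vecMul (blockPoly a' x) (FT x) l *
        Complex.exp (-(Complex.I * (x : ℝ) * (j : ℕ)))) circ :=
    (hexp _ i1).sub (hexp _ (integrable_vecMul_blockPoly hFTint a' l))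
  rw [h1, integral_sub i2
    (hexp _ (integrable_vecMul_blockPoly hp.dual_integrable c l)),
    integral_sub (hexp _ i1) (hexp _ (integrable_vecMul_blockPoly hFTint a' l)),
    integral_blockPoly]
  have hP := congrFun (Pmat_mulVec_cvec hf hg hmin a (N := N)) (j, l)
  have hP1 := fourierBlock_mulVec hp.dual_integrable c j l
  have hT1 := fourierBlock_mulVec hFTint a' j l
  have hres : resid γ a f g (j, l) = b (j, l) - (fourierBlock _ FT).mulVec a' (j, l) := rfl
  have hP' : (fourierBlock (N + γ.n + 1) (dualDensity γ (obsDensity γ f g))).mulVec c (j, l) =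
      b (j, l) - (fourierBlock _ FT).mulVec a' (j, l) := hP.trans hres
  rw [hP1, hT1] at hP'
  have : (Real.pi : ℂ) ≠ 0 := by simp [Real.pi_ne_zero]
  have aux : ∀ X Y B : ℂ, 1 / (2 * Real.pi : ℂ) * X = B - 1 / (2 * Real.pi : ℂ) * Y →
      2 * Real.pi * B - Y - X = 0 := by
    intro X Y B h
    field_simp at h
    linear_combination -h
  exact aux _ _ _ hP'

lemma specChar_mem_obsSpace (a : Fin (N + 1) → Fin T → ℂ) :
    specChar γ a f g ∈ obsSpace γ N (obsDensity γ f g) := by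
  refine (isMinimalWeight_obsDensity hf hg hmin).mem_obsSpace (memL2_specChar hf hg hmin a) ?_
  intro k hk hk' l
  have := fourierCoef_specChar hf hg hmin a ⟨k.toNat, by omega⟩ l
  rwa [Int.toNat_of_nonneg hk] at this

/-- The error expression as an integral: the part that no estimate can avoid pointwise, and the
squared distance of the pointwise minimizer from the observed subspace. -/
lemma errorValue_eq (a : Fin (N + 1) → Fin T → ℂ) : errorValue γ a f g = 1 / (2 * Real.pi) *
    (∫ x, quad (parallelSum γ f g x) (Afun a x) ∂circ +
      ∫ x, quad (obsDensity γ f g x)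
        (dualFun γ (obsDensity γ f g) (blockPoly (cvec γ a f g)) x) ∂circ) := by
  have hp := isMinimalWeight_obsDensity hf hg hmin
  have hw := isWeight_dualDensity γ hp.toIsWeight
  have hQint := integrable_parallelSum hf hg hmin
  have hpi : (1 / (2 * Real.pi) : ℂ) = ((1 / (2 * Real.pi) : ℝ) : ℂ) := by push_cast; rfl
  have hQ : ((Qmat γ N f g).mulVec (fun kq => a kq.1 kq.2) ⬝ᵥ star (fun kq => a kq.1 kq.2)).re =
      1 / (2 * Real.pi) * ∫ x, quad (parallelSum γ f g x) (Afun a x) ∂circ := by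
    have h := fourierBlock_mulVec_dotProduct hQint
      (fun kq : Fin (N + 1) × Fin T => a kq.1 kq.2)
    rw [← Afun_eq_blockPoly] at h
    have h2 : (Qmat γ N f g).mulVec (fun kq => a kq.1 kq.2) ⬝ᵥ star (fun kq => a kq.1 kq.2) =
      (1 / (2 * Real.pi) : ℂ) * ∫ x, form (parallelSum γ f g x) (Afun a x) (Afun a x) ∂circ := h
    rw [h2, hpi, Complex.re_ofReal_mul]
    congr 1
    have hI : Integrable (fun x => form (parallelSum γ f g x) (Afun a x) (Afun a x)) circ := by
      simp only [form_eq_sum]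
      refine integrable_finsetSum _ fun i _ => integrable_finsetSum _ fun j _ => ?_
      obtain ⟨C, hC⟩ := exists_ae_bound (continuous_Afun a)
      have hb : ∀ i, ∀ᵐ x ∂circ, ‖Afun a x i‖ ≤ C := fun i => by
        filter_upwards [hC] with x hx
        exact (Finset.single_le_sum (f := fun i => ‖Afun a x i‖) (fun _ _ => norm_nonneg _)
          (Finset.mem_univ i)).trans hx
      refine Integrable.bdd_mul (c := C) (Integrable.mul_bdd (c := C) (hQint i j) ?_ ?_)
        (VecMeasurable.of_continuous (continuous_Afun a) i) (hb i)
      · exact (VecMeasurable.of_continuous (continuous_Afun a) j).star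
      · filter_upwards [hb j] with x hx using by rwa [norm_star]
    exact (integral_re hI).symm
  have hP : (resid γ a f g ⬝ᵥ star (cvec γ a f g)).re = 1 / (2 * Real.pi) *
      ∫ x, quad (obsDensity γ f g x)
        (dualFun γ (obsDensity γ f g) (blockPoly (cvec γ a f g)) x) ∂circ := by
    have h : (Pmat γ N f g).mulVec (cvec γ a f g) ⬝ᵥ star (cvec γ a f g) = _ :=
      fourierBlock_mulVec_dotProduct hp.dual_integrable (cvec γ a f g)
    rw [← Pmat_mulVec_cvec hf hg hmin a, h, hpi, Complex.re_ofReal_mul]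
    congr 1
    have h2 : ∫ x, form (dualDensity γ (obsDensity γ f g) x) (blockPoly (cvec γ a f g) x)
          (blockPoly (cvec γ a f g) x) ∂circ
        = ((∫ x, quad (dualDensity γ (obsDensity γ f g) x)
            (blockPoly (cvec γ a f g) x) ∂circ : ℝ) : ℂ) := by
      rw [← integral_complex_ofReal]
      refine integral_congr_ae ?_
      filter_upwards [hw.psd] with x hx using form_self hx _
    rw [h2, Complex.ofReal_re]
    refine integral_congr_ae ?_
    filter_upwards [hp.quad_dualFun (blockPoly (cvec γ a f g))] with x hx using hx.symm
  rw [errorValue, hQ, hP]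
  ring

/-- Orthogonality of the two parts of the error: functions in the observed subspace are orthogonal
to the dual functions with unobserved frequencies. -/
lemma integral_form_dualFun_eq_zero {h : VecFun T} (hh : h ∈ obsSpace γ N (obsDensity γ f g))
    (v : Fin (N + γ.n + 1) × Fin T → ℂ) :
    ∫ x, form (obsDensity γ f g x) (h x)
      (dualFun γ (obsDensity γ f g) (blockPoly v) x) ∂circ = 0 := by
  have hp := isMinimalWeight_obsDensity hf hg hmin
  have hL := IsMinimalWeight.memL2_of_mem_obsSpace hp.toIsWeight hp.inc_integrable hh
  have h1 : ∫ x, form (obsDensity γ f g x) (h x)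
      (dualFun γ (obsDensity γ f g) (blockPoly v) x) ∂circ =
      ∫ x, ∑ kq : Fin (N + γ.n + 1) × Fin T, star (v kq) * (γ.beta x / γ.chi x *
        (h x kq.2 * Complex.exp (-(Complex.I * x * ((kq.1 : ℕ) : ℤ))))) ∂circ := by
    refine integral_congr_ae ?_
    filter_upwards [hp.form_dualFun (blockPoly v)] with x hx
    rw [hx, Fintype.sum_prod_type, Finset.sum_comm]
    simp only [dotProduct, Finset.mul_sum]
    refine Finset.sum_congr rfl fun l _ => ?_
    simp only [Pi.star_apply]
    rw [blockPoly, star_sum, Finset.mul_sum, Finset.mul_sum]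
    refine Finset.sum_congr rfl fun k _ => ?_
    rw [star_mul', star_exp_I_mul x _ (by simp)]
    push_cast
    ring
  rw [h1, integral_finsetSum _ fun kq _ => (hp.integrable_fourierCoef hL _ _).const_mul _]
  refine Finset.sum_eq_zero fun kq _ => ?_
  rw [integral_const_mul]
  have := hp.fourierCoef_eq_zero hh (k := ((kq.1 : ℕ) : ℤ)) (by omega)
    (by have := kq.1.2; omega) kq.2
  rw [fourierCoef] at this
  rw [this, mul_zero]

lemma obsSpace_sub_mem {h h' : VecFun T} (hh : h ∈ obsSpace γ N (obsDensity γ f g))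
    (hh' : h' ∈ obsSpace γ N (obsDensity γ f g)) :
    h - h' ∈ obsSpace γ N (obsDensity γ f g) := by
  have hp := isMinimalWeight_obsDensity hf hg hmin
  have hL := IsMinimalWeight.memL2_of_mem_obsSpace hp.toIsWeight hp.inc_integrable hh
  have hL' := IsMinimalWeight.memL2_of_mem_obsSpace hp.toIsWeight hp.inc_integrable hh'
  refine hp.mem_obsSpace (hL.sub hp.toIsWeight hL') fun k hk hk' l => ?_
  rw [hp.fourierCoef_sub hL hL', hp.fourierCoef_eq_zero hh hk hk',
    hp.fourierCoef_eq_zero hh' hk hk', sub_zero]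

/-- Pythagorean identity for the mean-square error. -/
theorem mse_eq (a : Fin (N + 1) → Fin T → ℂ) {h : VecFun T}
    (hh : h ∈ obsSpace γ N (obsDensity γ f g)) :
    mse γ a h f g = ENNReal.ofReal (errorValue γ a f g) +
      ENNReal.ofReal (1 / (2 * Real.pi)) * normSq (obsDensity γ f g) (h - specChar γ a f g) := by
  have hp := isMinimalWeight_obsDensity hf hg hmin
  have hd := obsSpace_sub_mem hf hg hmin hh (specChar_mem_obsSpace hf hg hmin a)
  have hdL := IsMinimalWeight.memL2_of_mem_obsSpace hp.toIsWeight hp.inc_integrable hd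
  set D := dualFun γ (obsDensity γ f g) (blockPoly (cvec γ a f g)) with hD
  have hDL : MemL2 (obsDensity γ f g) D := hp.memL2_dualFun (continuous_blockPoly _)
  set d := h - specChar γ a f g with hdd
  have hQint : Integrable (fun x => quad (parallelSum γ f g x) (Afun a x)) circ := by
    have hgA := hg.isWeight.memL2_of_continuous hg.integrable (continuous_Afun a)
    refine (hgA.integrable.sub
      (memL2_noiseFun hf hg hmin (continuous_Afun a)).integrable).congr ?_
    filter_upwards [error_density_eq hf hg hmin] with x hx
    have h := hx (Afun a x) 0
    have hz : ∀ M : Matrix (Fin T) (Fin T) ℂ, quad M (0 : Fin T → ℂ) = 0 := quad_zero_vec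
    rw [hz, smul_zero, zero_sub, quad_neg, zero_sub, quad_neg, zero_add] at h
    simp only [Pi.sub_apply, noiseFun]
    linarith
  have hfi := hp.integrable_form hdL hDL
  have hre : ∫ x, (form (obsDensity γ f g x) (d x) (D x)).re ∂circ = 0 := by
    have h1 := integral_re hfi
    have h2 := integral_form_dualFun_eq_zero hf hg hmin hd (cvec γ a f g)
    rw [h2] at h1
    simpa using h1
  have hpt : ∀ᵐ x ∂circ, quad (f x) (errFun γ a h x) +
      quad (g x) (γ.beta x • errFun γ a h x - Afun a x) =
      (quad (parallelSum γ f g x) (Afun a x) + quad (obsDensity γ f g x) (D x)) +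
        (quad (obsDensity γ f g x) (d x) - 2 * (form (obsDensity γ f g x) (d x) (D x)).re) := by
    filter_upwards [error_density_eq hf hg hmin, hp.psd] with x h1 h2
    rw [h1 (Afun a x) (errFun γ a h x)]
    have e : errFun γ a h x - Matrix.vecMul (Afun a x)
        (star (γ.beta x) • (g x * (obsDensity γ f g x)⁻¹)) = -d x + D x := by
      simp only [hdd, specChar_eq, errFun, noiseFun, Pi.sub_apply, hD]
      abel
    rw [e, quad_add h2, quad_neg]
    have : form (obsDensity γ f g x) (-d x) (D x) = -form (obsDensity γ f g x) (d x) (D x) := by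
      simpa using form_smul_left (M := obsDensity γ f g x) (u := d x) (v := D x) (-1)
    rw [this, Complex.neg_re]
    ring
  have hI : Integrable (fun x => quad (f x) (errFun γ a h x) +
      quad (g x) (γ.beta x • errFun γ a h x - Afun a x)) circ :=
    ((hQint.add hDL.integrable).add (hdL.integrable.sub (hfi.re.const_mul 2))).congr
      (hpt.mono fun x hx => hx.symm)
  have h0 : 0 ≤ᵐ[circ] fun x => quad (f x) (errFun γ a h x) +
      quad (g x) (γ.beta x • errFun γ a h x - Afun a x) := by
    filter_upwards [hf.psd, hg.psd] with x h1 h2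
      using add_nonneg (quad_nonneg h1 _) (quad_nonneg h2 _)
  have hfi2 : Integrable (fun x => 2 * (form (obsDensity γ f g x) (d x) (D x)).re) circ :=
    hfi.re.const_mul 2
  have hI1 : Integrable (fun x => quad (parallelSum γ f g x) (Afun a x) +
      quad (obsDensity γ f g x) (D x)) circ := hQint.add hDL.integrable
  have hI2 : Integrable (fun x => quad (obsDensity γ f g x) (d x) -
      2 * (form (obsDensity γ f g x) (d x) (D x)).re) circ := hdL.integrable.sub hfi2
  rw [mse, ← ofReal_integral_eq_lintegral_ofReal hI h0, integral_congr_ae hpt,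
    integral_add hI1 hI2,
    integral_add hQint hDL.integrable, integral_sub hdL.integrable hfi2,
    integral_const_mul, hre, mul_zero, sub_zero, hp.normSq_eq hdL, errorValue_eq hf hg hmin,
    ← ENNReal.ofReal_mul (by positivity), ← ENNReal.ofReal_mul (by positivity),
    ← ENNReal.ofReal_add, mul_add]
  · refine mul_nonneg (by positivity) (add_nonneg (integral_nonneg_of_ae ?_)
      (integral_nonneg_of_ae ?_))
    · filter_upwards [quad_parallelSum_nonneg hf hg hmin] with x hx using hx _
    · filter_upwards [hp.psd] with x hx using quad_nonneg hx _
  · refine mul_nonneg (by positivity) (integral_nonneg_of_ae ?_)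
    filter_upwards [hp.psd] with x hx using quad_nonneg hx _

lemma mse_specChar (a : Fin (N + 1) → Fin T → ℂ) :
    mse γ a (specChar γ a f g) f g = ENNReal.ofReal (errorValue γ a f g) := by
  have h0 : normSq (obsDensity γ f g) 0 = 0 := by
    simp [normSq, quad_zero_vec]
  rw [mse_eq hf hg hmin a (specChar_mem_obsSpace hf hg hmin a), sub_self, h0, mul_zero, add_zero]

lemma minMse_eq (a : Fin (N + 1) → Fin T → ℂ) :
    minMse γ a f g = ENNReal.ofReal (errorValue γ a f g) := by
  refine le_antisymm ?_ ?_
  · rw [← mse_specChar hf hg hmin a]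
    exact iInf₂_le _ (specChar_mem_obsSpace hf hg hmin a)
  · refine le_iInf₂ fun h hh => ?_
    rw [mse_eq hf hg hmin a hh]
    exact le_self_add

theorem isOptimal_specChar (a : Fin (N + 1) → Fin T → ℂ) :
    IsOptimal γ a (specChar γ a f g) f g :=
  ⟨specChar_mem_obsSpace hf hg hmin a, by
    rw [mse_specChar hf hg hmin, minMse_eq hf hg hmin]⟩

end Optimal

/-! ### Mixtures of spectral densities -/

section Pointwise

variable {M N : Matrix (Fin T) (Fin T) ℂ}

lemma quad_real_smul (t : ℝ) (u : Fin T → ℂ) : quad (t • M) u = t * quad M u := by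
  rw [← quad_smul_matrix]
  congr 1

lemma isUnit_det_of_quad_le (hN : N.PosSemidef) (hdet : IsUnit N.det)
    {c : ℝ} (hc : 0 < c) (h : ∀ u, c * quad N u ≤ quad M u) : IsUnit M.det := by
  rw [← Matrix.isUnit_iff_isUnit_det, ← Matrix.vecMul_injective_iff_isUnit]
  refine (injective_iff_map_eq_zero (Matrix.vecMulLinear M)).2 fun v hv => ?_
  have hv' : Matrix.vecMul v M = 0 := hv
  have h1 : quad M v = 0 := by
    rw [quad, Matrix.dotProduct_mulVec, hv', zero_dotProduct, Complex.zero_re]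
  have h2 := h v
  have h3 := quad_nonneg hN v
  refine eq_zero_of_quad_eq_zero hN hdet (le_antisymm ?_ h3)
  rw [h1] at h2
  nlinarith

/-- The matrix inverse is antitone on positive definite matrices. -/
lemma quad_inv_le (hM : M.PosSemidef) (hN : N.PosSemidef) (hMdet : IsUnit M.det)
    (hdet : IsUnit N.det) {c : ℝ} (hc : 0 < c) (h : ∀ u, c * quad N u ≤ quad M u)
    (w : Fin T → ℂ) : quad M⁻¹ w ≤ c⁻¹ * quad N⁻¹ w := by
  set v := Matrix.vecMul w M⁻¹ with hv
  have h1 : form M v v = v ⬝ᵥ star w := form_vecMul_inv_right hM.1 hMdet v w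
  have h2 : form N v (Matrix.vecMul w N⁻¹) = v ⬝ᵥ star w := form_vecMul_inv_right hN.1 hdet v w
  have h3 := two_mul_norm_form_le hN hc v (Matrix.vecMul w N⁻¹)
  rw [h2, ← h1, form_self hM, quad_vecMul_inv hN.1 hdet, Complex.norm_real,
    Real.norm_of_nonneg (quad_nonneg hM v)] at h3
  have h4 := h v
  rw [← quad_vecMul_inv hM.1 hMdet, ← hv]
  linarith

/-- Convergence in the norm of a positive definite form implies convergence. -/
lemma tendsto_zero_of_quad_tendsto_zero (hM : M.PosSemidef) (hdet : IsUnit M.det)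
    {v : ℕ → Fin T → ℂ} (h : Filter.Tendsto (fun n => quad M (v n)) Filter.atTop (nhds 0)) :
    Filter.Tendsto v Filter.atTop (nhds 0) := by
  rw [tendsto_pi_nhds]
  intro i
  rw [Metric.tendsto_atTop]
  intro ε hε
  set K := quad M⁻¹ (Pi.single i 1) with hK
  have hK0 : 0 ≤ K := quad_nonneg hM.inv _
  have hs : 0 < ε / (K + 1) := by positivity
  obtain ⟨n₀, hn₀⟩ := (Metric.tendsto_atTop.1 h) (ε / (K + 1) * ε) (by positivity)
  refine ⟨n₀, fun n hn => ?_⟩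
  have h1 := hn₀ n hn
  rw [Real.dist_eq, sub_zero, abs_of_nonneg (quad_nonneg hM _)] at h1
  have h2 := two_mul_norm_form_le hM (inv_pos.2 hs) (v n) (Matrix.vecMul (Pi.single i 1) M⁻¹)
  rw [form_vecMul_inv_right hM.1 hdet, quad_vecMul_inv hM.1 hdet, inv_inv, ← hK,
    ← Pi.single_star, dotProduct_single, star_one, mul_one] at h2
  have h3 : (ε / (K + 1))⁻¹ * quad M (v n) < (ε / (K + 1))⁻¹ * (ε / (K + 1) * ε) := by gcongr
  rw [inv_mul_cancel_left₀ hs.ne'] at h3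
  have h4 : ε / (K + 1) * K ≤ ε := by
    rw [div_mul_eq_mul_div, div_le_iff₀ (by positivity)]
    nlinarith
  rw [Pi.zero_apply, dist_zero_right]
  linarith

lemma continuous_quad (M : Matrix (Fin T) (Fin T) ℂ) : Continuous fun u => quad M u := by
  simp only [quad_eq_re_form, form_eq_sum]
  fun_prop

end Pointwise

lemma obsSpace_subset {γ : Pattern} {N : ℕ} {p p' : MatFun T} {K : ℝ≥0∞} (hK : K ≠ ∞)
    (h : ∀ u, normSq p' u ≤ K * normSq p u) : obsSpace γ N p ⊆ obsSpace γ N p' := by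
  intro u hu
  refine ⟨hu.1, fun ε hε => ?_⟩
  obtain ⟨c, hc, hlt⟩ := hu.2 (ε / (K + 1)) (ENNReal.div_pos hε.ne' (by finiteness))
  refine ⟨c, hc, (h _).trans_lt ?_⟩
  have h1 := (ENNReal.lt_div_iff_mul_lt (by simp) (Or.inl (by finiteness))).1 hlt
  refine lt_of_le_of_lt ?_ h1
  rw [mul_comm]
  gcongr
  exact le_self_add

section Mixture

variable {γ : Pattern} {N : ℕ} {f₀ g₀ f g : MatFun T}

lemma quad_obsDensity_mix (t : ℝ) (x : ℝ) (u : Fin T → ℂ) :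
    quad (obsDensity γ ((1 - t) • f₀ + t • f) ((1 - t) • g₀ + t • g) x) u =
      (1 - t) * quad (obsDensity γ f₀ g₀ x) u + t * quad (obsDensity γ f g x) u := by
  simp only [obsDensity, Pi.add_apply, Pi.smul_apply, quad_add_matrix, quad_smul_matrix,
    quad_real_smul]
  ring

lemma normSq_le_mix_left (hf : IsSignalDensity γ f) (hg : IsNoiseDensity g) {t : ℝ} (ht : 0 ≤ t)
    (ht1 : t < 1) (u : VecFun T) : normSq (obsDensity γ f₀ g₀) u ≤ ENNReal.ofReal (1 - t)⁻¹ *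
      normSq (obsDensity γ ((1 - t) • f₀ + t • f) ((1 - t) • g₀ + t • g)) u := by
  have hs : 0 < 1 - t := by linarith
  unfold normSq
  rw [← lintegral_const_mul' _ _ ENNReal.ofReal_ne_top]
  refine lintegral_mono_ae ?_
  filter_upwards [(isWeight_obsDensity hf hg).psd] with x hx
  rw [← ENNReal.ofReal_mul (by positivity), quad_obsDensity_mix]
  refine ENNReal.ofReal_le_ofReal ?_
  rw [mul_add, inv_mul_cancel_left₀ hs.ne']
  have := quad_nonneg hx (u x)
  have : 0 ≤ (1 - t)⁻¹ * (t * quad (obsDensity γ f g x) (u x)) := by positivity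
  linarith

lemma normSq_le_mix_right (hf₀ : IsSignalDensity γ f₀) (hg₀ : IsNoiseDensity g₀) {t : ℝ}
    (ht : 0 < t) (ht1 : t ≤ 1) (u : VecFun T) : normSq (obsDensity γ f g) u ≤ ENNReal.ofReal t⁻¹ *
      normSq (obsDensity γ ((1 - t) • f₀ + t • f) ((1 - t) • g₀ + t • g)) u := by
  have hs : 0 ≤ 1 - t := by linarith
  unfold normSq
  rw [← lintegral_const_mul' _ _ ENNReal.ofReal_ne_top]
  refine lintegral_mono_ae ?_
  filter_upwards [(isWeight_obsDensity hf₀ hg₀).psd] with x hx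
  rw [← ENNReal.ofReal_mul (by positivity), quad_obsDensity_mix]
  refine ENNReal.ofReal_le_ofReal ?_
  rw [mul_add, inv_mul_cancel_left₀ ht.ne']
  have := quad_nonneg hx (u x)
  have : 0 ≤ t⁻¹ * ((1 - t) * quad (obsDensity γ f₀ g₀ x) (u x)) := by positivity
  linarith

/-- The minimality condition passes from one pair to its proper mixtures with any other pair. -/
lemma minimalityCondition_mix (hf₀ : IsSignalDensity γ f₀) (hg₀ : IsNoiseDensity g₀)
    (hf : IsSignalDensity γ f) (hg : IsNoiseDensity g) {t : ℝ} (ht : 0 ≤ t) (ht1 : t < 1)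
    (hft : IsSignalDensity γ ((1 - t) • f₀ + t • f)) (hgt : IsNoiseDensity ((1 - t) • g₀ + t • g))
    (hmin : MinimalityCondition γ f₀ g₀) :
    MinimalityCondition γ ((1 - t) • f₀ + t • f) ((1 - t) • g₀ + t • g) := by
  have hs : 0 < 1 - t := by linarith
  have h0 := isWeight_obsDensity hf₀ hg₀
  have h1 := isWeight_obsDensity hf hg
  have ht' := isWeight_obsDensity hft hgt
  have hle : ∀ᵐ x ∂circ, ∀ u, (1 - t) * quad (obsDensity γ f₀ g₀ x) u ≤
      quad (obsDensity γ ((1 - t) • f₀ + t • f) ((1 - t) • g₀ + t • g) x) u := by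
    filter_upwards [h1.psd] with x hx u
    rw [quad_obsDensity_mix]
    have := mul_nonneg ht (quad_nonneg hx u)
    linarith
  have hdet : ∀ᵐ x ∂circ,
      IsUnit (obsDensity γ ((1 - t) • f₀ + t • f) ((1 - t) • g₀ + t • g) x).det := by
    filter_upwards [h0.psd, hmin.1, hle] with x a1 a3 a4
      using isUnit_det_of_quad_le a1 a3 hs a4
  refine ⟨hdet, ?_⟩
  have hm : AEStronglyMeasurable (fun x => ((‖γ.beta x‖ ^ 2 / ‖γ.chi x‖ ^ 2 : ℝ) : ℂ) *
      ((obsDensity γ ((1 - t) • f₀ + t • f) ((1 - t) • g₀ + t • g) x)⁻¹).trace) circ := by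
    have hw := (isWeight_dualDensity γ ht').meas
    have : AEStronglyMeasurable (fun x => ∑ i, dualDensity γ
        (obsDensity γ ((1 - t) • f₀ + t • f) ((1 - t) • g₀ + t • g)) x i i) circ :=
      Finset.aestronglyMeasurable_fun_sum _ fun i _ => hw i i
    refine this.congr (.of_forall fun x => ?_)
    simp [dualDensity, Matrix.trace, Finset.mul_sum]
  refine (hmin.2.norm.const_mul (1 - t)⁻¹).mono' hm ?_
  filter_upwards [h0.psd, ht'.psd, hmin.1, hdet, hle] with x a1 a2 a3 a4 a5
  have hnorm : ∀ M : Matrix (Fin T) (Fin T) ℂ, M.PosSemidef → ‖M.trace‖ = M.trace.re := by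
    intro M hM
    have := (Complex.le_def.1 hM.trace_nonneg).2
    rw [← Complex.re_add_im M.trace, ← this]
    simp [trace_re_nonneg hM]
  rw [norm_mul, norm_mul, hnorm _ a2.inv, hnorm _ a1.inv, trace_re_eq_sum, trace_re_eq_sum,
    mul_left_comm, Finset.mul_sum (a := (1 - t)⁻¹)]
  gcongr with i
  exact quad_inv_le a2 a1 a4 a3 hs a5 _

lemma vecMeasurable_errFun (γ : Pattern) (a : Fin (N + 1) → Fin T → ℂ) {h : VecFun T}
    (hh : VecMeasurable h) : VecMeasurable (errFun γ a h) := by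
  have hm : AEStronglyMeasurable (fun x => γ.chi x / γ.beta x) circ :=
    (γ.continuous_chi.measurable.div γ.continuous_beta.measurable).aestronglyMeasurable
  exact ((VecMeasurable.of_continuous (continuous_Bfun (γ := γ) a)).smul hm).sub hh

lemma vecMeasurable_noise_error (γ : Pattern) (a : Fin (N + 1) → Fin T → ℂ) {h : VecFun T}
    (hh : VecMeasurable h) : VecMeasurable (fun x => γ.beta x • errFun γ a h x - Afun a x) :=
  ((vecMeasurable_errFun γ a hh).smul γ.continuous_beta.aestronglyMeasurable).sub
    (.of_continuous (continuous_Afun a))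

lemma aemeasurable_error_density (hf : IsWeight f) (hg : IsWeight g)
    (a : Fin (N + 1) → Fin T → ℂ) {h : VecFun T} (hh : VecMeasurable h) :
    AEMeasurable (fun x => ENNReal.ofReal (quad (f x) (errFun γ a h x) +
      quad (g x) (γ.beta x • errFun γ a h x - Afun a x))) circ :=
  ((aestronglyMeasurable_quad hf.meas (vecMeasurable_errFun γ a hh)).add
    (aestronglyMeasurable_quad hg.meas
      (vecMeasurable_noise_error γ a hh))).aemeasurable.ennreal_ofReal

/-- For a fixed spectral characteristic, the mean-square error is affine in the densities. -/
lemma mse_mix (hf₀ : IsSignalDensity γ f₀) (hg₀ : IsNoiseDensity g₀)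
    (hf : IsSignalDensity γ f) (hg : IsNoiseDensity g) {t : ℝ} (ht : 0 ≤ t) (ht1 : t ≤ 1)
    (a : Fin (N + 1) → Fin T → ℂ) {h : VecFun T} (hh : VecMeasurable h) :
    mse γ a h ((1 - t) • f₀ + t • f) ((1 - t) • g₀ + t • g) =
      ENNReal.ofReal (1 - t) * mse γ a h f₀ g₀ + ENNReal.ofReal t * mse γ a h f g := by
  have hs : 0 ≤ 1 - t := by linarith
  unfold mse
  rw [mul_left_comm, mul_left_comm (ENNReal.ofReal t), ← mul_add,
    ← lintegral_const_mul' (ENNReal.ofReal (1 - t)) _ ENNReal.ofReal_ne_top,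
    ← lintegral_const_mul' (ENNReal.ofReal t) _ ENNReal.ofReal_ne_top, ← lintegral_add_left'
    ((aemeasurable_error_density hf₀.isWeight hg₀.isWeight a hh).const_mul _)]
  congr 1
  refine lintegral_congr_ae ?_
  filter_upwards [hf₀.psd, hg₀.psd, hf.psd, hg.psd] with x h1 h2 h3 h4
  have e1 := quad_nonneg h1 (errFun γ a h x)
  have e2 := quad_nonneg h2 (γ.beta x • errFun γ a h x - Afun a x)
  have e3 := quad_nonneg h3 (errFun γ a h x)
  have e4 := quad_nonneg h4 (γ.beta x • errFun γ a h x - Afun a x)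
  rw [← ENNReal.ofReal_mul hs, ← ENNReal.ofReal_mul ht,
    ← ENNReal.ofReal_add (by positivity) (by positivity)]
  simp only [Pi.add_apply, Pi.smul_apply, quad_add_matrix, quad_real_smul]
  congr 1
  ring

end Mixture

/-! ### Least favorable densities and minimax characteristics -/

section Minimax

variable {γ : Pattern} {N : ℕ} {f₀ g₀ f g : MatFun T}

lemma convex_mix_mem {D : Set (MatFun T)} (hD : Convex ℝ D) (hf₀ : f₀ ∈ D) (hf : f ∈ D) {t : ℝ}
    (ht : 0 ≤ t) (ht1 : t ≤ 1) : (1 - t) • f₀ + t • f ∈ D :=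
  hD hf₀ hf (by linarith) ht (by ring)

variable {Df Dg : Set (MatFun T)} {a : Fin (N + 1) → Fin T → ℂ}
  (hDf : ∀ f ∈ Df, IsSignalDensity γ f) (hDg : ∀ g ∈ Dg, IsNoiseDensity g)
  (hf₀ : f₀ ∈ Df) (hg₀ : g₀ ∈ Dg) (hmin : MinimalityCondition γ f₀ g₀)
  (hmax : ∀ f ∈ Df, ∀ g ∈ Dg, MinimalityCondition γ f g →
    errorValue γ a f g ≤ errorValue γ a f₀ g₀)

include hDf hDg hf₀ hg₀ hmin hmax

/-- Over convex classes, the bound for pairs satisfying the minimality condition extends to all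
pairs: the minimal error is concave, and the midpoint with `(f₀, g₀)` satisfies the condition. -/
lemma minMse_le_of_convex (hcf : Convex ℝ Df) (hcg : Convex ℝ Dg) (hf : f ∈ Df) (hg : g ∈ Dg) :
    minMse γ a f g ≤ minMse γ a f₀ g₀ := by
  have h2 : (0 : ℝ) < 2⁻¹ := by norm_num
  have hft := convex_mix_mem hcf hf₀ hf (t := 2⁻¹) (by norm_num) (by norm_num)
  have hgt := convex_mix_mem hcg hg₀ hg (t := 2⁻¹) (by norm_num) (by norm_num)
  have hmt := minimalityCondition_mix (hDf _ hf₀) (hDg _ hg₀) (hDf _ hf) (hDg _ hg)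
    (t := 2⁻¹) (by norm_num) (by norm_num) (hDf _ hft) (hDg _ hgt) hmin
  set ft := (1 - (2⁻¹ : ℝ)) • f₀ + (2⁻¹ : ℝ) • f with hft'
  set gt := (1 - (2⁻¹ : ℝ)) • g₀ + (2⁻¹ : ℝ) • g with hgt'
  set h := specChar γ a ft gt with hh
  have hmem := specChar_mem_obsSpace (hDf _ hft) (hDg _ hgt) hmt a
  have hle : mse γ a h ft gt ≤ minMse γ a f₀ g₀ := by
    rw [hh, mse_specChar (hDf _ hft) (hDg _ hgt) hmt, minMse_eq (hDf _ hf₀) (hDg _ hg₀) hmin]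
    exact ENNReal.ofReal_le_ofReal (hmax _ hft _ hgt hmt)
  have h0 : minMse γ a f₀ g₀ ≤ mse γ a h f₀ g₀ :=
    iInf₂_le _ (obsSpace_subset ENNReal.ofReal_ne_top (normSq_le_mix_left (hDf _ hf) (hDg _ hg)
      (by norm_num) (by norm_num)) hmem)
  have h1 : minMse γ a f g ≤ mse γ a h f g :=
    iInf₂_le _ (obsSpace_subset ENNReal.ofReal_ne_top (normSq_le_mix_right (hDf _ hf₀) (hDg _ hg₀)
      h2 (by norm_num)) hmem)
  rw [hft', hgt', mse_mix (hDf _ hf₀) (hDg _ hg₀) (hDf _ hf) (hDg _ hg) (by norm_num)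
    (by norm_num) a hmem.1, show (1 : ℝ) - 2⁻¹ = 2⁻¹ by norm_num, ← mul_add] at hle
  have h3 : ENNReal.ofReal 2⁻¹ = 2⁻¹ := by
    rw [ENNReal.ofReal_inv_of_pos (by norm_num)]; norm_num
  have hfin : minMse γ a f₀ g₀ ≠ ∞ := by
    rw [minMse_eq (hDf _ hf₀) (hDg _ hg₀) hmin]; exact ENNReal.ofReal_ne_top
  have h4 : minMse γ a f₀ g₀ + minMse γ a f g ≤ minMse γ a f₀ g₀ + minMse γ a f₀ g₀ := by
    refine (add_le_add h0 h1).trans ?_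
    have h5 := mul_le_mul_right hle 2
    rw [h3, ← mul_assoc, ENNReal.mul_inv_cancel (by norm_num) (by norm_num), one_mul] at h5
    rwa [← two_mul]
  exact (ENNReal.add_le_add_iff_left hfin).1 h4

lemma leastFavorable (h : (∀ f ∈ Df, ∀ g ∈ Dg, MinimalityCondition γ f g) ∨
    (Convex ℝ Df ∧ Convex ℝ Dg)) : LeastFavorable γ a Df Dg f₀ g₀ := by
  have hopt := isOptimal_specChar (hDf _ hf₀) (hDg _ hg₀) hmin a
  refine ⟨hf₀, hg₀, specChar γ a f₀ g₀, hopt, fun f hf g hg => ?_⟩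
  rw [hopt.2]
  rcases h with h | ⟨hcf, hcg⟩
  · rw [minMse_eq (hDf _ hf₀) (hDg _ hg₀) hmin, minMse_eq (hDf _ hf) (hDg _ hg) (h f hf g hg)]
    exact ENNReal.ofReal_le_ofReal (hmax f hf g hg (h f hf g hg))
  · exact minMse_le_of_convex hDf hDg hf₀ hg₀ hmin hmax hcf hcg hf hg

/-- The optimal characteristic for a small mixture with `(f, g)` does no worse at `(f, g)` than the
value at `(f₀, g₀)`, and it is close to the optimal characteristic for `(f₀, g₀)`. -/
lemma mse_specChar_mix_le (hcf : Convex ℝ Df) (hcg : Convex ℝ Dg) (hf : f ∈ Df) (hg : g ∈ Dg)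
    {t : ℝ} (ht : 0 < t) (ht1 : t ≤ 2⁻¹) :
    ∃ h, VecMeasurable h ∧ mse γ a h f g ≤ minMse γ a f₀ g₀ ∧
      normSq (obsDensity γ f₀ g₀) (h - specChar γ a f₀ g₀) ≤
        ENNReal.ofReal t * (2 * (ENNReal.ofReal (1 / (2 * Real.pi)))⁻¹ * minMse γ a f₀ g₀) := by
  have hs : 0 < 1 - t := by linarith
  have hft := convex_mix_mem hcf hf₀ hf (t := t) ht.le (by linarith)
  have hgt := convex_mix_mem hcg hg₀ hg (t := t) ht.le (by linarith)
  have hmt := minimalityCondition_mix (hDf _ hf₀) (hDg _ hg₀) (hDf _ hf) (hDg _ hg)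
    ht.le (by linarith) (hDf _ hft) (hDg _ hgt) hmin
  set ft := (1 - t) • f₀ + t • f with hft'
  set gt := (1 - t) • g₀ + t • g with hgt'
  set h := specChar γ a ft gt with hh
  have hmem := specChar_mem_obsSpace (hDf _ hft) (hDg _ hgt) hmt a
  have hmem₀ : h ∈ obsSpace γ N (obsDensity γ f₀ g₀) :=
    obsSpace_subset ENNReal.ofReal_ne_top (normSq_le_mix_left (hDf _ hf) (hDg _ hg)
      ht.le (by linarith)) hmem
  have hle : mse γ a h ft gt ≤ minMse γ a f₀ g₀ := by
    rw [hh, mse_specChar (hDf _ hft) (hDg _ hgt) hmt, minMse_eq (hDf _ hf₀) (hDg _ hg₀) hmin]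
    exact ENNReal.ofReal_le_ofReal (hmax _ hft _ hgt hmt)
  set M := minMse γ a f₀ g₀ with hM
  have hMe : M = ENNReal.ofReal (errorValue γ a f₀ g₀) :=
    minMse_eq (hDf _ hf₀) (hDg _ hg₀) hmin a
  have hMfin : M ≠ ∞ := by rw [hMe]; exact ENNReal.ofReal_ne_top
  set κ := ENNReal.ofReal (1 / (2 * Real.pi)) with hκ
  have hκ0 : κ ≠ 0 := by
    have := Real.pi_pos
    rw [hκ, Ne, ENNReal.ofReal_eq_zero, not_le]
    positivity
  have hκt : κ ≠ ∞ := ENNReal.ofReal_ne_top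
  set n := normSq (obsDensity γ f₀ g₀) (h - specChar γ a f₀ g₀) with hn
  rw [hft', hgt', mse_mix (hDf _ hf₀) (hDg _ hg₀) (hDf _ hf) (hDg _ hg) ht.le (by linarith) a
    hmem.1, mse_eq (hDf _ hf₀) (hDg _ hg₀) hmin a hmem₀, ← hMe] at hle
  have hsum : ENNReal.ofReal (1 - t) * M + ENNReal.ofReal t * M = M := by
    rw [← add_mul, ← ENNReal.ofReal_add hs.le ht.le, sub_add_cancel, ENNReal.ofReal_one, one_mul]
  -- after cancelling the value at `(f₀, g₀)`, both terms are bounded by `t M`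
  have hcan : ENNReal.ofReal (1 - t) * (κ * n) + ENNReal.ofReal t * mse γ a h f g ≤
      ENNReal.ofReal t * M := by
    have h1 : ENNReal.ofReal (1 - t) * M +
        (ENNReal.ofReal (1 - t) * (κ * n) + ENNReal.ofReal t * mse γ a h f g) ≤
        ENNReal.ofReal (1 - t) * M + ENNReal.ofReal t * M := by
      rw [hsum, ← add_assoc, ← mul_add]
      exact hle
    exact (ENNReal.add_le_add_iff_left (ENNReal.mul_ne_top ENNReal.ofReal_ne_top hMfin)).1 h1
  refine ⟨h, hmem.1, ?_, ?_⟩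
  · exact (ENNReal.mul_le_mul_iff_right (by simpa using ht) ENNReal.ofReal_ne_top).1
      (le_add_self.trans hcan)
  · have h1 : ENNReal.ofReal (1 - t) * (κ * n) ≤ ENNReal.ofReal t * M := le_self_add.trans hcan
    have h2 : (2 : ℝ≥0∞)⁻¹ ≤ ENNReal.ofReal (1 - t) := by
      have : (2 : ℝ≥0∞)⁻¹ = ENNReal.ofReal 2⁻¹ := by
        rw [ENNReal.ofReal_inv_of_pos (by norm_num)]; norm_num
      rw [this]
      exact ENNReal.ofReal_le_ofReal (by linarith)
    have h3 : (2 : ℝ≥0∞)⁻¹ * (κ * n) ≤ ENNReal.ofReal t * M := (by gcongr : _ ≤ _).trans h1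
    calc n = 2 * κ⁻¹ * (2⁻¹ * (κ * n)) := by
          rw [mul_mul_mul_comm, ENNReal.mul_inv_cancel (by norm_num) (by norm_num), one_mul,
            ← mul_assoc, ENNReal.inv_mul_cancel hκ0 hκt, one_mul]
      _ ≤ 2 * κ⁻¹ * (ENNReal.ofReal t * M) := by gcongr
      _ = _ := by ring

/-- Saddle point inequality: the optimal characteristic for `(f₀, g₀)` has its largest error there.
The characteristics optimal for mixtures with weights `2⁻ⁿ⁻¹` converge to it almost everywhere, and
Fatou's lemma passes the bound to the limit. -/
lemma mse_specChar_le (hcf : Convex ℝ Df) (hcg : Convex ℝ Dg) (hf : f ∈ Df) (hg : g ∈ Dg) :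
    mse γ a (specChar γ a f₀ g₀) f g ≤ minMse γ a f₀ g₀ := by
  have hp := isMinimalWeight_obsDensity (hDf _ hf₀) (hDg _ hg₀) hmin
  set M := minMse γ a f₀ g₀ with hM
  have hMfin : M ≠ ∞ := by
    rw [hM, minMse_eq (hDf _ hf₀) (hDg _ hg₀) hmin]; exact ENNReal.ofReal_ne_top
  have hex : ∀ n : ℕ, ∃ h, VecMeasurable h ∧ mse γ a h f g ≤ M ∧
      normSq (obsDensity γ f₀ g₀) (h - specChar γ a f₀ g₀) ≤ ENNReal.ofReal ((2⁻¹ : ℝ) ^ (n + 1)) *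
        (2 * (ENNReal.ofReal (1 / (2 * Real.pi)))⁻¹ * M) := fun n =>
    mse_specChar_mix_le hDf hDg hf₀ hg₀ hmin hmax hcf hcg hf hg (by positivity) (by
      rw [pow_succ]
      exact mul_le_of_le_one_left (by norm_num) (pow_le_one₀ (by norm_num) (by norm_num)))
  choose h hhm hhle hhn using hex
  set h₀ := specChar γ a f₀ g₀ with hh₀
  have hh₀m : VecMeasurable h₀ := (specChar_mem_obsSpace (hDf _ hf₀) (hDg _ hg₀) hmin a).1
  have hsum : ∑' n, normSq (obsDensity γ f₀ g₀) (h n - h₀) ≠ ∞ := by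
    refine ne_top_of_le_ne_top ?_ (ENNReal.tsum_le_tsum hhn)
    rw [ENNReal.tsum_mul_right]
    refine ENNReal.mul_ne_top ?_ (ENNReal.mul_ne_top (ENNReal.mul_ne_top (by norm_num) ?_) hMfin)
    · have hsm : Summable fun n : ℕ => (2⁻¹ : ℝ) ^ (n + 1) :=
        (summable_nat_add_iff 1).2 (summable_geometric_of_lt_one (by norm_num) (by norm_num))
      exact hsm.tsum_ofReal_ne_top
    · have := Real.pi_pos
      rw [ENNReal.inv_ne_top, Ne, ENNReal.ofReal_eq_zero, not_le]
      positivity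
  have hmeas : ∀ n, AEMeasurable (fun x =>
      ENNReal.ofReal (quad (obsDensity γ f₀ g₀ x) ((h n - h₀) x))) circ := fun n =>
    (aestronglyMeasurable_quad hp.meas ((hhm n).sub hh₀m)).aemeasurable.ennreal_ofReal
  have hae : ∀ᵐ x ∂circ,
      ∑' n, ENNReal.ofReal (quad (obsDensity γ f₀ g₀ x) ((h n - h₀) x)) < ∞ := by
    refine ae_lt_top' (AEMeasurable.tsum hmeas) ?_
    rw [lintegral_tsum hmeas]
    exact hsum
  have hconv : ∀ᵐ x ∂circ, Filter.Tendsto (fun n => h n x) Filter.atTop (nhds (h₀ x)) := by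
    filter_upwards [hae, hp.psd, hp.isUnit_det] with x h1 h2 h3
    have h4 := ENNReal.tendsto_atTop_zero_of_tsum_ne_top h1.ne
    have h5 : Filter.Tendsto (fun n => quad (obsDensity γ f₀ g₀ x) ((h n - h₀) x))
        Filter.atTop (nhds 0) := by
      have h6 := (ENNReal.tendsto_toReal ENNReal.zero_ne_top).comp h4
      rw [ENNReal.toReal_zero] at h6
      refine h6.congr fun n => ?_
      exact ENNReal.toReal_ofReal (quad_nonneg h2 _)
    have h7 := (tendsto_zero_of_quad_tendsto_zero h2 h3 h5).add_const (h₀ x)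
    simpa using h7
  have hcont : ∀ᵐ x ∂circ, ENNReal.ofReal (quad (f x) (errFun γ a h₀ x) +
      quad (g x) (γ.beta x • errFun γ a h₀ x - Afun a x)) =
      Filter.liminf (fun n => ENNReal.ofReal (quad (f x) (errFun γ a (h n) x) +
        quad (g x) (γ.beta x • errFun γ a (h n) x - Afun a x))) Filter.atTop := by
    filter_upwards [hconv] with x hx
    have hc : Continuous fun u : Fin T → ℂ => ENNReal.ofReal
        (quad (f x) ((γ.chi x / γ.beta x) • Bfun γ a x - u) +
        quad (g x) (γ.beta x • ((γ.chi x / γ.beta x) • Bfun γ a x - u) - Afun a x)) := by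
      refine ENNReal.continuous_ofReal.comp (((continuous_quad (f x)).comp ?_).add
        ((continuous_quad (g x)).comp ?_)) <;> fun_prop
    exact ((hc.tendsto (h₀ x)).comp hx).liminf_eq.symm
  unfold mse
  rw [lintegral_congr_ae hcont]
  set κ := ENNReal.ofReal (1 / (2 * Real.pi)) with hκ
  have hκ0 : κ ≠ 0 := by
    have := Real.pi_pos
    rw [hκ, Ne, ENNReal.ofReal_eq_zero, not_le]
    positivity
  have hF := lintegral_liminf_le' (μ := circ) (u := Filter.atTop) fun n =>
    aemeasurable_error_density (γ := γ) (hDf _ hf).isWeight (hDg _ hg).isWeight a (hhm n)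
  refine (mul_le_mul_right hF κ).trans ?_
  have hbound : ∀ n, ∫⁻ x, ENNReal.ofReal (quad (f x) (errFun γ a (h n) x) +
        quad (g x) (γ.beta x • errFun γ a (h n) x - Afun a x)) ∂circ ≤ κ⁻¹ * M := by
    intro n
    rw [mul_comm, ← div_eq_mul_inv, ENNReal.le_div_iff_mul_le (Or.inl hκ0)
      (Or.inl ENNReal.ofReal_ne_top), mul_comm]
    exact hhle n
  calc κ * Filter.liminf _ Filter.atTop ≤ κ * (κ⁻¹ * M) := by
        gcongr
        exact (Filter.liminf_le_liminf (.of_forall hbound)).trans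
          (Filter.liminf_const _).le
    _ = M := by
        rw [← mul_assoc, ENNReal.mul_inv_cancel hκ0 ENNReal.ofReal_ne_top, one_mul]

lemma isMinimax (hcf : Convex ℝ Df) (hcg : Convex ℝ Dg)
    (hHD : specChar γ a f₀ g₀ ∈ HD γ N Df Dg) :
    IsMinimax γ a Df Dg (specChar γ a f₀ g₀) := by
  have hopt := isOptimal_specChar (hDf _ hf₀) (hDg _ hg₀) hmin a
  have hworst : worstMse γ a Df Dg (specChar γ a f₀ g₀) = minMse γ a f₀ g₀ := by
    refine le_antisymm (iSup₂_le fun f hf => iSup₂_le fun g hg =>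
      mse_specChar_le hDf hDg hf₀ hg₀ hmin hmax hcf hcg hf hg) ?_
    rw [← hopt.2]
    exact le_iSup₂_of_le f₀ hf₀ (le_iSup₂_of_le g₀ hg₀ le_rfl)
  refine ⟨hHD, ⟨f₀, hf₀, g₀, hg₀, hopt.2.trans hworst.symm⟩, fun h hh => ?_⟩
  rw [hworst]
  exact (iInf₂_le h (hh f₀ hf₀ g₀ hg₀)).trans
    (le_iSup₂_of_le f₀ hf₀ (le_iSup₂_of_le g₀ hg₀ le_rfl))

end Minimax

/-! ### Inversion of the increment operator -/

namespace Pattern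

variable (γ : Pattern)

lemma one_sub_X_pow_mul_mk {q : ℕ} (hq : 0 < q) :
    (1 - PowerSeries.X ^ q : PowerSeries ℂ) *
      PowerSeries.mk (fun m : ℕ => if q ∣ m then (1 : ℂ) else 0) = 1 := by
  ext r
  rw [sub_mul, one_mul, map_sub, PowerSeries.coeff_X_pow_mul', PowerSeries.coeff_one,
    PowerSeries.coeff_mk]
  by_cases h : q ≤ r
  · have h1 : q ∣ r - q ↔ q ∣ r := by
      rw [Nat.dvd_sub_iff_left h dvd_rfl]
    have h2 : r ≠ 0 := by omega
    simp [h, h1, h2, PowerSeries.coeff_mk]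
  · by_cases h0 : r = 0
    · simp [h0, hq.ne']
    · have : ¬ q ∣ r := fun hd => h (Nat.le_of_dvd (Nat.pos_of_ne_zero h0) hd)
      simp [h, this, h0]

/-- The sequences `e_γ` and `d_μ` are inverse to each other under convolution. -/
lemma sum_antidiagonal_e_mul_dcoef (r : ℕ) :
    ∑ ij ∈ Finset.HasAntidiagonal.antidiagonal r, γ.e ij.1 * γ.dcoef ij.2 = if r = 0 then 1 else 0 := by
  have h : (γ.incPoly : PowerSeries ℂ) * ∏ j, (PowerSeries.mk fun m : ℕ =>
      if γ.μ j * γ.s j ∣ m then (1 : ℂ) else 0) ^ γ.d j = 1 := by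
    have h1 : (γ.incPoly : PowerSeries ℂ) =
        ∏ j, (1 - PowerSeries.X ^ (γ.μ j * γ.s j) : PowerSeries ℂ) ^ γ.d j := by
      rw [incPoly, ← Polynomial.coeToPowerSeries.ringHom_apply, map_prod]
      simp
    rw [h1, ← Finset.prod_mul_distrib]
    refine Finset.prod_eq_one fun j _ => ?_
    rw [← mul_pow, one_sub_X_pow_mul_mk (Nat.mul_pos (γ.μ_pos j) (γ.s_pos j)), one_pow]
  have h2 := congrArg (PowerSeries.coeff r) h
  rw [PowerSeries.coeff_mul, PowerSeries.coeff_one] at h2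
  rw [← h2]
  simp [e, dcoef, Polynomial.coeff_coe]

lemma sum_e_mul_dcoef {N j m : ℕ} (hm : m ≤ N) :
    ∑ l ∈ Finset.range (N + 1), (if j ≤ l then γ.e (l - j) else 0) *
      (if l ≤ m then γ.dcoef (m - l) else 0) = if j = m then 1 else 0 := by
  have h1 : ∑ l ∈ Finset.range (N + 1), (if j ≤ l then γ.e (l - j) else 0) *
      (if l ≤ m then γ.dcoef (m - l) else 0) =
      ∑ l ∈ Finset.Ico j (m + 1), γ.e (l - j) * γ.dcoef (m - l) := by
    symm
    refine Finset.sum_subset_zero_on_sdiff (fun l hl => ?_) (fun l hl => ?_) (fun l hl => ?_)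
    · rw [Finset.mem_Ico] at hl
      rw [Finset.mem_range]; omega
    · rw [Finset.mem_sdiff, Finset.mem_Ico, not_and_or] at hl
      rcases hl.2 with h | h
      · rw [if_neg h, zero_mul]
      · rw [if_neg (c := l ≤ m) (by omega), mul_zero]
    · rw [Finset.mem_Ico] at hl
      rw [if_pos hl.1, if_pos (by omega)]
  rw [h1]
  rcases le_or_gt j m with hjm | hjm
  · have h2 := γ.sum_antidiagonal_e_mul_dcoef (m - j)
    rw [Finset.Nat.sum_antidiagonal_eq_sum_range_succ (fun i k => γ.e i * γ.dcoef k)] at h2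
    rw [Finset.sum_Ico_eq_sum_range, show m + 1 - j = (m - j).succ by omega]
    have h3 : (m - j = 0) ↔ j = m := by omega
    simp only [h3] at h2
    rw [← h2]
    refine Finset.sum_congr rfl fun k _ => ?_
    rw [Nat.add_sub_cancel_left, Nat.sub_add_eq]
  · rw [Finset.Ico_eq_empty (by omega), Finset.sum_empty, if_neg (by omega)]

end Pattern

/-- An increment splits into a part with nonnegative and a part with negative times. -/
lemma sum_e_mul_split (γ : Pattern) (Y : ℤ → ℂ) (l : ℕ) :
    ∑ k ∈ Finset.range (γ.n + 1), γ.e k * Y (l - k) =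
      ∑ j ∈ Finset.range (l + 1), γ.e (l - j) * Y j +
        ∑ k ∈ Finset.Icc 1 γ.n, γ.e (l + k) * Y (-k) := by
  have h1 : ∑ k ∈ Finset.range (γ.n + 1), γ.e k * Y (l - k) =
      ∑ k ∈ Finset.range (l + 1 + γ.n), γ.e k * Y (l - k) := by
    refine Finset.sum_subset (Finset.range_mono (by omega)) fun k _ hk => ?_
    rw [Finset.mem_range] at hk
    rw [γ.e_eq_zero (by omega), zero_mul]
  rw [h1, Finset.sum_range_add]
  congr 1
  · rw [← Finset.sum_range_reflect]
    refine Finset.sum_congr rfl fun j hj => ?_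
    rw [Finset.mem_range] at hj
    have : l + 1 - 1 - j = l - j := by omega
    rw [this, Nat.cast_sub (by omega), sub_sub_cancel]
  · rw [← Finset.Ico_add_one_right_eq_Icc, Finset.sum_Ico_eq_sum_range, Nat.add_sub_cancel]
    refine Finset.sum_congr rfl fun k _ => ?_
    rw [add_assoc]
    congr 2
    push_cast
    ring

lemma sum_bvec_mul_incr (γ : Pattern) {N : ℕ} (a : Fin (N + 1) → Fin T → ℂ) (p : Fin T)
    (Y : ℤ → ℂ) :
    ∑ l ∈ Finset.range (N + 1), bvec γ a l p *
      ∑ k ∈ Finset.range (γ.n + 1), γ.e k * Y (l - k) =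
    ∑ m : Fin (N + 1), a m p * Y ((m : ℕ) : ℤ) +
      ∑ k ∈ Finset.Icc 1 γ.n,
        (∑ l ∈ Finset.range (N + 1), γ.e (l + k) * bvec γ a l p) * Y (-(k : ℤ)) := by
  simp only [sum_e_mul_split, mul_add, Finset.sum_add_distrib]
  congr 1
  · have h1 : ∀ l ∈ Finset.range (N + 1), bvec γ a l p *
        ∑ j ∈ Finset.range (l + 1), γ.e (l - j) * Y j =
        ∑ j ∈ Finset.range (N + 1), ∑ m : Fin (N + 1), a m p * Y j *
          ((if j ≤ l then γ.e (l - j) else 0) *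
            (if l ≤ (m : ℕ) then γ.dcoef (m - l) else 0)) := by
      intro l hl
      rw [Finset.mem_range] at hl
      have h2 : ∑ j ∈ Finset.range (l + 1), γ.e (l - j) * Y j =
          ∑ j ∈ Finset.range (N + 1), (if j ≤ l then γ.e (l - j) else 0) * Y j := by
        refine Finset.sum_subset_zero_on_sdiff (Finset.range_mono (by omega)) (fun j hj => ?_)
          (fun j hj => ?_)
        · rw [Finset.mem_sdiff, Finset.mem_range, Finset.mem_range] at hj
          rw [if_neg (by omega), zero_mul]
        · rw [Finset.mem_range] at hj
          rw [if_pos (by omega)]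
      rw [h2, Finset.mul_sum]
      refine Finset.sum_congr rfl fun j _ => ?_
      rw [bvec, Finset.sum_mul]
      refine Finset.sum_congr rfl fun m _ => ?_
      split_ifs <;> ring
    rw [Finset.sum_congr rfl h1, Finset.sum_comm]
    have h3 : ∀ j, ∑ l ∈ Finset.range (N + 1), ∑ m : Fin (N + 1), a m p * Y (j : ℕ) *
          ((if j ≤ l then γ.e (l - j) else 0) *
            (if l ≤ (m : ℕ) then γ.dcoef (m - l) else 0)) =
        ∑ m : Fin (N + 1), a m p * Y (j : ℕ) * if j = (m : ℕ) then 1 else 0 := by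
      intro j
      rw [Finset.sum_comm]
      refine Finset.sum_congr rfl fun m _ => ?_
      rw [← Finset.mul_sum, γ.sum_e_mul_dcoef (Nat.lt_succ_iff.1 m.2)]
    simp only [h3]
    rw [Finset.sum_comm]
    refine Finset.sum_congr rfl fun m _ => ?_
    simp [show ¬ N < (m : ℕ) by omega]
  · simp only [Finset.mul_sum, Finset.sum_mul]
    rw [Finset.sum_comm]
    refine Finset.sum_congr rfl fun k _ => Finset.sum_congr rfl fun l _ => ?_
    ring

section Stochastic

variable {Ω : Type*}

/-- The functional of the increments, `∑ₖ b(k)ᵀ χy(k)`. -/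
noncomputable def functionalB (γ : Pattern) {N : ℕ} (a : Fin (N + 1) → Fin T → ℂ)
    (y : ℤ → Fin T → Ω → ℂ) : Ω → ℂ :=
  fun ω => ∑ k ∈ Finset.range (N + 1), ∑ p, bvec γ a k p * incr γ y k p ω

lemma functionalA_eq (γ : Pattern) {N : ℕ} (a : Fin (N + 1) → Fin T → ℂ)
    (y : ℤ → Fin T → Ω → ℂ) (ω : Ω) :
    functionalA a y ω = functionalB γ a y ω - functionalV γ a y ω := by
  rw [eq_sub_iff_add_eq, functionalA, functionalB, functionalV, Finset.sum_comm]
  rw [Finset.sum_comm (s := Finset.Icc 1 γ.n), Finset.sum_comm (s := Finset.range (N + 1)),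
    ← Finset.sum_add_distrib]
  refine Finset.sum_congr rfl fun p _ => ?_
  exact (sum_bvec_mul_incr γ a p fun m => y m p ω).symm

lemma incr_add (γ : Pattern) (y z : ℤ → Fin T → Ω → ℂ) (m : ℤ) (p : Fin T) :
    incr γ (y + z) m p = incr γ y m p + incr γ z m p := by
  ext ω
  simp [incr, mul_add, Finset.sum_add_distrib]

lemma functionalA_add {N : ℕ} (a : Fin (N + 1) → Fin T → ℂ) (y z : ℤ → Fin T → Ω → ℂ) (ω : Ω) :
    functionalA a (y + z) ω = functionalA a y ω + functionalA a z ω := by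
  simp [functionalA, mul_add, Finset.sum_add_distrib]

/-! ### The spectral isometry -/

/-- Pairs of random variables and their spectral representations: the span of the triples
`(χξ_p(k), e^{ixk} (χ/β) δ_p, 0)` and `(η_p(k), 0, e^{ixk} δ_p)`. -/
noncomputable def spectralSpan (γ : Pattern) (ξ η : ℤ → Fin T → Ω → ℂ) :
    Submodule ℂ ((Ω → ℂ) × VecFun T × VecFun T) :=
  Submodule.span ℂ
    (Set.range (fun kp : ℤ × Fin T =>
      (incr γ ξ kp.1 kp.2, (fun x => (γ.chi x / γ.beta x) • expVec kp.1 kp.2 x), 0)) ∪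
    Set.range (fun kp : ℤ × Fin T => (η kp.1 kp.2, 0, expVec kp.1 kp.2)))

lemma form_expVec (M : Matrix (Fin T) (Fin T) ℂ) (k m : ℤ) (p q : Fin T) (x : ℝ) :
    form M (expVec k p x) (expVec m q x) =
      Complex.exp (Complex.I * x * ((k : ℂ) - (m : ℂ))) * M p q := by
  rw [expVec, expVec, form_smul_left, form_smul_right, form_single, star_exp_I_mul x m (by simp),
    ← mul_assoc, ← Complex.exp_add]
  congr 2
  ring

variable {γ : Pattern} {ξ η : ℤ → Fin T → Ω → ℂ}

lemma incr_noise_mem_spectralSpan (k : ℤ) (p : Fin T) :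
    (incr γ η k p, 0, (fun x => γ.chi x • expVec k p x)) ∈ spectralSpan γ ξ η := by
  have h : (incr γ η k p, (0 : VecFun T), (fun x => γ.chi x • expVec k p x : VecFun T)) =
      ∑ j ∈ Finset.range (γ.n + 1), γ.e j • (η (k - j) p, (0 : VecFun T), expVec (k - j) p) := by
    refine Prod.ext ?_ (Prod.ext ?_ ?_)
    · rw [Prod.fst_sum]
      ext ω
      simp [incr]
    · rw [Prod.snd_sum, Prod.fst_sum]
      simp
    · rw [Prod.snd_sum, Prod.snd_sum]
      ext x l
      simp only [γ.chi_eq_sum, Finset.sum_apply, Pi.smul_apply, smul_eq_mul, expVec,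
        Finset.sum_mul, Prod.smul_snd]
      refine Finset.sum_congr rfl fun j _ => ?_
      rw [← mul_assoc, ← mul_assoc, mul_assoc (γ.e j), ← Complex.exp_add]
      congr 3
      push_cast
      ring
  rw [h]
  exact Submodule.sum_mem _ fun j _ => Submodule.smul_mem _ _
    (Submodule.subset_span (Or.inr ⟨(k - j, p), rfl⟩))

lemma incr_add_mem_spectralSpan (k : ℤ) (p : Fin T) :
    (incr γ (ξ + η) k p, (fun x => (γ.chi x / γ.beta x) • expVec k p x),
      (fun x => γ.chi x • expVec k p x)) ∈ spectralSpan γ ξ η := by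
  have h1 : (incr γ ξ k p, (fun x => (γ.chi x / γ.beta x) • expVec k p x), 0) ∈
      spectralSpan γ ξ η := Submodule.subset_span (Or.inl ⟨(k, p), rfl⟩)
  have h2 := Submodule.add_mem _ h1 (incr_noise_mem_spectralSpan (γ := γ) (ξ := ξ) (η := η) k p)
  rw [Prod.mk_add_mk, Prod.mk_add_mk, add_zero, zero_add, ← incr_add] at h2
  exact h2

lemma sum_smul_expVec {ι : Type*} (s : Finset ι) (k : ι → ℤ) (c : ι → Fin T → ℂ) (x : ℝ)
    (l : Fin T) : ∑ i ∈ s, ∑ p, c i p * expVec (k i) p x l =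
      ∑ i ∈ s, c i l * Complex.exp (Complex.I * x * k i) := by
  refine Finset.sum_congr rfl fun i _ => ?_
  rw [Finset.sum_eq_single l]
  · simp [expVec]
  · intro p _ hp
    simp [expVec, hp.symm]
  · simp

/-- Finite combinations of observed increments and their spectral representations. -/
lemma sum_incr_mem_spectralSpan {ι : Type*} (s : Finset ι) (k : ι → ℤ) (c : ι → Fin T → ℂ)
    (w : VecFun T)
    (hw : ∀ x l, w x l = ∑ i ∈ s, c i l * Complex.exp (Complex.I * x * k i)) :
    ((fun ω => ∑ i ∈ s, ∑ p, c i p * incr γ (ξ + η) (k i) p ω),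
      (fun x => (γ.chi x / γ.beta x) • w x), (fun x => γ.chi x • w x)) ∈ spectralSpan γ ξ η := by
  have h : ((fun ω => ∑ i ∈ s, ∑ p, c i p * incr γ (ξ + η) (k i) p ω),
      (fun x => (γ.chi x / γ.beta x) • w x : VecFun T), (fun x => γ.chi x • w x : VecFun T)) =
      ∑ i ∈ s, ∑ p, c i p • (incr γ (ξ + η) (k i) p,
        (fun x => (γ.chi x / γ.beta x) • expVec (k i) p x : VecFun T),
        (fun x => γ.chi x • expVec (k i) p x : VecFun T)) := by
    refine Prod.ext ?_ (Prod.ext ?_ ?_)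
    · ext ω
      simp [Prod.fst_sum]
    · ext x l
      simp only [Prod.fst_sum, Prod.snd_sum, Finset.sum_apply, Pi.smul_apply, smul_eq_mul,
        Prod.smul_snd, Prod.smul_fst, hw, ← sum_smul_expVec, Finset.mul_sum]
      exact Finset.sum_congr rfl fun i _ => Finset.sum_congr rfl fun p _ => by ring
    · ext x l
      simp only [Prod.snd_sum, Finset.sum_apply, Pi.smul_apply, smul_eq_mul,
        Prod.smul_snd, hw, ← sum_smul_expVec, Finset.mul_sum]
      exact Finset.sum_congr rfl fun i _ => Finset.sum_congr rfl fun p _ => by ring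
  rw [h]
  exact Submodule.sum_mem _ fun i _ => Submodule.sum_mem _ fun p _ =>
    Submodule.smul_mem _ _ (incr_add_mem_spectralSpan (k i) p)

lemma functionalA_noise_mem_spectralSpan {N : ℕ} (a : Fin (N + 1) → Fin T → ℂ) :
    (functionalA a η, 0, Afun a) ∈ spectralSpan γ ξ η := by
  have h : (functionalA a η, (0 : VecFun T), Afun a) =
      ∑ k : Fin (N + 1), ∑ p, a k p • (η ((k : ℕ) : ℤ) p, (0 : VecFun T),
        expVec ((k : ℕ) : ℤ) p) := by
    refine Prod.ext ?_ (Prod.ext ?_ ?_)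
    · ext ω
      simp [Prod.fst_sum, functionalA]
    · simp [Prod.fst_sum, Prod.snd_sum]
    · ext x l
      have := sum_smul_expVec Finset.univ (fun k : Fin (N + 1) => ((k : ℕ) : ℤ)) a x l
      simp only [Prod.snd_sum, Finset.sum_apply, Pi.smul_apply, smul_eq_mul, Prod.smul_snd, this]
      simp [Afun]
  rw [h]
  exact Submodule.sum_mem _ fun k _ => Submodule.sum_mem _ fun p _ =>
    Submodule.smul_mem _ _ (Submodule.subset_span (Or.inr ⟨(((k : ℕ) : ℤ), p), rfl⟩))

/-- A finite combination of increments of the observed sequence. -/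
noncomputable def incrSum (γ : Pattern) (ζ : ℤ → Fin T → Ω → ℂ) (c : ℤ →₀ (Fin T → ℂ)) : Ω → ℂ :=
  fun ω => ∑ k ∈ c.support, ∑ p, c k p * incr γ ζ k p ω

lemma incrSum_mem_spectralSpan (c : ℤ →₀ (Fin T → ℂ)) :
    (incrSum γ (ξ + η) c, trig γ c, (fun x => γ.chi x • trigPoly c x)) ∈ spectralSpan γ ξ η := by
  have h := sum_incr_mem_spectralSpan (γ := γ) (ξ := ξ) (η := η) c.support (fun k => k) c
    (trigPoly c) (fun x l => rfl)
  have e : (fun x => (γ.chi x / γ.beta x) • trigPoly c x) = trig γ c :=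
    funext fun x => (trig_apply γ c x).symm
  rw [e] at h
  exact h

lemma functionalB_mem_spectralSpan {N : ℕ} (a : Fin (N + 1) → Fin T → ℂ) :
    (functionalB γ a (ξ + η), (fun x => (γ.chi x / γ.beta x) • Bfun γ a x),
      (fun x => γ.chi x • Bfun γ a x)) ∈ spectralSpan γ ξ η := by
  refine sum_incr_mem_spectralSpan (Finset.range (N + 1)) (fun k => (k : ℤ)) (bvec γ a)
    (Bfun γ a) fun x l => ?_
  rw [← Fin.sum_univ_eq_sum_range
    (fun k => bvec γ a k l * Complex.exp (Complex.I * x * ((k : ℤ) : ℂ)))]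
  simp [Bfun]

variable [MeasurableSpace Ω] {P : Measure Ω} {f g : MatFun T}

lemma spectralSpan_memLp (hf : IsSignalDensity γ f) (hg : IsNoiseDensity g)
    (hM : IsModel γ P ξ η f g) {z : (Ω → ℂ) × VecFun T × VecFun T}
    (hz : z ∈ spectralSpan γ ξ η) : MemLp z.1 2 P ∧ MemL2 f z.2.1 ∧ MemL2 g z.2.2 := by
  refine Submodule.span_induction ?_ ?_ ?_ ?_ hz
  · rintro _ (⟨⟨k, p⟩, rfl⟩ | ⟨⟨k, p⟩, rfl⟩)
    · exact ⟨hM.incr_memLp k p, memL2_chi_div_beta_smul hf.isWeight hf.integrable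
        (continuous_expVec k p), .zero g⟩
    · exact ⟨hM.noise_memLp k p, .zero f, hg.isWeight.memL2_of_continuous hg.integrable
        (continuous_expVec k p)⟩
  · exact ⟨MemLp.zero, .zero f, .zero g⟩
  · rintro z w - - ⟨h1, h2, h3⟩ ⟨h1', h2', h3'⟩
    exact ⟨h1.add h1', h2.add hf.isWeight h2', h3.add hg.isWeight h3'⟩
  · rintro c z - ⟨h1, h2, h3⟩
    exact ⟨h1.const_smul c, h2.const_smul c, h3.const_smul c⟩

/-- The covariance of two random variables is the inner product of their spectral
representations. -/
lemma spectralSpan_cov (hf : IsSignalDensity γ f) (hg : IsNoiseDensity g)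
    (hM : IsModel γ P ξ η f g) {z w : (Ω → ℂ) × VecFun T × VecFun T}
    (hz : z ∈ spectralSpan γ ξ η) (hw : w ∈ spectralSpan γ ξ η) :
    ∫ ω, z.1 ω * star (w.1 ω) ∂P = (1 / (2 * Real.pi) : ℂ) *
      (∫ x, form (f x) (z.2.1 x) (w.2.1 x) ∂circ + ∫ x, form (g x) (z.2.2 x) (w.2.2 x) ∂circ) := by
  have hmem := fun z (hz : z ∈ spectralSpan γ ξ η) => spectralSpan_memLp hf hg hM hz
  have i1 : ∀ z ∈ spectralSpan γ ξ η, ∀ w ∈ spectralSpan γ ξ η,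
      Integrable (fun ω => z.1 ω * star (w.1 ω)) P := fun z hz w hw =>
    (hmem z hz).1.integrable_mul (hmem w hw).1.star
  have i2 : ∀ z ∈ spectralSpan γ ξ η, ∀ w ∈ spectralSpan γ ξ η,
      Integrable (fun x => form (f x) (z.2.1 x) (w.2.1 x)) circ := fun z hz w hw =>
    hf.isWeight.integrable_form (hmem z hz).2.1 (hmem w hw).2.1
  have i3 : ∀ z ∈ spectralSpan γ ξ η, ∀ w ∈ spectralSpan γ ξ η,
      Integrable (fun x => form (g x) (z.2.2 x) (w.2.2 x)) circ := fun z hz w hw =>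
    hg.isWeight.integrable_form (hmem z hz).2.2 (hmem w hw).2.2
  have z1 : ∀ (M : Matrix (Fin T) (Fin T) ℂ) u, form M u 0 = 0 := fun M u => by
    simp [form]
  have z2 : ∀ (M : Matrix (Fin T) (Fin T) ℂ) u, form M 0 u = 0 := fun M u => by
    simp [form]
  refine Submodule.span_induction₂ (p := fun z w _ _ => ∫ ω, z.1 ω * star (w.1 ω) ∂P =
    (1 / (2 * Real.pi) : ℂ) * (∫ x, form (f x) (z.2.1 x) (w.2.1 x) ∂circ +
      ∫ x, form (g x) (z.2.2 x) (w.2.2 x) ∂circ)) ?_ ?_ ?_ ?_ ?_ ?_ ?_ hz hw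
  · rintro _ _ (⟨⟨k, p⟩, rfl⟩ | ⟨⟨k, p⟩, rfl⟩) (⟨⟨m, q⟩, rfl⟩ | ⟨⟨m, q⟩, rfl⟩)
    · simp only [Pi.zero_apply, z1, integral_zero, add_zero]
      rw [hM.incr_cov]
      congr 1
      refine integral_congr_ae (.of_forall fun x => ?_)
      simp only
      rw [form_smul_left, form_smul_right, form_expVec, ← mul_assoc (γ.chi x / γ.beta x),
        Complex.star_def, Complex.mul_conj, Complex.normSq_eq_norm_sq, norm_div, div_pow]
      ring
    · simp only [Pi.zero_apply, z1, z2, integral_zero, add_zero, mul_zero]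
      exact hM.uncorrelated k m p q
    · simp only [Pi.zero_apply, z1, z2, integral_zero, add_zero, mul_zero]
      have h := congrArg star (hM.uncorrelated m k q p)
      rw [star_zero, Complex.star_def, ← integral_conj] at h
      rw [← h]
      refine integral_congr_ae (.of_forall fun ω => ?_)
      simp [mul_comm]
    · simp only [Pi.zero_apply, z1, integral_zero, zero_add]
      rw [hM.noise_cov]
      simp only [form_expVec]
  · intro w _
    simp [z2]
  · intro w _
    simp [z1]
  · intro z z' w hz hz' hw h h'
    have e : ∀ ω, (z + z').1 ω * star (w.1 ω) = z.1 ω * star (w.1 ω) + z'.1 ω * star (w.1 ω) :=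
      fun ω => add_mul _ _ _
    have e2 : ∀ x, form (f x) ((z + z').2.1 x) (w.2.1 x) =
      form (f x) (z.2.1 x) (w.2.1 x) + form (f x) (z'.2.1 x) (w.2.1 x) := fun x => form_add_left
    have e3 : ∀ x, form (g x) ((z + z').2.2 x) (w.2.2 x) =
      form (g x) (z.2.2 x) (w.2.2 x) + form (g x) (z'.2.2 x) (w.2.2 x) := fun x => form_add_left
    simp only [e, e2, e3]
    rw [integral_add (i1 z hz w hw) (i1 z' hz' w hw), integral_add (i2 z hz w hw) (i2 z' hz' w hw),
      integral_add (i3 z hz w hw) (i3 z' hz' w hw), h, h']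
    ring
  · intro w z z' hw hz hz' h h'
    have e : ∀ ω, w.1 ω * star ((z + z').1 ω) = w.1 ω * star (z.1 ω) + w.1 ω * star (z'.1 ω) :=
      fun ω => by simp [mul_add]
    have e2 : ∀ x, form (f x) (w.2.1 x) ((z + z').2.1 x) =
      form (f x) (w.2.1 x) (z.2.1 x) + form (f x) (w.2.1 x) (z'.2.1 x) := fun x => form_add_right
    have e3 : ∀ x, form (g x) (w.2.2 x) ((z + z').2.2 x) =
      form (g x) (w.2.2 x) (z.2.2 x) + form (g x) (w.2.2 x) (z'.2.2 x) := fun x => form_add_right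
    simp only [e, e2, e3]
    rw [integral_add (i1 w hw z hz) (i1 w hw z' hz'), integral_add (i2 w hw z hz) (i2 w hw z' hz'),
      integral_add (i3 w hw z hz) (i3 w hw z' hz'), h, h']
    ring
  · intro c z w hz hw h
    have e : ∀ ω, (c • z).1 ω * star (w.1 ω) = c * (z.1 ω * star (w.1 ω)) :=
      fun ω => by simp [mul_assoc]
    have e2 : ∀ x, form (f x) ((c • z).2.1 x) (w.2.1 x) =
      c * form (f x) (z.2.1 x) (w.2.1 x) := fun x => form_smul_left c
    have e3 : ∀ x, form (g x) ((c • z).2.2 x) (w.2.2 x) =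
      c * form (g x) (z.2.2 x) (w.2.2 x) := fun x => form_smul_left c
    simp only [e, e2, e3, integral_const_mul, h]
    ring
  · intro c w z hw hz h
    have e : ∀ ω, w.1 ω * star ((c • z).1 ω) = star c * (w.1 ω * star (z.1 ω)) :=
      fun ω => by simp; ring
    have e2 : ∀ x, form (f x) (w.2.1 x) ((c • z).2.1 x) =
      star c * form (f x) (w.2.1 x) (z.2.1 x) := fun x => form_smul_right c
    have e3 : ∀ x, form (g x) (w.2.2 x) ((c • z).2.2 x) =
      star c * form (g x) (w.2.2 x) (z.2.2 x) := fun x => form_smul_right c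
    simp only [e, e2, e3, integral_const_mul, h]
    ring

/-- The second moment of a random variable in terms of its spectral representation. -/
lemma spectralSpan_secondMoment (hf : IsSignalDensity γ f) (hg : IsNoiseDensity g)
    (hM : IsModel γ P ξ η f g) {z : (Ω → ℂ) × VecFun T × VecFun T}
    (hz : z ∈ spectralSpan γ ξ η) :
    ∫⁻ ω, ‖z.1 ω‖ₑ ^ 2 ∂P = ENNReal.ofReal (1 / (2 * Real.pi)) *
      ∫⁻ x, ENNReal.ofReal (quad (f x) (z.2.1 x) + quad (g x) (z.2.2 x)) ∂circ := by
  obtain ⟨m1, m2, m3⟩ := spectralSpan_memLp hf hg hM hz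
  have hcov := spectralSpan_cov hf hg hM hz hz
  have hI : Integrable (fun ω => ‖z.1 ω‖ ^ 2) P := m1.integrable_norm_pow (by norm_num)
  have e1 : ∫ ω, z.1 ω * star (z.1 ω) ∂P = ((∫ ω, ‖z.1 ω‖ ^ 2 ∂P : ℝ) : ℂ) := by
    rw [← integral_complex_ofReal]
    refine integral_congr_ae (.of_forall fun ω => ?_)
    simp only
    rw [Complex.star_def, Complex.mul_conj, Complex.normSq_eq_norm_sq]
  have e2 : ∀ {p : MatFun T} {u : VecFun T}, IsWeight p →
      ∫ x, form (p x) (u x) (u x) ∂circ = ((∫ x, quad (p x) (u x) ∂circ : ℝ) : ℂ) := by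
    intro p u hp
    rw [← integral_complex_ofReal]
    refine integral_congr_ae ?_
    filter_upwards [hp.psd] with x hx using form_self hx _
  rw [e1, e2 hf.isWeight, e2 hg.isWeight, ← Complex.ofReal_add,
    ← integral_add m2.integrable m3.integrable] at hcov
  have hr : ∫ ω, ‖z.1 ω‖ ^ 2 ∂P = 1 / (2 * Real.pi) *
      ∫ x, (quad (f x) (z.2.1 x) + quad (g x) (z.2.2 x)) ∂circ := by
    have : (1 / (2 * Real.pi) : ℂ) = ((1 / (2 * Real.pi) : ℝ) : ℂ) := by push_cast; rfl
    rw [this, ← Complex.ofReal_mul] at hcov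
    exact_mod_cast hcov
  have hfg : Integrable (fun x => quad (f x) (z.2.1 x) + quad (g x) (z.2.2 x)) circ :=
    m2.integrable.add m3.integrable
  have l1 : ∫⁻ ω, ‖z.1 ω‖ₑ ^ 2 ∂P = ∫⁻ ω, ENNReal.ofReal (‖z.1 ω‖ ^ 2) ∂P := by
    refine lintegral_congr fun ω => ?_
    rw [ENNReal.ofReal_pow (norm_nonneg _), ofReal_norm]
  rw [l1, ← ofReal_integral_eq_lintegral_ofReal hI (.of_forall fun ω => by positivity), hr,
    ENNReal.ofReal_mul (by positivity), ofReal_integral_eq_lintegral_ofReal hfg]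
  filter_upwards [hf.psd, hg.psd] with x h1 h2
    using add_nonneg (quad_nonneg h1 _) (quad_nonneg h2 _)

/-- Isometry between combinations of observed increments and their characteristics. -/
lemma secondMoment_incrSum_sub (hf : IsSignalDensity γ f) (hg : IsNoiseDensity g)
    (hM : IsModel γ P ξ η f g) (c c' : ℤ →₀ (Fin T → ℂ)) :
    ∫⁻ ω, ‖incrSum γ (ξ + η) c ω - incrSum γ (ξ + η) c' ω‖ₑ ^ 2 ∂P =
      ENNReal.ofReal (1 / (2 * Real.pi)) *
        normSq (obsDensity γ f g) (trig γ c - trig γ c') := by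
  have h := spectralSpan_secondMoment hf hg hM
    (Submodule.sub_mem _ (incrSum_mem_spectralSpan c) (incrSum_mem_spectralSpan c'))
  refine Eq.trans h ?_
  congr 1
  refine lintegral_congr_ae ?_
  filter_upwards [γ.beta_ne_zero] with x hx
  have e : ((fun x => γ.chi x • trigPoly c x) - fun x => γ.chi x • trigPoly c' x) x =
      γ.beta x • (trig γ c - trig γ c') x := by
    simp only [Pi.sub_apply, trig_apply, smul_sub, smul_smul, mul_div_cancel₀ _ hx]
  simp only [Prod.fst_sub, Prod.snd_sub]
  rw [e, quad_smul, obsDensity, quad_add_matrix, quad_smul_matrix]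

/-- For finite combinations of increments, the error of the estimate has second moment
`Δ(h; f, g)`. -/
lemma secondMoment_error (hf : IsSignalDensity γ f) (hg : IsNoiseDensity g)
    (hM : IsModel γ P ξ η f g) {N : ℕ} (a : Fin (N + 1) → Fin T → ℂ) (c : ℤ →₀ (Fin T → ℂ)) :
    ∫⁻ ω, ‖functionalB γ a (ξ + η) ω - incrSum γ (ξ + η) c ω - functionalA a η ω‖ₑ ^ 2 ∂P =
      mse γ a (trig γ c) f g := by
  have h := spectralSpan_secondMoment hf hg hM
    (Submodule.sub_mem _ (Submodule.sub_mem _ (functionalB_mem_spectralSpan a)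
      (incrSum_mem_spectralSpan c)) (functionalA_noise_mem_spectralSpan a))
  refine Eq.trans h ?_
  rw [mse]
  congr 1
  refine lintegral_congr_ae ?_
  filter_upwards [γ.beta_ne_zero] with x hx
  have e : ((fun x => γ.chi x • Bfun γ a x) - (fun x => γ.chi x • trigPoly c x) - Afun a) x =
      γ.beta x • errFun γ a (trig γ c) x - Afun a x := by
    simp only [Pi.sub_apply, errFun, trig_apply, smul_sub, smul_smul, mul_div_cancel₀ _ hx]
  simp only [Prod.fst_sub, Prod.snd_sub, sub_zero]
  rw [e]
  rfl

end Stochastic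

/-! ### Passage to the limit -/

/-- Two quantities with common approximants, up to the two-term Young inequality, are ordered. -/
lemma le_of_young {X Y κ : ℝ≥0∞} (hκ : κ ≠ ∞)
    (H : ∀ ε : ℝ≥0∞, 0 < ε → ∃ Z, ∀ t : ℝ, 0 < t →
      X ≤ ENNReal.ofReal (1 + t) * Z + ENNReal.ofReal (1 + t⁻¹) * (κ * ε) ∧
      Z ≤ ENNReal.ofReal (1 + t) * Y + ENNReal.ofReal (1 + t⁻¹) * (κ * ε)) : X ≤ Y := by
  have h1 : ∀ t : ℝ, 0 < t → X ≤ ENNReal.ofReal (1 + t) * (ENNReal.ofReal (1 + t) * Y) := by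
    intro t ht
    have hlim : Filter.Tendsto (fun ε : ℝ≥0∞ => ENNReal.ofReal (1 + t) *
        (ENNReal.ofReal (1 + t) * Y + ENNReal.ofReal (1 + t⁻¹) * (κ * ε)) +
          ENNReal.ofReal (1 + t⁻¹) * (κ * ε)) (nhds 0) (nhds (ENNReal.ofReal (1 + t) *
        (ENNReal.ofReal (1 + t) * Y + ENNReal.ofReal (1 + t⁻¹) * (κ * 0)) +
          ENNReal.ofReal (1 + t⁻¹) * (κ * 0))) := by
      have h2 : Filter.Tendsto (fun ε : ℝ≥0∞ => ENNReal.ofReal (1 + t⁻¹) * (κ * ε)) (nhds 0)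
          (nhds (ENNReal.ofReal (1 + t⁻¹) * (κ * 0))) :=
        ENNReal.Tendsto.const_mul (ENNReal.Tendsto.const_mul Filter.tendsto_id (Or.inr hκ))
          (Or.inr ENNReal.ofReal_ne_top)
      exact (ENNReal.Tendsto.const_mul (tendsto_const_nhds.add h2)
        (Or.inr ENNReal.ofReal_ne_top)).add h2
    simp only [mul_zero, add_zero] at hlim
    have hseq := hlim.comp ENNReal.tendsto_inv_nat_nhds_zero
    refine ge_of_tendsto' hseq fun n => ?_
    obtain ⟨Z, hZ⟩ := H ((n : ℝ≥0∞)⁻¹) (by simp)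
    obtain ⟨hX, hZY⟩ := hZ t ht
    refine hX.trans ?_
    simp only [Function.comp_apply]
    gcongr
  have hlim : Filter.Tendsto (fun n : ℕ => ENNReal.ofReal (1 + 1 / ((n : ℝ) + 1)) *
      (ENNReal.ofReal (1 + 1 / ((n : ℝ) + 1)) * Y)) Filter.atTop
      (nhds (ENNReal.ofReal (1 + 0) * (ENNReal.ofReal (1 + 0) * Y))) := by
    have h2 : Filter.Tendsto (fun n : ℕ => ENNReal.ofReal (1 + 1 / ((n : ℝ) + 1))) Filter.atTop
        (nhds (ENNReal.ofReal (1 + 0))) :=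
      (ENNReal.continuous_ofReal.tendsto _).comp
        (tendsto_one_div_add_atTop_nhds_zero_nat.const_add 1)
    refine ENNReal.Tendsto.mul h2 (Or.inl (by simp)) (ENNReal.Tendsto.mul_const h2
      (Or.inl (by simp))) (Or.inr (by simp))
  simp only [add_zero, ENNReal.ofReal_one, one_mul] at hlim
  exact ge_of_tendsto' hlim fun n => h1 _ (by positivity)

lemma lintegral_enorm_add_sq_le {Ω : Type*} [MeasurableSpace Ω] {P : Measure Ω} {u v : Ω → ℂ}
    (hu : AEStronglyMeasurable u P) {t : ℝ} (ht : 0 < t) :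
    ∫⁻ ω, ‖u ω + v ω‖ₑ ^ 2 ∂P ≤ ENNReal.ofReal (1 + t) * ∫⁻ ω, ‖u ω‖ₑ ^ 2 ∂P +
      ENNReal.ofReal (1 + t⁻¹) * ∫⁻ ω, ‖v ω‖ₑ ^ 2 ∂P := by
  have ht' : 0 < t⁻¹ := inv_pos.2 ht
  rw [← lintegral_const_mul' _ _ ENNReal.ofReal_ne_top,
    ← lintegral_const_mul' _ _ ENNReal.ofReal_ne_top,
    ← lintegral_add_left' ((hu.enorm.pow_const 2).const_mul _)]
  refine lintegral_mono fun ω => ?_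
  simp only [← ofReal_norm]
  rw [← ENNReal.ofReal_pow (norm_nonneg _), ← ENNReal.ofReal_pow (norm_nonneg _),
    ← ENNReal.ofReal_pow (norm_nonneg _), ← ENNReal.ofReal_mul (by positivity),
    ← ENNReal.ofReal_mul (by positivity), ← ENNReal.ofReal_add (by positivity) (by positivity)]
  refine ENNReal.ofReal_le_ofReal ?_
  have h1 : ‖u ω + v ω‖ ^ 2 ≤ (‖u ω‖ + ‖v ω‖) ^ 2 := by
    gcongr; exact norm_add_le _ _
  have h2 : 0 ≤ t⁻¹ * (t * ‖u ω‖ - ‖v ω‖) ^ 2 := by positivity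
  have h3 : t⁻¹ * (t * ‖u ω‖ - ‖v ω‖) ^ 2 =
      t * ‖u ω‖ ^ 2 - 2 * ‖u ω‖ * ‖v ω‖ + t⁻¹ * ‖v ω‖ ^ 2 := by
    field_simp
    ring
  nlinarith

lemma mse_le_of_normSq_sub {γ : Pattern} {N : ℕ} {f g : MatFun T} (hf : IsSignalDensity γ f)
    (hg : IsNoiseDensity g) (a : Fin (N + 1) → Fin T → ℂ) {h h' : VecFun T}
    (hh' : VecMeasurable h') {t : ℝ} (ht : 0 < t) :
    mse γ a h f g ≤ ENNReal.ofReal (1 + t) * mse γ a h' f g + ENNReal.ofReal (1 + t⁻¹) *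
      (ENNReal.ofReal (1 / (2 * Real.pi)) * normSq (obsDensity γ f g) (h - h')) := by
  have ht' : 0 < t⁻¹ := inv_pos.2 ht
  unfold mse normSq
  rw [mul_left_comm, mul_left_comm (ENNReal.ofReal (1 + t⁻¹)), ← mul_add,
    ← lintegral_const_mul' (ENNReal.ofReal (1 + t)) _ ENNReal.ofReal_ne_top,
    ← lintegral_const_mul' (ENNReal.ofReal (1 + t⁻¹)) _ ENNReal.ofReal_ne_top,
    ← lintegral_add_left' ((aemeasurable_error_density hf.isWeight hg.isWeight a hh').const_mul _)]
  refine mul_le_mul_right (lintegral_mono_ae ?_) _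
  filter_upwards [hf.psd, hg.psd, (isWeight_obsDensity hf hg).psd] with x h1 h2 h3
  rw [← ENNReal.ofReal_mul (by positivity), ← ENNReal.ofReal_mul (by positivity),
    ← ENNReal.ofReal_add (mul_nonneg (by positivity)
      (add_nonneg (quad_nonneg h1 _) (quad_nonneg h2 _)))
      (mul_nonneg (by positivity) (quad_nonneg h3 _))]
  refine ENNReal.ofReal_le_ofReal ?_
  have e1 : errFun γ a h x = errFun γ a h' x + (h' - h) x := by
    simp [errFun]
  have e2 : γ.beta x • errFun γ a h x - Afun a x =
      (γ.beta x • errFun γ a h' x - Afun a x) + γ.beta x • (h' - h) x := by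
    rw [e1, smul_add]; abel
  have q1 := quad_add_le h1 ht (errFun γ a h' x) ((h' - h) x)
  have q2 := quad_add_le h2 ht (γ.beta x • errFun γ a h' x - Afun a x) (γ.beta x • (h' - h) x)
  rw [quad_smul] at q2
  have q3 : quad (obsDensity γ f g x) ((h - h') x) =
      quad (f x) ((h' - h) x) + ‖γ.beta x‖ ^ 2 * quad (g x) ((h' - h) x) := by
    rw [Pi.sub_apply, quad_sub_comm, obsDensity, quad_add_matrix, quad_smul_matrix]
    rfl
  rw [q3, e2]
  rw [← e1] at q1
  linarith

section Estimate

variable {Ω : Type*} [MeasurableSpace Ω] {γ : Pattern} {P : Measure Ω}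
  {ξ η : ℤ → Fin T → Ω → ℂ} {f g : MatFun T}

lemma estimateError_eq_mse (hf : IsSignalDensity γ f) (hg : IsNoiseDensity g)
    (hM : IsModel γ P ξ η f g) {N : ℕ} (a : Fin (N + 1) → Fin T → ℂ) {h : VecFun T}
    (hh : VecMeasurable h) {H : Ω → ℂ} (hH : HasCharacteristic γ N P ξ η f g h H) :
    estimateError γ a P ξ η H = mse γ a h f g := by
  set κ := ENNReal.ofReal (1 / (2 * Real.pi)) with hκ
  set R : Ω → ℂ := fun ω => functionalB γ a (ξ + η) ω - H ω - functionalA a η ω with hR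
  set S : (ℤ →₀ (Fin T → ℂ)) → Ω → ℂ := fun c ω =>
    functionalB γ a (ξ + η) ω - incrSum γ (ξ + η) c ω - functionalA a η ω with hS
  have hE : estimateError γ a P ξ η H = ∫⁻ ω, ‖R ω‖ₑ ^ 2 ∂P := by
    refine lintegral_congr fun ω => ?_
    congr 2
    have h1 := functionalA_add a ξ η ω
    rw [functionalA_eq γ a (ξ + η)] at h1
    simp only [hR]
    linear_combination -h1
  have hBm : AEStronglyMeasurable (functionalB γ a (ξ + η)) P :=
    (spectralSpan_memLp hf hg hM (functionalB_mem_spectralSpan a)).1.1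
  have hAm : AEStronglyMeasurable (functionalA a η) P :=
    (spectralSpan_memLp hf hg hM (functionalA_noise_mem_spectralSpan (γ := γ) (ξ := ξ) a)).1.1
  have hcm : ∀ c, AEStronglyMeasurable (incrSum γ (ξ + η) c) P := fun c =>
    (spectralSpan_memLp hf hg hM (incrSum_mem_spectralSpan c)).1.1
  have hSm : ∀ c, AEStronglyMeasurable (S c) P := fun c => (hBm.sub (hcm c)).sub hAm
  have hRm : AEStronglyMeasurable R P := (hBm.sub hH.1).sub hAm
  have hSc : ∀ c, ∫⁻ ω, ‖S c ω‖ₑ ^ 2 ∂P = mse γ a (trig γ c) f g := fun c =>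
    secondMoment_error hf hg hM a c
  have hκ1 : κ + 1 ≠ ∞ := by finiteness
  have hint := integrable_incDensity hf hg
  rw [hE]
  refine le_antisymm (le_of_young hκ1 fun ε hε => ?_) (le_of_young hκ1 fun ε hε => ?_)
  · obtain ⟨c, -, hc1, hc2⟩ := hH.2 ε hε
    refine ⟨mse γ a (trig γ c) f g, fun t ht => ⟨?_, ?_⟩⟩
    · have e : ∀ ω, R ω = S c ω + (incrSum γ (ξ + η) c ω - H ω) := fun ω => by
        simp only [hR, hS]; ring
      simp only [e]
      refine (lintegral_enorm_add_sq_le (hSm c) ht).trans ?_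
      rw [hSc]
      gcongr
      refine le_trans ?_ (hc2.le.trans (le_mul_of_one_le_left' le_add_self))
      exact le_of_eq (lintegral_congr fun ω => by rw [enorm_sub_rev]; rfl)
    · refine (mse_le_of_normSq_sub hf hg a hh ht).trans ?_
      gcongr
      · exact le_self_add
      · rw [normSq_sub_comm]; exact hc1.le
  · obtain ⟨c, -, hc1, hc2⟩ := hH.2 ε hε
    refine ⟨mse γ a (trig γ c) f g, fun t ht => ⟨?_, ?_⟩⟩
    · refine (mse_le_of_normSq_sub hf hg a
        (memL2_trig (isWeight_obsDensity hf hg) hint c).meas ht).trans ?_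
      gcongr
      exact le_self_add
    · have e : ∀ ω, S c ω = R ω + (H ω - incrSum γ (ξ + η) c ω) := fun ω => by
        simp only [hR, hS]; ring
      rw [← hSc]
      simp only [e]
      refine (lintegral_enorm_add_sq_le hRm ht).trans ?_
      gcongr
      exact hc2.le.trans (le_mul_of_one_le_left' le_add_self)

lemma lintegral_enorm_sq_eq (u : Ω → ℂ) : ∫⁻ ω, ‖u ω‖ₑ ^ 2 ∂P = eLpNorm u 2 P ^ 2 := by
  rw [eLpNorm_eq_lintegral_rpow_enorm_toReal (by norm_num) (by norm_num), ← ENNReal.rpow_natCast,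
    ← ENNReal.rpow_mul]
  simp

lemma exists_hasCharacteristic (hf : IsSignalDensity γ f) (hg : IsNoiseDensity g)
    (hM : IsModel γ P ξ η f g) {N : ℕ} {h : VecFun T}
    (hh : h ∈ obsSpace γ N (obsDensity γ f g)) :
    ∃ H, HasCharacteristic γ N P ξ η f g h H := by
  have hp := isWeight_obsDensity hf hg
  have hint := integrable_incDensity hf hg
  have htm := fun c => (memL2_trig hp hint (γ := γ) c).meas
  have hδ0 : ∀ n : ℕ, (0 : ℝ≥0∞) < (2⁻¹) ^ n := fun n => ENNReal.pow_pos (by norm_num) n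
  choose c hc hcn using fun n : ℕ => hh.2 (((2 : ℝ≥0∞)⁻¹ ^ n) ^ 2 / 4)
    (ENNReal.div_pos (ENNReal.pow_pos (hδ0 n) 2).ne' (by norm_num))
  have hκ1 : ENNReal.ofReal (1 / (2 * Real.pi)) ≤ 1 := by
    rw [ENNReal.ofReal_le_one, div_le_one (by positivity)]
    linarith [Real.pi_gt_three]
  obtain ⟨H, hHm, hHt⟩ := Lp.cauchy_complete_eLpNorm (p := 2) (μ := P)
    (f := fun n => incrSum γ (ξ + η) (c n)) (by norm_num)
    (fun n => (spectralSpan_memLp hf hg hM (incrSum_mem_spectralSpan (c n))).1)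
    (B := fun n => (2 : ℝ≥0∞)⁻¹ ^ n) (by
      rw [ENNReal.tsum_geometric]
      simp) (by
      intro K n m hn hm
      have h1 := secondMoment_incrSum_sub hf hg hM (c n) (c m)
      refine lt_of_not_ge fun hge => absurd (pow_le_pow_left' hge 2) (not_le.2 ?_)
      rw [← lintegral_enorm_sq_eq]
      refine lt_of_eq_of_lt h1 ?_
      have e : trig γ (c n) - trig γ (c m) =
          (trig γ (c n) - h) + (h - trig γ (c m)) := by abel
      have h2 := hp.normSq_add_le (v := h - trig γ (c m)) ((htm (c n)).sub hh.1) one_pos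
      rw [← e, inv_one, show ENNReal.ofReal (1 + 1) = 2 by norm_num, ← mul_add,
        normSq_sub_comm _ (trig γ (c n)) h] at h2
      have hanti : ∀ n, K ≤ n → normSq (obsDensity γ f g) (h - trig γ (c n)) <
          ((2 : ℝ≥0∞)⁻¹ ^ K) ^ 2 / 4 := by
        intro n hn
        refine (hcn n).trans_le ?_
        gcongr ?_ ^ 2 / 4
        exact pow_le_pow_right_of_le_one' (by norm_num) hn
      calc ENNReal.ofReal (1 / (2 * Real.pi)) *
            normSq (obsDensity γ f g) (trig γ (c n) - trig γ (c m))
          ≤ 1 * (2 * (normSq (obsDensity γ f g) (h - trig γ (c n)) +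
              normSq (obsDensity γ f g) (h - trig γ (c m)))) := by gcongr
        _ = 2 * (normSq (obsDensity γ f g) (h - trig γ (c n)) +
              normSq (obsDensity γ f g) (h - trig γ (c m))) := one_mul _
        _ < 2 * (((2 : ℝ≥0∞)⁻¹ ^ K) ^ 2 / 4 + ((2 : ℝ≥0∞)⁻¹ ^ K) ^ 2 / 4) :=
            ENNReal.mul_lt_mul_right (by norm_num) (by norm_num)
              (ENNReal.add_lt_add (hanti n hn) (hanti m hm))
        _ = ((2 : ℝ≥0∞)⁻¹ ^ K) ^ 2 := by
            rw [← two_mul, ← mul_assoc, show (2 * 2 : ℝ≥0∞) = 4 by norm_num]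
            exact ENNReal.mul_div_cancel (by norm_num) (by norm_num))
  refine ⟨H, hHm.1, fun ε hε => ?_⟩
  have hlim1 : Filter.Tendsto (fun n : ℕ => ((2 : ℝ≥0∞)⁻¹ ^ n) ^ 2 / 4) Filter.atTop (nhds 0) := by
    have h1 : Filter.Tendsto (fun n : ℕ => (2 : ℝ≥0∞)⁻¹ ^ n) Filter.atTop (nhds 0) :=
      ENNReal.tendsto_pow_atTop_nhds_zero_of_lt_one (by norm_num)
    have h2 := ENNReal.Tendsto.div_const (ENNReal.Tendsto.pow (n := 2) h1)
      (b := 4) (Or.inr (by norm_num))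
    simpa using h2
  have hlim2 := ENNReal.Tendsto.pow (n := 2) hHt
  rw [zero_pow two_ne_zero] at hlim2
  obtain ⟨n, hn1, hn2⟩ :=
    ((hlim1.eventually (gt_mem_nhds hε)).and (hlim2.eventually (gt_mem_nhds hε))).exists
  refine ⟨c n, hc n, (hcn n).trans hn1, ?_⟩
  rw [← lintegral_enorm_sq_eq] at hn2
  refine lt_of_eq_of_lt (lintegral_congr fun ω => ?_) hn2
  rw [enorm_sub_rev]
  rfl

end Estimate

end GMInterp

theorem lemma3p1 {T : ℕ} (γ : Pattern) (N : ℕ) (a : Fin (N + 1) → Fin T → ℂ)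
    (Df Dg : Set (MatFun T))
    (hDf : ∀ f ∈ Df, IsSignalDensity γ f) (hDg : ∀ g ∈ Dg, IsNoiseDensity g)
    (f₀ g₀ : MatFun T) (hf₀ : f₀ ∈ Df) (hg₀ : g₀ ∈ Dg) (hmin : MinimalityCondition γ f₀ g₀)
    -- `(f₀, g₀)` maximizes the error expression, which is defined under the minimality condition
    (hmax : ∀ f ∈ Df, ∀ g ∈ Dg, MinimalityCondition γ f g → errorValue γ a f g ≤ errorValue γ a f₀ g₀) :
    -- `Δ(h; f, g)` is the mean-square error of the estimate with spectral characteristic `h`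
    (∀ (Ω : Type*) [MeasurableSpace Ω] (P : Measure Ω) [IsProbabilityMeasure P]
      (ξ η : ℤ → Fin T → Ω → ℂ), ∀ f ∈ Df, ∀ g ∈ Dg, IsModel γ P ξ η f g →
      ∀ h ∈ obsSpace γ N (obsDensity γ f g),
        (∃ H, HasCharacteristic γ N P ξ η f g h H) ∧
        ∀ H, HasCharacteristic γ N P ξ η f g h H →
          estimateError γ a P ξ η H = mse γ a h f g) ∧
    -- the explicit formula gives the optimal spectral characteristic for `(f₀, g₀)`
    IsOptimal γ a (specChar γ a f₀ g₀) f₀ g₀ ∧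
    -- least favorable densities
    (((∀ f ∈ Df, ∀ g ∈ Dg, MinimalityCondition γ f g) ∨ (Convex ℝ Df ∧ Convex ℝ Dg)) →
      LeastFavorable γ a Df Dg f₀ g₀) ∧
    -- minimax spectral characteristic
    (Convex ℝ Df → Convex ℝ Dg → specChar γ a f₀ g₀ ∈ HD γ N Df Dg →
      IsMinimax γ a Df Dg (specChar γ a f₀ g₀)) := by
  refine ⟨fun Ω _ P _ ξ η f hf g hg hM h hh => ⟨?_, fun H hH => ?_⟩, ?_, ?_, ?_⟩
  · exact exists_hasCharacteristic (hDf f hf) (hDg g hg) hM hh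
  · exact estimateError_eq_mse (hDf f hf) (hDg g hg) hM a hh.1 hH
  · exact isOptimal_specChar (hDf _ hf₀) (hDg _ hg₀) hmin a
  · exact leastFavorable hDf hDg hf₀ hg₀ hmin hmax
  · exact isMinimax hDf hDg hf₀ hg₀ hmin hmax
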